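/- Let $q>1$ be a real number and let $\mathbf n=(n_1,\dots,n_m)$, $\mathbf i=(i_1,\dots,i_m)$ be tuples of non-negative integers with $i_k\le n_k$ for all $k$. Let $n=\sum_k n_k$, let $X_n=\bigoplus_{j=1}^n\mathbb Z\epsilon_j$, whose basis is divided into $m$ consecutive blocks of sizes $n_1,\dots,n_m$, and let $V_n=X_n\otimes\mathbb C$. Let $R_{\mathbf n}$ be the root system of all $\epsilon_a-\epsilon_b$ with $a\ne b$ in the same block, with simple roots $\Delta_{\mathbf n}=\{\epsilon_a-\epsilon_{a+1}\in R_{\mathbf n}\}$, Weyl group $S_{\mathbf n}=S_{n_1}\times\dots\times S_{n_m}$ and length function $l$. The affine Hecke algebra $\mathcal H_{\mathbf n}$ is the unital complex algebra generated by the group algebra $\mathbb C[X_n]$ (with basis $\theta_x$, $x\in X_n$) and elements $T_w$, $w\in S_{\mathbf n}$, with relations $T_1=1$, $T_wT_{w'}=T_{ww'}$ if $l(ww')=l(w)+l(w')$, and, for $\alpha\in\Delta_{\mathbf n}$ and $s=s_\alpha$, $(T_s+1)(T_s-q)=0$ and $T_s\theta_x-\theta_{s(x)}T_s=(q-1)\frac{\theta_x-\theta_{s(x)}}{1-\theta_{-\alpha}}$.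 The graded Hecke algebra $\mathbb H_{\mathbf n}$ is the unital complex algebra generated by the symmetric algebra $S(V_n)$ and elements $t_w$, $w\in S_{\mathbf n}$, with relations $t_1=1$, $t_wt_{w'}=t_{ww'}$, and $v\,t_{s}-t_{s}\,s(v)=\log q\,\langle v,\alpha^\vee\rangle$ for $v\in V_n$, $\alpha\in\Delta_{\mathbf n}$, $s=s_\alpha$. For $\zeta\in V_n^*$ let $\mathbb J_{S_{\mathbf n}\zeta}$ be the ideal of elements of $S(V_n)^{S_{\mathbf n}}$ vanishing at $\zeta$; $\zeta$ is called real for $R_{\mathbf n}$ if $\alpha(\zeta)\in\mathbb R$ for all $\alpha\in R_{\mathbf n}$. The sign projectors of $\mathcal H_{\mathbf n}$ and $\mathbb H_{\mathbf n}$ are $\mathbf S_{\mathbf n}=\big(\sum_w q^{-l(w)}\big)^{-1}\sum_w(-1/q)^{l(w)}T_w$ and $\mathbf s_{\mathbf n}=|S_{\mathbf n}|^{-1}\sum_w(-1)^{l(w)}t_w$, the sums running over $w\in S_{\mathbf n}$. Placing, in the $k$-th block, the first $n_k-i_k$ coordinates before the last $i_k$ gives algebra maps $\mathcal H_{\mathbf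 n-\mathbf i}\otimes\mathcal H_{\mathbf i}\to\mathcal H_{\mathbf n}$ and $\mathbb H_{\mathbf n-\mathbf i}\otimes\mathbb H_{\mathbf i}\to\mathbb H_{\mathbf n}$. Let $\mathbf S^{\mathbf n}_{\mathbf i}$ and $\mathbf s^{\mathbf n}_{\mathbf i}$ be the images of $1\otimes\mathbf S_{\mathbf i}$ and $1\otimes\mathbf s_{\mathbf i}$. For an $\mathcal H_{\mathbf n}$-module $\sigma$ put $\mathbf{BZ}^{\mathbf n}_{\mathbf i}(\sigma)=\mathbf S^{\mathbf n}_{\mathbf i}(\sigma)$, an $\mathcal H_{\mathbf n-\mathbf i}$-module, and for an $\mathbb H_{\mathbf n}$-module $\pi$ put $\mathbf{gBZ}^{\mathbf n}_{\mathbf i}(\pi)=\mathbf s^{\mathbf n}_{\mathbf i}(\pi)$, an $\mathbb H_{\mathbf n-\mathbf i}$-module. Let $\mathcal C_{\mathbf n}$ be the category of finite-dimensional $\mathbb H_{\mathbf n}$-modules that are sums of submodules each annihilated by a power of $\mathbb J_{S_{\mathbf n}\zeta'}$ for some $\zeta'$ real for $R_{\mathbf n}$. Lusztig's functor $\Lambda$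 from $\mathcal C_{\mathbf n}$ to $\mathcal H_{\mathbf n}$-modules keeps the underlying vector spaces and linear maps, and lets $\mathcal H_{\mathbf n}$ act so that $\theta_x$ acts by $e^{x}$ and, for $\alpha\in\Delta_{\mathbf n}$, $T_{s_\alpha}+1$ acts by $(t_{s_\alpha}+1)\,\frac{e^{\alpha}q-1}{e^{\alpha}-1}\cdot\frac{\alpha}{\alpha+\log q}$, where the last factor is the value at the operator $\alpha$ (whose eigenvalues are real) of a function of one variable whose singularities at $0$ and $-\log q$ are removable. **Theorem.** The functors $\Lambda$ on $\mathcal C_{\mathbf n}$ and on $\mathcal C_{\mathbf n-\mathbf i}$ are well defined. Let $\zeta\in V_n^*$ be real for $R_{\mathbf n}$. For every finite-dimensional $\mathbb H_{\mathbf n}$-module $\pi$ annihilated by a power of $\mathbb J_{S_{\mathbf n}\zeta}$, the module $\mathbf{gBZ}^{\mathbf n}_{\mathbf i}(\pi)$ lies in $\mathcal C_{\mathbf n-\mathbf i}$, and there is an isomorphism of $\mathcal H_{\mathbf n-\mathbf i}$-modules $$\mathbf{BZ}^{\mathbf n}_{\mathbf i}(\Lambda(\pi))\cong\Lambda(\mathbf{gBZ}^{\mathbf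 n}_{\mathbf i}(\pi)),$$ natural in $\pi$. -/

import Mathlib

open CategoryTheory
universe u

noncomputable section

namespace HeckeBZ

/-- Coordinates of `X_n`, for `n = (n_1, ..., n_m)`, grouped in `m` consecutive blocks: the pair
`(k, a)` is the `a`-th coordinate of the `k`-th block, so that `X_n` is `Coord n → ℤ`, with basis
`ε_(k,a)`. The roots of `R_n` are the differences `ε_(k,a) - ε_(k,b)`, `a ≠ b`; the simple ones
are those with `b = a + 1`. -/
abbrev Coord {m : ℕ} (n : Fin m → ℕ) : Type := Σ k : Fin m, Fin (n k)
/-- The Weyl group `S_{n_1} × ... × S_{n_m}` of `R_n`. -/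
abbrev Weyl {m : ℕ} (n : Fin m → ℕ) : Type := ∀ k : Fin m, Equiv.Perm (Fin (n k))

/-- The inversions of a permutation. -/
def inversions {N : ℕ} (w : Equiv.Perm (Fin N)) : Finset (Fin N × Fin N) :=
  Finset.univ.filter fun p => p.1 < p.2 ∧ w p.2 < w p.1

/-- The length function of the Weyl group, as the number of positive roots made negative. -/
def len {m : ℕ} {n : Fin m → ℕ} (w : Weyl n) : ℕ := ∑ k, (inversions (w k)).card

/-- The transposition of the coordinates `(k, a)` and `(k, b)`; it is the simple reflection of
`α = ε_(k,a) - ε_(k,b)` when `b = a + 1`. -/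
def simple {m : ℕ} {n : Fin m → ℕ} (k : Fin m) (a b : Fin (n k)) : Weyl n :=
  Pi.mulSingle k (Equiv.swap a b)

/-- The action of the Weyl group on coordinate vectors, `w ε_(k,a) = ε_(k, w a)`. -/
def permute {m : ℕ} {n : Fin m → ℕ} {R : Type} (w : Weyl n) (x : Coord n → R) : Coord n → R :=
  fun c => x ⟨c.1, (w c.1).symm c.2⟩

theorem mem_inversions {N : ℕ} (w : Equiv.Perm (Fin N)) (c d : Fin N) :
    (c, d) ∈ inversions w ↔ c < d ∧ w d < w c := by
  simp [inversions]

theorem inversions_mul_swap {N : ℕ} (w : Equiv.Perm (Fin N)) (a b : Fin N)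
    (hab : (a : ℕ) + 1 = b) (h : w a < w b) :
    (inversions (w * Equiv.swap a b)).card = (inversions w).card + 1 := by
  classical
  have key : inversions (w * Equiv.swap a b) = insert (a, b)
      ((inversions w).image fun p => (Equiv.swap a b p.1, Equiv.swap a b p.2)) := by
    have hs : ∀ c d : Fin N, c < d → (c, d) ≠ (a, b) →
        Equiv.swap a b c < Equiv.swap a b d := by
      intro c d hcd hne
      have hne' : ¬ (c = a ∧ d = b) := by simpa using hne
      simp only [Equiv.swap_apply_def, Fin.lt_def, Fin.ext_iff] at *
      split_ifs <;> simp_all <;> omega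
    ext ⟨c, d⟩
    simp only [mem_inversions, Finset.mem_insert, Finset.mem_image, Prod.exists,
      Equiv.Perm.mul_apply]
    constructor
    · rintro ⟨h1, h2⟩
      by_cases hne : (c, d) = (a, b)
      · exact Or.inl hne
      · exact Or.inr ⟨_, _, ⟨hs c d h1 hne, h2⟩, by simp⟩
    · rintro (heq | ⟨c', d', ⟨h1, h2⟩, heq⟩)
      · obtain ⟨rfl, rfl⟩ := Prod.mk.inj heq
        refine ⟨by rw [Fin.lt_def]; omega, by simpa using h⟩
      · obtain ⟨rfl, rfl⟩ := Prod.mk.inj heq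
        refine ⟨hs _ _ h1 ?_, by simpa using h2⟩
        rintro heq2
        obtain ⟨rfl, rfl⟩ := Prod.mk.inj heq2
        exact absurd h2 (not_lt.2 h.le)
  rw [key, Finset.card_insert_of_notMem, Finset.card_image_of_injective]
  · intro p p' hp
    simpa [Prod.ext_iff] using hp
  · simp only [mem_inversions, Finset.mem_image, Prod.exists, not_exists, not_and]
    rintro c d ⟨h1, -⟩ heq
    obtain ⟨h2, h3⟩ := Prod.mk.inj heq
    rw [Equiv.swap_apply_eq_iff, Equiv.swap_apply_left] at h2
    rw [Equiv.swap_apply_eq_iff, Equiv.swap_apply_right] at h3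
    subst h2 h3
    rw [Fin.lt_def] at h1
    omega

theorem exists_descent {N : ℕ} (w : Equiv.Perm (Fin N)) (hw : w ≠ 1) :
    ∃ a b : Fin N, (a : ℕ) + 1 = b ∧ w b < w a := by
  by_contra! hcon
  apply hw
  cases N with
  | zero => exact Subsingleton.elim _ _
  | succ N =>
    have hm : StrictMono w := by
      rw [Fin.strictMono_iff_lt_succ]
      intro i
      refine lt_of_le_of_ne (hcon _ _ (by simp)) ?_
      intro h
      exact absurd (w.injective h) (Fin.castSucc_lt_succ).ne
    have h := Subsingleton.elim (hm.orderIsoOfSurjective w w.surjective) (OrderIso.refl _)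
    ext x
    exact congrArg Fin.val (DFunLike.congr_fun h x)

theorem weyl_induction {m : ℕ} {n : Fin m → ℕ} {P : Weyl n → Prop} (one : P 1)
    (step : ∀ (w : Weyl n) (k : Fin m) (a b : Fin (n k)), (a : ℕ) + 1 = b →
      len (simple k a b : Weyl n) = 1 → len (w * simple k a b) = len w + 1 → P w → P (w * simple k a b)) (w : Weyl n) : P w := by
  classical
  have hl : ∀ (w : Weyl n) (k : Fin m) (a b : Fin (n k)), (a : ℕ) + 1 = b → w k a < w k b →
      len (w * simple k a b) = len w + 1 := by
    intro w k a b hab h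
    unfold len
    rw [← Finset.add_sum_erase _ _ (Finset.mem_univ k),
      ← Finset.add_sum_erase (a := k) _ (fun k => (inversions (w k)).card) (Finset.mem_univ k)]
    have : ∑ x ∈ Finset.univ.erase k, (inversions ((w * simple k a b) x)).card =
        ∑ x ∈ Finset.univ.erase k, (inversions (w x)).card := by
      refine Finset.sum_congr rfl fun x hx => ?_
      rw [Pi.mul_apply, simple, Pi.mulSingle_eq_of_ne (Finset.ne_of_mem_erase hx), mul_one]
    rw [this, Pi.mul_apply, simple, Pi.mulSingle_eq_same, inversions_mul_swap _ _ _ hab h]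
    ring
  induction hN : len w using Nat.strong_induction_on generalizing w with
  | _ N ih =>
    by_cases hw : w = 1
    · exact hw ▸ one
    · obtain ⟨k, hk⟩ : ∃ k, w k ≠ 1 := by
        by_contra! h
        exact hw (funext h)
      obtain ⟨a, b, hab, hd⟩ := exists_descent (w k) hk
      have hss : (simple k a b : Weyl n) * simple k a b = 1 := by
        rw [simple, ← Pi.mulSingle_mul, Equiv.swap_mul_self, Pi.mulSingle_one]
      have e : w = (w * simple k a b) * simple k a b := by
        rw [mul_assoc, hss, mul_one]
      have h2 := hl (w * simple k a b) k a b hab (by simpa [simple] using hd)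
      have h1 : len (simple k a b : Weyl n) = 1 := by
        have := hl 1 k a b hab (show a < b by rw [Fin.lt_def]; omega)
        rw [one_mul] at this
        rw [this]
        simp only [len, Nat.add_eq_right, Finset.sum_eq_zero_iff, Finset.card_eq_zero]
        intro x _
        ext ⟨c, d⟩
        simpa [mem_inversions] using fun h => le_of_lt h
      rw [← e] at h2
      rw [e]
      exact step _ k a b hab h1 (by rw [← e]; exact h2) (ih _ (by omega) _ rfl)

theorem inversions_mul_of_separated {N : ℕ} (u v : Equiv.Perm (Fin N)) (c : ℕ)
    (hu : ∀ x : Fin N, c ≤ x → u x = x) (hv : ∀ x : Fin N, (x : ℕ) < c → v x = x) :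
    (inversions (u * v)).card = (inversions u).card + (inversions v).card := by
  classical
  have hu2 : ∀ x : Fin N, (x : ℕ) < c → (u x : ℕ) < c := by
    intro x hx
    by_contra! hcon
    have := u.injective (hu _ hcon)
    rw [this] at hcon
    omega
  have hv2 : ∀ x : Fin N, c ≤ x → c ≤ v x := by
    intro x hx
    by_contra! hcon
    have := v.injective (hv _ hcon)
    rw [this] at hcon
    omega
  rw [← Finset.card_union_of_disjoint]
  · congr 1
    ext ⟨x, y⟩
    simp only [Finset.mem_union, mem_inversions, Equiv.Perm.mul_apply, Fin.lt_def]
    rcases lt_or_ge (x : ℕ) c with hx | hx <;> rcases lt_or_ge (y : ℕ) c with hy | hy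
    · rw [hv x hx, hv y hy]
      constructor
      · exact fun h => Or.inl h
      · rintro (h | h)
        · exact h
        · omega
    · rw [hv x hx, hu _ (hv2 y hy), hu y hy]
      have := hu2 x hx
      have := hv2 y hy
      omega
    · omega
    · rw [hu _ (hv2 y hy), hu _ (hv2 x hx), hu y hy, hu x hx]
      omega
  · rw [Finset.disjoint_left]
    rintro ⟨x, y⟩ h1 h2
    simp only [mem_inversions, Fin.lt_def] at h1 h2
    rcases lt_or_ge (x : ℕ) c with hx | hx <;> rcases lt_or_ge (y : ℕ) c with hy | hy
    · rw [hv x hx, hv y hy] at h2; omega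
    · have := hv2 y hy
      rw [hv x hx] at h2; omega
    · omega
    · rw [hu x hx, hu y hy] at h1; omega

section Blocks

variable {m : ℕ} {n p p' d d' : Fin m → ℕ}

/-- The inclusion `a ↦ d k + a` of the `k`-th block of `p` into the `k`-th block of `n`. -/
def blk (h : ∀ k, d k + p k ≤ n k) (k : Fin m) : Fin (p k) ↪ Fin (n k) where
  toFun a := ⟨d k + a, by have := h k; omega⟩
  inj' a b hab := by
    have := congrArg Fin.val hab
    simp only at this
    exact Fin.ext (by omega)

theorem blk_val (h : ∀ k, d k + p k ≤ n k) (k : Fin m) (a : Fin (p k)) :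
    (blk h k a : ℕ) = d k + a := rfl

/-- The induced inclusion of coordinates. -/
def embCoord (h : ∀ k, d k + p k ≤ n k) : Coord p ↪ Coord n where
  toFun c := ⟨c.1, blk h c.1 c.2⟩
  inj' := by
    rintro ⟨k, a⟩ ⟨k', a'⟩ hab
    obtain ⟨h1, h2⟩ := Sigma.mk.inj hab
    subst h1
    have h3 : a = a' := (blk h k).injective (eq_of_heq h2)
    rw [h3]

/-- The induced inclusion of Weyl groups. -/
def embWeyl (h : ∀ k, d k + p k ≤ n k) : Weyl p →* Weyl n where
  toFun w k := (w k).viaEmbedding (blk h k)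
  map_one' := by
    funext k
    exact map_one (Equiv.Perm.viaEmbeddingHom (blk h k))
  map_mul' w w' := by
    funext k
    exact map_mul (Equiv.Perm.viaEmbeddingHom (blk h k)) (w k) (w' k)

/-- Extension of coordinate vectors by zero. -/
def embVec (h : ∀ k, d k + p k ≤ n k) {R : Type} [AddMonoid R] :
    (Coord p → R) →+ (Coord n → R) where
  toFun x := Function.extend (embCoord h) x 0
  map_zero' := by
    funext c
    by_cases hc : ∃ c', embCoord h c' = c
    · obtain ⟨c', rfl⟩ := hc
      rw [(embCoord h).injective.extend_apply]; rfl
    · rw [Function.extend_apply' _ _ _ hc]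
  map_add' x y := by
    funext c
    by_cases hc : ∃ c', embCoord h c' = c
    · obtain ⟨c', rfl⟩ := hc
      simp only [Pi.add_apply, (embCoord h).injective.extend_apply]
    · simp only [Pi.add_apply, Function.extend_apply' _ _ _ hc, Pi.zero_apply, add_zero]

theorem embVec_apply (h : ∀ k, d k + p k ≤ n k) {R : Type} [AddMonoid R] (x : Coord p → R)
    (c : Coord p) : embVec h x (embCoord h c) = x c :=
  (embCoord h).injective.extend_apply _ _ _

theorem embVec_apply_mk (h : ∀ k, d k + p k ≤ n k) {R : Type} [AddMonoid R] (x : Coord p → R)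
    (k : Fin m) (a : Fin (p k)) : embVec h x ⟨k, blk h k a⟩ = x ⟨k, a⟩ :=
  embVec_apply h x ⟨k, a⟩

theorem embVec_apply_of_notMem (h : ∀ k, d k + p k ≤ n k) {R : Type} [AddMonoid R]
    (x : Coord p → R) (c : Coord n) (hc : ¬ ∃ c', embCoord h c' = c) : embVec h x c = 0 :=
  Function.extend_apply' _ _ _ hc

theorem embWeyl_apply (h : ∀ k, d k + p k ≤ n k) (w : Weyl p) (k : Fin m) (a : Fin (p k)) :
    embWeyl h w k (blk h k a) = blk h k (w k a) :=
  Equiv.Perm.viaEmbedding_apply _ _ _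

theorem embWeyl_apply_of_notMem (h : ∀ k, d k + p k ≤ n k) (w : Weyl p) (k : Fin m)
    (x : Fin (n k)) (hx : x ∉ Set.range (blk h k)) : embWeyl h w k x = x :=
  Equiv.Perm.viaEmbedding_apply_of_notMem _ _ _ hx

theorem mem_range_blk (h : ∀ k, d k + p k ≤ n k) (k : Fin m) (x : Fin (n k)) :
    x ∈ Set.range (blk h k) ↔ d k ≤ x ∧ (x : ℕ) < d k + p k := by
  constructor
  · rintro ⟨a, rfl⟩
    have := a.2
    rw [blk_val]
    omega
  · rintro ⟨h1, h2⟩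
    exact ⟨⟨x - d k, by omega⟩, Fin.ext (by rw [blk_val]; show d k + (x - d k) = (x : ℕ); omega)⟩

theorem permute_embVec (h : ∀ k, d k + p k ≤ n k) {R : Type} [AddMonoid R] (w : Weyl p)
    (x : Coord p → R) : permute (embWeyl h w) (embVec h x) = embVec h (permute w x) := by
  funext ⟨k, c⟩
  by_cases hc : c ∈ Set.range (blk h k)
  · obtain ⟨a, rfl⟩ := hc
    rw [embVec_apply_mk]
    have : (embWeyl h w k).symm (blk h k a) = blk h k ((w k).symm a) := by
      rw [Equiv.symm_apply_eq, embWeyl_apply, Equiv.apply_symm_apply]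
    simp only [permute, this, embVec_apply_mk]
  · have hc2 : ¬ ∃ c', embCoord h c' = (⟨k, c⟩ : Coord n) := by
      rintro ⟨⟨k', a⟩, hk⟩
      obtain ⟨h1, h2⟩ := Sigma.mk.inj hk
      subst h1
      exact hc ⟨a, eq_of_heq h2⟩
    have : (embWeyl h w k).symm c = c := by
      rw [Equiv.symm_apply_eq, embWeyl_apply_of_notMem h w k c hc]
    simp only [permute, this]
    rw [embVec_apply_of_notMem h _ _ hc2, embVec_apply_of_notMem h _ _ hc2]

theorem embWeyl_simple (h : ∀ k, d k + p k ≤ n k) (k : Fin m) (a b : Fin (p k)) :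
    embWeyl h (simple k a b) = simple k (blk h k a) (blk h k b) := by
  funext k'
  by_cases hk : k' = k
  · subst hk
    ext x
    by_cases hx : x ∈ Set.range (blk h k')
    · obtain ⟨y, rfl⟩ := hx
      rw [embWeyl_apply]
      simp only [simple, Pi.mulSingle_eq_same]
      rw [(blk h k').injective.swap_apply]
    · rw [embWeyl_apply_of_notMem h _ _ _ hx]
      simp only [simple, Pi.mulSingle_eq_same]
      rw [Equiv.swap_apply_of_ne_of_ne]
      · rintro rfl; exact hx ⟨_, rfl⟩
      · rintro rfl; exact hx ⟨_, rfl⟩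
  · have h1 : (simple k a b : Weyl p) k' = 1 := Pi.mulSingle_eq_of_ne hk _
    have h2 : (simple k (blk h k a) (blk h k b) : Weyl n) k' = 1 := Pi.mulSingle_eq_of_ne hk _
    rw [h2]
    show Equiv.Perm.viaEmbedding (simple k a b k') _ = 1
    rw [h1]
    exact map_one (Equiv.Perm.viaEmbeddingHom (blk h k'))

theorem len_embWeyl (h : ∀ k, d k + p k ≤ n k) (w : Weyl p) : len (embWeyl h w) = len w := by
  refine Finset.sum_congr rfl fun k _ => ?_
  rw [← Finset.card_map ((blk h k).prodMap (blk h k))]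
  congr 1
  have lt_iff : ∀ a b : Fin (p k), blk h k a < blk h k b ↔ a < b := by
    intro a b
    simp only [Fin.lt_def, blk_val]
    omega
  ext ⟨x, y⟩
  simp only [Finset.mem_map, Prod.exists, mem_inversions, Function.Embedding.prodMap,
    Function.Embedding.coeFn_mk, Prod.map, Prod.mk.injEq]
  constructor
  · rintro ⟨h1, h2⟩
    by_cases hx : x ∈ Set.range (blk h k) <;> by_cases hy : y ∈ Set.range (blk h k)
    · obtain ⟨a, rfl⟩ := hx
      obtain ⟨b, rfl⟩ := hy
      rw [embWeyl_apply, embWeyl_apply] at h2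
      exact ⟨a, b, ⟨(lt_iff _ _).1 h1, (lt_iff _ _).1 h2⟩, rfl, rfl⟩
    · obtain ⟨a, rfl⟩ := hx
      rw [embWeyl_apply, embWeyl_apply_of_notMem h _ _ _ hy] at h2
      have e1 := (mem_range_blk h k _).1 ⟨a, rfl⟩
      have e2 := (mem_range_blk h k _).1 ⟨w k a, rfl⟩
      rw [mem_range_blk] at hy
      rw [Fin.lt_def] at h1 h2
      omega
    · obtain ⟨b, rfl⟩ := hy
      rw [embWeyl_apply, embWeyl_apply_of_notMem h _ _ _ hx] at h2
      have e1 := (mem_range_blk h k _).1 ⟨b, rfl⟩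
      have e2 := (mem_range_blk h k _).1 ⟨w k b, rfl⟩
      rw [mem_range_blk] at hx
      rw [Fin.lt_def] at h1 h2
      omega
    · rw [embWeyl_apply_of_notMem h _ _ _ hx, embWeyl_apply_of_notMem h _ _ _ hy] at h2
      exact absurd h1 (lt_asymm h2)
  · rintro ⟨a, b, ⟨h1, h2⟩, rfl, rfl⟩
    rw [embWeyl_apply, embWeyl_apply, lt_iff, lt_iff]
    exact ⟨h1, h2⟩

theorem len_embWeyl_mul (h : ∀ k, d k + p k ≤ n k) (h' : ∀ k, d' k + p' k ≤ n k)
    (hd : ∀ k, d k + p k ≤ d' k) (w : Weyl p) (w' : Weyl p') :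
    len (embWeyl h w * embWeyl h' w') = len (embWeyl h w) + len (embWeyl h' w') := by
  unfold len
  rw [← Finset.sum_add_distrib]
  refine Finset.sum_congr rfl fun k _ => inversions_mul_of_separated _ _ (d' k) ?_ ?_
  · intro x hx
    refine embWeyl_apply_of_notMem h _ _ _ fun hcon => ?_
    rw [mem_range_blk] at hcon
    have := hd k
    omega
  · intro x hx
    refine embWeyl_apply_of_notMem h' _ _ _ fun hcon => ?_
    rw [mem_range_blk] at hcon
    omega

theorem embWeyl_commute (h : ∀ k, d k + p k ≤ n k) (h' : ∀ k, d' k + p' k ≤ n k)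
    (hd : ∀ k, d k + p k ≤ d' k) (w : Weyl p) (w' : Weyl p') :
    Commute (embWeyl h w) (embWeyl h' w') := by
  have hn : ∀ (k : Fin m) (x : Fin (n k)), x ∈ Set.range (blk h k) →
      x ∉ Set.range (blk h' k) := by
    intro k x hx
    rw [mem_range_blk] at hx ⊢
    have := hd k
    omega
  funext k
  ext x
  simp only [Pi.mul_apply, Equiv.Perm.mul_apply]
  by_cases hx : x ∈ Set.range (blk h k)
  · have h1 := embWeyl_apply_of_notMem h' w' k x (hn k x hx)
    obtain ⟨a, rfl⟩ := hx
    rw [h1, embWeyl_apply, embWeyl_apply_of_notMem h' w' k _ (hn k _ ⟨_, rfl⟩)]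
  · rw [embWeyl_apply_of_notMem h w k x hx]
    by_cases hx' : x ∈ Set.range (blk h' k)
    · obtain ⟨a, rfl⟩ := hx'
      rw [embWeyl_apply, embWeyl_apply_of_notMem h w k]
      exact fun hcon => hn k _ hcon ⟨_, rfl⟩
    · rw [embWeyl_apply_of_notMem h' w' k x hx', embWeyl_apply_of_notMem h w k x hx]

theorem permute_embVec_of_disjoint (h : ∀ k, d k + p k ≤ n k) (h' : ∀ k, d' k + p' k ≤ n k)
    (hd : ∀ k, d k + p k ≤ d' k) {R : Type} [AddMonoid R] (x : Coord p → R) (w' : Weyl p') :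
    permute (embWeyl h' w') (embVec h x) = embVec h x := by
  have hz : ∀ (k : Fin m) (c : Fin (n k)), c ∈ Set.range (blk h' k) →
      embVec h x ⟨k, c⟩ = 0 := by
    intro k c hc
    refine embVec_apply_of_notMem h _ _ ?_
    rintro ⟨⟨k', a⟩, hk⟩
    obtain ⟨h1, h2⟩ := Sigma.mk.inj hk
    subst h1
    have e := (mem_range_blk h k' c).1 ⟨a, eq_of_heq h2⟩
    have hc2 := (mem_range_blk h' k' c).1 hc
    have := hd k'
    omega
  funext ⟨k, c⟩
  simp only [permute]
  by_cases hc : c ∈ Set.range (blk h' k)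
  · rw [hz k c hc]
    obtain ⟨a, rfl⟩ := hc
    have : (embWeyl h' w' k).symm (blk h' k a) = blk h' k ((w' k).symm a) := by
      rw [Equiv.symm_apply_eq, embWeyl_apply, Equiv.apply_symm_apply]
    rw [this, hz k _ ⟨_, rfl⟩]
  · have : (embWeyl h' w' k).symm c = c := by
      rw [Equiv.symm_apply_eq, embWeyl_apply_of_notMem h' w' k c hc]
    rw [this]

end Blocks

/-! ### The affine Hecke algebra -/

/-- The root `ε_(k,a) - ε_(k,b)`. -/
def root {m : ℕ} {n : Fin m → ℕ} {R : Type} [Ring R] (k : Fin m) (a b : Fin (n k)) :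
    Coord n → R :=
  Pi.single ⟨k, a⟩ 1 - Pi.single ⟨k, b⟩ 1

/-- The group algebra `𝒜 = ℂ[X]` of the lattice `X = ⨁ ℤ ε_(k,a)`. -/
abbrev Laurent {m : ℕ} (n : Fin m → ℕ) : Type := AddMonoidAlgebra ℂ (Coord n → ℤ)

/-- The basis element `θ_x` of `ℂ[X]`. -/
def monom {m : ℕ} {n : Fin m → ℕ} (x : Coord n → ℤ) : Laurent n := AddMonoidAlgebra.single x 1

/-- The free algebra on symbols `T_w`, `w ∈ W`, and on the elements of `ℂ[X]`. -/
abbrev AffineFree {m : ℕ} (n : Fin m → ℕ) : Type := FreeAlgebra ℂ (Weyl n ⊕ Laurent n)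

namespace AffineFree
def T {m : ℕ} {n : Fin m → ℕ} (w : Weyl n) : AffineFree n := FreeAlgebra.ι ℂ (Sum.inl w)
def A {m : ℕ} {n : Fin m → ℕ} (f : Laurent n) : AffineFree n := FreeAlgebra.ι ℂ (Sum.inr f)
end AffineFree

open AffineFree in
/-- The defining relations of the affine Hecke algebra `ℋ(X, R, Δ, q)`. In the last one, the
quotient `(θ_x - θ_{s x}) / (1 - θ_{-α})` is the unique `f ∈ ℂ[X]` with
`f (1 - θ_{-α}) = θ_x - θ_{s x}`. -/
inductive AffineRel (q : ℝ) {m : ℕ} (n : Fin m → ℕ) : AffineFree n → AffineFree n → Prop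
  | add (f g : Laurent n) : AffineRel q n (A (f + g)) (A f + A g)
  | mul (f g : Laurent n) : AffineRel q n (A (f * g)) (A f * A g)
  | scalar (c : ℂ) : AffineRel q n (A (algebraMap ℂ _ c)) (algebraMap ℂ _ c)
  | one : AffineRel q n (T 1) 1
  | length (w w' : Weyl n) (h : len (w * w') = len w + len w') :
      AffineRel q n (T w * T w') (T (w * w'))
  | quadratic (k : Fin m) (a b : Fin (n k)) (hab : (a : ℕ) + 1 = b) :
      AffineRel q n ((T (simple k a b) + 1) * (T (simple k a b) - algebraMap ℂ _ (q : ℂ))) 0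
  | cross (k : Fin m) (a b : Fin (n k)) (hab : (a : ℕ) + 1 = b) (x : Coord n → ℤ)
      (f : Laurent n)
      (hf : f * (1 - monom (-root k a b)) = monom x - monom (permute (simple k a b) x)) :
      AffineRel q n
        (T (simple k a b) * A (monom x) - A (monom (permute (simple k a b) x)) * T (simple k a b))
        (((q : ℂ) - 1) • A f)

/-- The affine Hecke algebra `ℋ_n = ℋ(X_n, R_n, Δ_n, q)`. -/
def AffineHecke (q : ℝ) {m : ℕ} (n : Fin m → ℕ) : Type := RingQuot (AffineRel q n)

instance (q : ℝ) {m : ℕ} (n : Fin m → ℕ) : Ring (AffineHecke q n) :=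
  inferInstanceAs (Ring (RingQuot (AffineRel q n)))

instance (q : ℝ) {m : ℕ} (n : Fin m → ℕ) : Algebra ℂ (AffineHecke q n) :=
  inferInstanceAs (Algebra ℂ (RingQuot (AffineRel q n)))

namespace AffineHecke

variable (q : ℝ) {m : ℕ} {n p p' d d' : Fin m → ℕ}

/-- The projection of the free algebra onto `ℋ_n`. -/
def mk (n : Fin m → ℕ) : AffineFree n →ₐ[ℂ] AffineHecke q n := RingQuot.mkAlgHom ℂ (AffineRel q n)

variable {q} in
theorem mk_rel {x y : AffineFree n} (h : AffineRel q n x y) : mk q n x = mk q n y :=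
  RingQuot.mkAlgHom_rel ℂ h

/-- The element `T_w`. -/
def T (w : Weyl n) : AffineHecke q n := mk q n (AffineFree.T w)

/-- The algebra map `ℂ[X] → ℋ_n`. -/
def ofLaurent (n : Fin m → ℕ) : Laurent n →ₐ[ℂ] AffineHecke q n where
  toFun f := mk q n (AffineFree.A f)
  map_add' f g := by rw [← map_add]; exact mk_rel (.add f g)
  map_mul' f g := by rw [← map_mul]; exact mk_rel (.mul f g)
  commutes' c := (mk_rel (.scalar c)).trans (AlgHom.commutes _ c)
  map_zero' := by
    have := mk_rel (q := q) (n := n) (.scalar 0)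
    rw [map_zero, map_zero] at this
    rw [this, map_zero]
  map_one' := by
    have := mk_rel (q := q) (n := n) (.scalar 1)
    rw [map_one, map_one] at this
    rw [this, map_one]

/-- The element `θ_x`. -/
def theta (x : Coord n → ℤ) : AffineHecke q n := ofLaurent q n (monom x)

theorem T_one : T q (1 : Weyl n) = 1 := (mk_rel .one).trans (map_one _)

theorem T_mul (w w' : Weyl n) (h : len (w * w') = len w + len w') :
    T q w * T q w' = T q (w * w') := by
  rw [T, T, ← map_mul]; exact mk_rel (.length w w' h)

theorem quadratic (k : Fin m) (a b : Fin (n k)) (hab : (a : ℕ) + 1 = b) :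
    (T q (simple k a b : Weyl n) + 1) * (T q (simple k a b) - algebraMap ℂ _ (q : ℂ)) = 0 := by
  have := mk_rel (q := q) (.quadratic k a b hab)
  simp only [map_mul, map_add, map_sub, map_one, map_zero, AlgHom.commutes] at this
  exact this

theorem cross (k : Fin m) (a b : Fin (n k)) (hab : (a : ℕ) + 1 = b) (x : Coord n → ℤ)
    (f : Laurent n)
    (hf : f * (1 - monom (-root k a b)) = monom x - monom (permute (simple k a b) x)) :
    T q (simple k a b) * theta q x - theta q (permute (simple k a b) x) * T q (simple k a b)
      = ((q : ℂ) - 1) • ofLaurent q n f := by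
  have := mk_rel (q := q) (.cross k a b hab x f hf)
  simp only [map_mul, map_sub, map_smul] at this
  exact this

/-- The universal property of `ℋ_n`. -/
def liftHom {B : Type} [Ring B] [Algebra ℂ B] (f : AffineFree n →ₐ[ℂ] B)
    (hf : ∀ x y, AffineRel q n x y → f x = f y) : AffineHecke q n →ₐ[ℂ] B :=
  RingQuot.liftAlgHom ℂ ⟨f, fun x y h => hf x y h⟩

theorem liftHom_mk {B : Type} [Ring B] [Algebra ℂ B] (f : AffineFree n →ₐ[ℂ] B)
    (hf : ∀ x y, AffineRel q n x y → f x = f y) (x : AffineFree n) :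
    liftHom q f hf (mk q n x) = f x :=
  RingQuot.liftAlgHom_mkAlgHom_apply ℂ f (fun x y h => hf x y h) x

/-- A subalgebra containing all `T_w` and all `θ_x` is everything. -/
theorem mem_of_generators (S : Subalgebra ℂ (AffineHecke q n)) (hT : ∀ w, T q w ∈ S)
    (hX : ∀ x, theta q x ∈ S) (z : AffineHecke q n) : z ∈ S := by
  have hA : ∀ f, ofLaurent q n f ∈ S := by
    intro f
    induction f using AddMonoidAlgebra.induction_on with
    | of x => exact hX _
    | add f g hf hg => rw [map_add]; exact S.add_mem hf hg
    | smul r f hf => rw [map_smul]; exact S.smul_mem hf r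
  obtain ⟨y, rfl⟩ := RingQuot.mkAlgHom_surjective ℂ (AffineRel q n) z
  change mk q n y ∈ S
  induction y using FreeAlgebra.induction with
  | grade0 c => rw [AlgHom.commutes]; exact S.algebraMap_mem c
  | grade1 x =>
    cases x with
    | inl w => exact hT w
    | inr f => exact hA f
  | mul a b ha hb => rw [map_mul]; exact S.mul_mem ha hb
  | add a b ha hb => rw [map_add]; exact S.add_mem ha hb

theorem embVec_root (h : ∀ k, d k + p k ≤ n k) (R : Type) [Ring R] (k : Fin m) (a b : Fin (p k)) :
    embVec h (root k a b : Coord p → R) = root k (blk h k a) (blk h k b) := by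
  have hs : ∀ c : Coord p, embVec h (Pi.single c 1 : Coord p → R) = Pi.single (embCoord h c) 1 := by
    intro c
    funext c'
    by_cases hc : ∃ c'', embCoord h c'' = c'
    · obtain ⟨c'', rfl⟩ := hc
      rw [embVec_apply]
      by_cases e : c'' = c
      · subst e; simp
      · rw [Pi.single_eq_of_ne e, Pi.single_eq_of_ne]
        exact fun h2 => e ((embCoord h).injective h2)
    · rw [embVec_apply_of_notMem h _ _ hc, Pi.single_eq_of_ne]
      rintro rfl; exact hc ⟨_, rfl⟩
  rw [root, map_sub, hs, hs]
  rfl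

/-- The map `θ_x ↦ θ_{x}` between group algebras induced by extension by zero. -/
def embLaurent (h : ∀ k, d k + p k ≤ n k) : Laurent p →ₐ[ℂ] Laurent n :=
  AddMonoidAlgebra.mapDomainAlgHom ℂ ℂ (embVec h)

theorem embLaurent_monom (h : ∀ k, d k + p k ≤ n k) (x : Coord p → ℤ) :
    embLaurent h (monom x) = monom (embVec h x) := by
  simp [embLaurent, monom]

/-- The embedding `ℋ_p → ℋ_n` with `T_w ↦ T_w` and `θ_x ↦ θ_x`, after the `k`-th block of `p` is
placed inside the `k`-th block of `n` with offset `d k`. -/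
def emb (h : ∀ k, d k + p k ≤ n k) : AffineHecke q p →ₐ[ℂ] AffineHecke q n :=
  liftHom q (FreeAlgebra.lift ℂ
    (Sum.elim (fun w => T q (embWeyl h w)) (fun f => ofLaurent q n (embLaurent h f)))) (by
    intro x y hxy
    cases hxy with
    | add f g => simp [AffineFree.A]
    | mul f g => simp [AffineFree.A]
    | scalar c =>
      simp only [AffineFree.A, FreeAlgebra.lift_ι_apply, Sum.elim_inr, AlgHom.commutes]
    | one => simp [AffineFree.T, T_one]
    | length w w' hl =>
      simp only [AffineFree.T, map_mul, FreeAlgebra.lift_ι_apply, Sum.elim_inl]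
      rw [T_mul]
      rw [← map_mul, len_embWeyl, len_embWeyl, len_embWeyl, hl]
    | quadratic k a b hab =>
      simp only [AffineFree.T, map_mul, map_add, map_sub, map_one, map_zero, AlgHom.commutes,
        FreeAlgebra.lift_ι_apply, Sum.elim_inl, embWeyl_simple]
      exact quadratic q k _ _ (by rw [blk_val, blk_val]; omega)
    | cross k a b hab x f hf =>
      simp only [AffineFree.T, AffineFree.A, map_mul, map_sub, map_smul,
        FreeAlgebra.lift_ι_apply, Sum.elim_inl, Sum.elim_inr, embLaurent_monom, ← permute_embVec,
        embWeyl_simple]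
      refine cross q k _ _ (by rw [blk_val, blk_val]; omega) _ _ ?_
      have := congrArg (embLaurent h) hf
      simpa only [map_mul, map_sub, map_one, embLaurent_monom, map_neg, embVec_root,
        ← permute_embVec, embWeyl_simple] using this)

theorem emb_T (h : ∀ k, d k + p k ≤ n k) (w : Weyl p) : emb q h (T q w) = T q (embWeyl h w) := by
  rw [T, emb, liftHom_mk]
  simp [AffineFree.T]

theorem emb_theta (h : ∀ k, d k + p k ≤ n k) (x : Coord p → ℤ) :
    emb q h (theta q x) = theta q (embVec h x) := by
  rw [theta, theta, ← embLaurent_monom]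
  change emb q h (mk q p _) = _
  rw [emb, liftHom_mk]
  simp [AffineFree.A]

/-- The sign projector
`𝐒 = (∑_w (1/q)^{l(w)})⁻¹ ∑_w (-1/q)^{l(w)} T_w` of `ℋ_n`. -/
def signProj (n : Fin m → ℕ) : AffineHecke q n :=
  (∑ w : Weyl n, (1 / (q : ℂ)) ^ len w)⁻¹ • ∑ w : Weyl n, (-1 / (q : ℂ)) ^ len w • T q w

theorem theta_commute_T (h : ∀ k, d k + p k ≤ n k) (h' : ∀ k, d' k + p' k ≤ n k)
    (hd : ∀ k, d k + p k ≤ d' k) (x : Coord p → ℤ) (w : Weyl p') :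
    Commute (theta q (embVec h x)) (T q (embWeyl h' w)) := by
  induction w using weyl_induction with
  | one => rw [map_one, T_one]; exact Commute.one_right _
  | step w k a b hab h1 hl ih =>
    rw [map_mul, ← T_mul]
    · refine ih.mul_right ?_
      have hp := permute_embVec_of_disjoint h h' hd x (simple k a b)
      rw [embWeyl_simple] at hp ⊢
      have := cross q k (blk h' k a) (blk h' k b) (by rw [blk_val, blk_val]; omega)
        (embVec h x) 0 (by rw [hp, zero_mul, sub_self])
      rw [hp, map_zero, smul_zero, sub_eq_zero] at this
      exact this.symm
    · rw [← map_mul, len_embWeyl, len_embWeyl, len_embWeyl, hl, h1]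

theorem emb_commute (h : ∀ k, d k + p k ≤ n k) (h' : ∀ k, d' k + p' k ≤ n k)
    (hd : ∀ k, d k + p k ≤ d' k) (z : AffineHecke q p) :
    Commute (emb q h z) (emb q h' (signProj q p')) := by
  suffices ∀ w : Weyl p', Commute (emb q h z) (T q (embWeyl h' w)) by
    simp only [signProj, map_smul, map_sum, emb_T]
    exact (Commute.sum_right _ _ _ fun w _ => (this w).smul_right _).smul_right _
  intro w
  have := mem_of_generators q
    ((Subalgebra.centralizer ℂ {T q (embWeyl h' w)}).comap (emb q h)) ?_ ?_ z
  · exact ((Subalgebra.mem_centralizer_iff ℂ).1 this _ rfl).symm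
  · intro w'
    refine (Subalgebra.mem_centralizer_iff ℂ).2 ?_
    rintro _ rfl
    change _ * emb q h (T q w') = emb q h (T q w') * _
    have hl := len_embWeyl_mul h h' hd w' w
    rw [emb_T, T_mul q (embWeyl h w') _ hl, T_mul, (embWeyl_commute h h' hd w' w).eq]
    rw [← (embWeyl_commute h h' hd w' w).eq, hl, add_comm]
  · intro x
    refine (Subalgebra.mem_centralizer_iff ℂ).2 ?_
    rintro _ rfl
    change _ * emb q h (theta q x) = emb q h (theta q x) * _
    rw [emb_theta]
    exact (theta_commute_T q h h' hd x w).symm.eq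

end AffineHecke

/-! ### The graded affine Hecke algebra -/

/-- The symmetric algebra `𝔸 = S(V)` of `V = X ⊗ ℂ`, as polynomials in the basis `ε_(k,a)`. -/
abbrev Poly {m : ℕ} (n : Fin m → ℕ) : Type := MvPolynomial (Coord n) ℂ

/-- The inclusion `V → S(V)`. -/
def lin {m : ℕ} {n : Fin m → ℕ} (v : Coord n → ℂ) : Poly n :=
  ∑ c, v c • MvPolynomial.X c

/-- The free algebra on symbols `t_w`, `w ∈ W`, and on the elements of `S(V)`. -/
abbrev GradedFree {m : ℕ} (n : Fin m → ℕ) : Type := FreeAlgebra ℂ (Weyl n ⊕ Poly n)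

namespace GradedFree
def t {m : ℕ} {n : Fin m → ℕ} (w : Weyl n) : GradedFree n := FreeAlgebra.ι ℂ (Sum.inl w)
def A {m : ℕ} {n : Fin m → ℕ} (f : Poly n) : GradedFree n := FreeAlgebra.ι ℂ (Sum.inr f)
end GradedFree

open GradedFree in
/-- The defining relations of the graded affine Hecke algebra `ℍ(V, R, Δ, log q)`; note that
`⟨v, α^∨⟩ = v_a - v_b` for `α = ε_a - ε_b`. -/
inductive GradedRel (q : ℝ) {m : ℕ} (n : Fin m → ℕ) : GradedFree n → GradedFree n → Prop
  | add (f g : Poly n) : GradedRel q n (A (f + g)) (A f + A g)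
  | mul (f g : Poly n) : GradedRel q n (A (f * g)) (A f * A g)
  | scalar (c : ℂ) : GradedRel q n (A (algebraMap ℂ _ c)) (algebraMap ℂ _ c)
  | one : GradedRel q n (t 1) 1
  | group (w w' : Weyl n) : GradedRel q n (t w * t w') (t (w * w'))
  | cross (k : Fin m) (a b : Fin (n k)) (hab : (a : ℕ) + 1 = b) (v : Coord n → ℂ) :
      GradedRel q n
        (A (lin v) * t (simple k a b) - t (simple k a b) * A (lin (permute (simple k a b) v)))
        (algebraMap ℂ _ ((Real.log q : ℂ) * (v ⟨k, a⟩ - v ⟨k, b⟩)))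

/-- The graded affine Hecke algebra `ℍ_n = ℍ(V_n, R_n, Δ_n, log q)`. -/
def GradedHecke (q : ℝ) {m : ℕ} (n : Fin m → ℕ) : Type := RingQuot (GradedRel q n)

instance (q : ℝ) {m : ℕ} (n : Fin m → ℕ) : Ring (GradedHecke q n) :=
  inferInstanceAs (Ring (RingQuot (GradedRel q n)))

instance (q : ℝ) {m : ℕ} (n : Fin m → ℕ) : Algebra ℂ (GradedHecke q n) :=
  inferInstanceAs (Algebra ℂ (RingQuot (GradedRel q n)))

namespace GradedHecke

variable (q : ℝ) {m : ℕ} {n p p' d d' : Fin m → ℕ}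

/-- The projection of the free algebra onto `ℍ_n`. -/
def mk (n : Fin m → ℕ) : GradedFree n →ₐ[ℂ] GradedHecke q n := RingQuot.mkAlgHom ℂ (GradedRel q n)

variable {q} in
theorem mk_rel {x y : GradedFree n} (h : GradedRel q n x y) : mk q n x = mk q n y :=
  RingQuot.mkAlgHom_rel ℂ h

/-- The element `t_w`. -/
def t (w : Weyl n) : GradedHecke q n := mk q n (GradedFree.t w)

/-- The algebra map `S(V) → ℍ_n`. -/
def ofPoly (n : Fin m → ℕ) : Poly n →ₐ[ℂ] GradedHecke q n where
  toFun f := mk q n (GradedFree.A f)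
  map_add' f g := by rw [← map_add]; exact mk_rel (.add f g)
  map_mul' f g := by rw [← map_mul]; exact mk_rel (.mul f g)
  commutes' c := (mk_rel (.scalar c)).trans (AlgHom.commutes _ c)
  map_zero' := by
    have := mk_rel (q := q) (n := n) (.scalar 0)
    rw [map_zero, map_zero] at this
    rw [this, map_zero]
  map_one' := by
    have := mk_rel (q := q) (n := n) (.scalar 1)
    rw [map_one, map_one] at this
    rw [this, map_one]

theorem t_one : t q (1 : Weyl n) = 1 := (mk_rel .one).trans (map_one _)

theorem t_mul (w w' : Weyl n) : t q w * t q w' = t q (w * w') := by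
  rw [t, t, ← map_mul]; exact mk_rel (.group w w')

theorem cross (k : Fin m) (a b : Fin (n k)) (hab : (a : ℕ) + 1 = b) (v : Coord n → ℂ) :
    ofPoly q n (lin v) * t q (simple k a b)
      - t q (simple k a b) * ofPoly q n (lin (permute (simple k a b) v))
      = algebraMap ℂ _ ((Real.log q : ℂ) * (v ⟨k, a⟩ - v ⟨k, b⟩)) := by
  have := mk_rel (q := q) (.cross k a b hab v)
  simp only [map_mul (mk q n), map_sub (mk q n), AlgHom.commutes] at this
  exact this

/-- The universal property of `ℍ_n`. -/
def liftHom {B : Type} [Ring B] [Algebra ℂ B] (f : GradedFree n →ₐ[ℂ] B)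
    (hf : ∀ x y, GradedRel q n x y → f x = f y) : GradedHecke q n →ₐ[ℂ] B :=
  RingQuot.liftAlgHom ℂ ⟨f, fun x y h => hf x y h⟩

theorem liftHom_mk {B : Type} [Ring B] [Algebra ℂ B] (f : GradedFree n →ₐ[ℂ] B)
    (hf : ∀ x y, GradedRel q n x y → f x = f y) (x : GradedFree n) :
    liftHom q f hf (mk q n x) = f x :=
  RingQuot.liftAlgHom_mkAlgHom_apply ℂ f (fun x y h => hf x y h) x

theorem lin_single (c : Coord n) : lin (Pi.single c 1) = MvPolynomial.X c := by
  rw [lin, Finset.sum_eq_single c]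
  · rw [Pi.single_eq_same, one_smul]
  · intro c' _ hc
    rw [Pi.single_eq_of_ne hc, zero_smul]
  · exact fun h => absurd (Finset.mem_univ c) h

/-- A subalgebra containing all `t_w` and all `v ∈ V` is everything. -/
theorem mem_of_generators (S : Subalgebra ℂ (GradedHecke q n)) (ht : ∀ w, t q w ∈ S)
    (hV : ∀ v, ofPoly q n (lin v) ∈ S) (z : GradedHecke q n) : z ∈ S := by
  have hA : ∀ f, ofPoly q n f ∈ S := by
    intro f
    induction f using MvPolynomial.induction_on with
    | C c =>
      rw [← MvPolynomial.algebraMap_eq, AlgHom.commutes]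
      exact S.algebraMap_mem c
    | add f g hf hg => rw [map_add]; exact S.add_mem hf hg
    | mul_X f c hf =>
      rw [map_mul, ← lin_single]
      exact S.mul_mem hf (hV _)
  obtain ⟨y, rfl⟩ := RingQuot.mkAlgHom_surjective ℂ (GradedRel q n) z
  change mk q n y ∈ S
  induction y using FreeAlgebra.induction with
  | grade0 c => rw [AlgHom.commutes]; exact S.algebraMap_mem c
  | grade1 x =>
    cases x with
    | inl w => exact ht w
    | inr f => exact hA f
  | mul a b ha hb => rw [map_mul]; exact S.mul_mem ha hb
  | add a b ha hb => rw [map_add]; exact S.add_mem ha hb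

theorem rename_lin (h : ∀ k, d k + p k ≤ n k) (v : Coord p → ℂ) :
    MvPolynomial.rename (embCoord h) (lin v) = lin (embVec h v) := by
  simp only [lin, map_sum, map_smul, MvPolynomial.rename_X]
  rw [← Finset.sum_map Finset.univ (embCoord h)
    (fun c => embVec h v c • (MvPolynomial.X c : Poly n)) |>.trans
    (Finset.sum_congr rfl fun c _ => by rw [embVec_apply])]
  refine Finset.sum_subset (Finset.subset_univ _) fun c _ hc => ?_
  rw [embVec_apply_of_notMem h, zero_smul]
  rintro ⟨c', rfl⟩
  exact hc (Finset.mem_map_of_mem _ (Finset.mem_univ _))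

/-- The embedding `ℍ_p → ℍ_n` with `t_w ↦ t_w` and `ε_c ↦ ε_c`, after the `k`-th block of `p` is
placed inside the `k`-th block of `n` with offset `d k`. -/
def emb (h : ∀ k, d k + p k ≤ n k) : GradedHecke q p →ₐ[ℂ] GradedHecke q n :=
  liftHom q (FreeAlgebra.lift ℂ (Sum.elim (fun w => t q (embWeyl h w))
    (fun f => ofPoly q n (MvPolynomial.rename (embCoord h) f)))) (by
    intro x y hxy
    cases hxy with
    | add f g => simp [GradedFree.A]
    | mul f g => simp [GradedFree.A]
    | scalar c =>
      simp only [GradedFree.A, FreeAlgebra.lift_ι_apply, Sum.elim_inr, AlgHom.commutes]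
    | one => simp [GradedFree.t, t_one]
    | group w w' =>
      simp only [GradedFree.t, map_mul, FreeAlgebra.lift_ι_apply, Sum.elim_inl, t_mul]
    | cross k a b hab v =>
      rw [map_sub, map_mul, map_mul, AlgHom.commutes]
      simp only [GradedFree.t, GradedFree.A, FreeAlgebra.lift_ι_apply, Sum.elim_inl,
        Sum.elim_inr, rename_lin, ← permute_embVec, embWeyl_simple]
      rw [cross q k _ _ (by rw [blk_val, blk_val]; omega), embVec_apply_mk, embVec_apply_mk])

theorem emb_t (h : ∀ k, d k + p k ≤ n k) (w : Weyl p) : emb q h (t q w) = t q (embWeyl h w) := by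
  rw [t, emb, liftHom_mk]
  simp [GradedFree.t]

theorem emb_lin (h : ∀ k, d k + p k ≤ n k) (v : Coord p → ℂ) :
    emb q h (ofPoly q p (lin v)) = ofPoly q n (lin (embVec h v)) := by
  rw [← rename_lin]
  change emb q h (mk q p _) = _
  rw [emb, liftHom_mk]
  simp [GradedFree.A]

/-- The sign projector `𝐬 = |W|⁻¹ ∑_w (-1)^{l(w)} t_w` of `ℍ_n`. -/
def signProj (n : Fin m → ℕ) : GradedHecke q n :=
  (Fintype.card (Weyl n) : ℂ)⁻¹ • ∑ w : Weyl n, (-1 : ℂ) ^ len w • t q w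

theorem lin_commute_t (h : ∀ k, d k + p k ≤ n k) (h' : ∀ k, d' k + p' k ≤ n k)
    (hd : ∀ k, d k + p k ≤ d' k) (v : Coord p → ℂ) (w : Weyl p') :
    Commute (ofPoly q n (lin (embVec h v))) (t q (embWeyl h' w)) := by
  induction w using weyl_induction with
  | one => rw [map_one, t_one]; exact Commute.one_right _
  | step w k a b hab h1 hl ih =>
    rw [map_mul, ← t_mul]
    refine ih.mul_right ?_
    have hp := permute_embVec_of_disjoint h h' hd v (simple k a b)
    rw [embWeyl_simple] at hp ⊢
    have := cross q k (blk h' k a) (blk h' k b) (by rw [blk_val, blk_val]; omega) (embVec h v)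
    have hz : embVec h v ⟨k, blk h' k a⟩ = embVec h v ⟨k, blk h' k b⟩ := by
      conv_lhs => rw [← hp]
      simp [permute, simple]
    rw [hp, hz, sub_self, mul_zero, map_zero, sub_eq_zero] at this
    exact this

theorem emb_commute (h : ∀ k, d k + p k ≤ n k) (h' : ∀ k, d' k + p' k ≤ n k)
    (hd : ∀ k, d k + p k ≤ d' k) (z : GradedHecke q p) :
    Commute (emb q h z) (emb q h' (signProj q p')) := by
  suffices ∀ w : Weyl p', Commute (emb q h z) (t q (embWeyl h' w)) by
    simp only [signProj, map_smul, map_sum, emb_t]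
    exact (Commute.sum_right _ _ _ fun w _ => (this w).smul_right _).smul_right _
  intro w
  have := mem_of_generators q
    ((Subalgebra.centralizer ℂ {t q (embWeyl h' w)}).comap (emb q h)) ?_ ?_ z
  · exact ((Subalgebra.mem_centralizer_iff ℂ).1 this _ rfl).symm
  · intro w'
    refine (Subalgebra.mem_centralizer_iff ℂ).2 ?_
    rintro _ rfl
    change _ * emb q h (t q w') = emb q h (t q w') * _
    rw [emb_t, t_mul, t_mul, (embWeyl_commute h h' hd w' w).eq]
  · intro v
    refine (Subalgebra.mem_centralizer_iff ℂ).2 ?_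
    rintro _ rfl
    change _ * emb q h (ofPoly q p (lin v)) = emb q h (ofPoly q p (lin v)) * _
    rw [emb_lin]
    exact (lin_commute_t q h h' hd v w).symm.eq

end GradedHecke

/-! ### Bernstein-Zelevinsky derivatives -/

section Cut

variable {A B : Type} [Ring A] [Ring B] (φ : B →+* A) (e : A) (he : ∀ b, Commute (φ b) e)

/-- Multiplication by `e` on an `A`-module, as a `B`-linear map. -/
def mulEnd (M : ModuleCat.{u} A) :
    (ModuleCat.restrictScalars φ).obj M →ₗ[B] (ModuleCat.restrictScalars φ).obj M where
  toFun x := (e • (show M from x) : M)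
  map_add' x y := smul_add e (show M from x) (show M from y)
  map_smul' b x := by
    change e • (φ b • (show M from x)) = φ b • (e • (show M from x))
    rw [smul_smul, smul_smul, (he b).eq]

/-- The functor `M ↦ e M` from `A`-modules to `B`-modules, where `B` acts through `φ : B → A`,
whose image commutes with `e`. -/
def cut : ModuleCat.{u} A ⥤ ModuleCat.{u} B where
  obj M := ModuleCat.of B (LinearMap.range (mulEnd φ e he M))
  map {M N} f := ModuleCat.ofHom
    (((ModuleCat.restrictScalars φ).map f).hom.restrict (by
      rintro _ ⟨x, rfl⟩
      exact ⟨f.hom x, (f.hom.map_smul e x).symm⟩))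

end Cut

section BZ

variable (q : ℝ) {m : ℕ} {n i : Fin m → ℕ}

theorem offset_fst (hi : ∀ k, i k ≤ n k) (k : Fin m) : (0 : Fin m → ℕ) k + (n - i) k ≤ n k := by
  have := hi k
  simp

theorem offset_snd (hi : ∀ k, i k ≤ n k) (k : Fin m) : (n - i) k + i k ≤ n k := by
  have := hi k
  simp only [Pi.sub_apply]; omega

theorem offset_disj (k : Fin m) : (0 : Fin m → ℕ) k + (n - i) k ≤ (n - i) k := by simp

/-- The derivative `BZ^n_i(σ) = 𝐒^n_i(σ)`, a functor from `ℋ_n`-modules to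
`ℋ_{n-i}`-modules. Here `𝐒^n_i ∈ ℋ_n` is the sign projector of `ℋ_i`, embedded in the last
`i k` coordinates of every block, and `ℋ_{n-i}` is embedded in the first `n k - i k`
coordinates of every block. -/
def BZ (hi : ∀ k, i k ≤ n k) : ModuleCat.{u} (AffineHecke q n) ⥤ ModuleCat.{u} (AffineHecke q (n - i)) :=
  cut (AffineHecke.emb q (offset_fst hi)).toRingHom
    (AffineHecke.emb q (offset_snd hi) (AffineHecke.signProj q i))
    (AffineHecke.emb_commute q (offset_fst hi) (offset_snd hi) offset_disj)

/-- The derivative `gBZ^n_i(σ) = 𝐬^n_i(σ)`, a functor from `ℍ_n`-modules to `ℍ_{n-i}`-modules. -/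
def gBZ (hi : ∀ k, i k ≤ n k) : ModuleCat.{u} (GradedHecke q n) ⥤ ModuleCat.{u} (GradedHecke q (n - i)) :=
  cut (GradedHecke.emb q (offset_fst hi)).toRingHom
    (GradedHecke.emb q (offset_snd hi) (GradedHecke.signProj q i))
    (GradedHecke.emb_commute q (offset_fst hi) (offset_snd hi) offset_disj)

end BZ

/-! ### Central characters and Lusztig's functor -/

/-- `ζ ∈ V^*` is real for the root system `R_n`: every root takes a real value at `ζ`. -/
def IsRealPoint {m : ℕ} (n : Fin m → ℕ) (ζ : Coord n → ℂ) : Prop :=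
  ∀ (k : Fin m) (a b : Fin (n k)), (ζ ⟨k, a⟩ - ζ ⟨k, b⟩).im = 0

/-- The centre `ℤ = S(V)^W`. -/
def invariants {m : ℕ} (n : Fin m → ℕ) : Subalgebra ℂ (Poly n) where
  carrier := {f | ∀ w : Weyl n, MvPolynomial.rename (Equiv.sigmaCongrRight w) f = f}
  mul_mem' hf hg w := by rw [map_mul, hf w, hg w]
  add_mem' hf hg w := by rw [map_add, hf w, hg w]
  algebraMap_mem' c w := AlgHom.commutes _ c

/-- The maximal ideal `𝕁_{Wζ}` of `S(V)^W`: the invariant polynomials that vanish at `ζ`. -/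
def centralIdeal {m : ℕ} {n : Fin m → ℕ} (ζ : Coord n → ℂ) : Ideal (invariants n) :=
  RingHom.ker ((MvPolynomial.aeval ζ).comp (invariants n).val : invariants n →ₐ[ℂ] ℂ)

open scoped ModuleCat

section Graded

variable (q : ℝ) {m : ℕ} (n : Fin m → ℕ)

/-- The submodule `N` of the `ℍ_n`-module `M` is annihilated by a power of `𝕁_{Wζ}`. -/
def IsKilledByPower {M : Type u} [AddCommGroup M] [Module (GradedHecke q n) M]
    (N : Submodule (GradedHecke q n) M) (ζ : Coord n → ℂ) : Prop :=
  ∃ r : ℕ, ∀ z ∈ centralIdeal ζ ^ r, ∀ x ∈ N, GradedHecke.ofPoly q n (z : Poly n) • x = 0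

/-- Finite-dimensional `ℍ_n`-modules annihilated by a power of `𝕁_{Wζ}`. -/
def CentralCat (ζ : Coord n → ℂ) : ObjectProperty (ModuleCat.{u} (GradedHecke q n)) := fun M =>
  FiniteDimensional ℂ M ∧ IsKilledByPower q n (⊤ : Submodule (GradedHecke q n) M) ζ

/-- Finite-dimensional `ℍ_n`-modules that are sums of submodules, each annihilated by a power of
`𝕁_{Wζ}` for some `ζ` real for `R_n`. -/
def RealCat : ObjectProperty (ModuleCat.{u} (GradedHecke q n)) := fun M =>
  FiniteDimensional ℂ M ∧
    sSup {N : Submodule (GradedHecke q n) M | ∃ ζ, IsRealPoint n ζ ∧ IsKilledByPower q n N ζ} = ⊤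

theorem centralCat_le_realCat {ζ : Coord n → ℂ} (hζ : IsRealPoint n ζ) :
    CentralCat.{u} q n ζ ≤ RealCat.{u} q n := fun _ hM =>
  ⟨hM.1, top_le_iff.1 (le_sSup ⟨ζ, hζ, hM.2⟩)⟩

end Graded

/-- The sum `∑_r a_r A^r` of a power series at an endomorphism of a finite-dimensional space,
computed on matrix entries in a basis. It is used for entire series only. -/
def opSeries {V : Type u} [AddCommGroup V] [Module ℂ V] [FiniteDimensional ℂ V]
    (a : ℕ → ℂ) (A : Module.End ℂ V) : Module.End ℂ V :=
  Matrix.toLinAlgEquiv (Module.finBasis ℂ V)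
    (∑' r, a r • LinearMap.toMatrixAlgEquiv (Module.finBasis ℂ V) A ^ r)

/-- The exponential `exp A`. -/
def opExp {V : Type u} [AddCommGroup V] [Module ℂ V] [FiniteDimensional ℂ V]
    (A : Module.End ℂ V) : Module.End ℂ V :=
  opSeries (fun r => ((r.factorial : ℂ))⁻¹) A

/-- The operator `E(A)` for the entire function `E(z) = (e^z - 1) / z = ∑_r z^r / (r + 1)!`. -/
def opE {V : Type u} [AddCommGroup V] [Module ℂ V] [FiniteDimensional ℂ V]
    (A : Module.End ℂ V) : Module.End ℂ V :=
  opSeries (fun r => (((r + 1).factorial : ℂ))⁻¹) A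

/-- Lusztig's functor `Λ`, from the modules in `RealCat` to `ℋ_n`-modules. It keeps the underlying
vector space (`equiv`) and the maps (`naturality`), and `h ∈ ℋ_n` acts as `j(h)`, where
`j(θ_x) = e^x` and `j(τ_s) = τ̄_s`. Since `τ_s + 1 = (T_s + 1) 𝒢(α)⁻¹` and
`τ̄_s + 1 = (t_s + 1) g(α)⁻¹` with `𝒢(α) = (θ_α q - 1) / (θ_α - 1)` and
`g(α) = (α + log q) / α`, the second equation says
`j(T_s) + 1 = (t_s + 1) · (e^α q - 1) / (e^α - 1) · α / (α + log q)`,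
that is `j(T_s) + 1 = (t_s + 1) E(α + log q) E(α)⁻¹`. On a module in `RealCat` all eigenvalues of
`α` are real, so `E(α)` is invertible there, and the two formulas determine the action of `ℋ_n`. -/
structure LusztigFunctor (q : ℝ) {m : ℕ} (n : Fin m → ℕ) where
  functor : (RealCat.{u} q n).FullSubcategory ⥤ ModuleCat.{u} (AffineHecke q n)
  equiv (π : (RealCat.{u} q n).FullSubcategory) : π.obj ≃ₗ[ℂ] functor.obj π
  naturality {π π' : (RealCat.{u} q n).FullSubcategory} (f : π ⟶ π') (x : π.obj) :
    (functor.map f).hom (equiv π x) = equiv π' (f.hom.hom x)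
  theta_smul (π : (RealCat.{u} q n).FullSubcategory) (x : Coord n → ℤ) (y : π.obj) :
    haveI : FiniteDimensional ℂ π.obj := π.property.1
    AffineHecke.theta q x • equiv π y =
      equiv π (opExp (Algebra.lsmul ℂ ℂ π.obj
        (GradedHecke.ofPoly q n (lin fun c => (x c : ℂ)))) y)
  T_smul (π : (RealCat.{u} q n).FullSubcategory) (k : Fin m) (a b : Fin (n k))
    (hab : (a : ℕ) + 1 = b) (y : π.obj) :
    haveI : FiniteDimensional ℂ π.obj := π.property.1
    letI α : GradedHecke q n := GradedHecke.ofPoly q n (lin (root k a b))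
    (AffineHecke.T q (simple k a b) + 1) • equiv π (opE (Algebra.lsmul ℂ ℂ π.obj α) y) =
      equiv π ((GradedHecke.t q (simple k a b) + 1) •
        opE (Algebra.lsmul ℂ ℂ π.obj (α + algebraMap ℂ _ (Real.log q : ℂ))) y)

end HeckeBZ

end

open HeckeBZ

/-! Put E(z) = (e^z - 1)/z and φ(z) = E(z + log q)/E(z), so that Lusztig's formula reads T_s + 1 =
(t_s + 1) φ(α). The image of the affine sign projector of `i` is the common kernel of the T_s + 1,
and that of the graded one is the common kernel of the t_s + 1, for s simple in S_i. Let B be the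
product of φ(β) over the positive roots β of R_i. A simple reflection s permutes the positive roots
other than its own root α, so the product B' over β ≠ α is s-invariant, commutes with t_s, and gives
(t_s + 1) B = B' (t_s + 1) φ(α) = B' (T_s + 1). The zeros of E are nonzero multiples of 2πi, hence B
and B' are invertible as soon as the roots have real eigenvalues, and B carries the affine sign
space onto the graded one (`IsLusztigAction.mem_range_signProj_iff`). The Weyl group of R_{n-i}
fixes the roots of R_i, so B commutes with ℍ_{n-i} (`twist_commute_emb`). A linear map that commutes
with a graded action also commutes with the affine action built from it
(`IsLusztigAction.intertwine`); this makes B linear over ℋ_{n-i}. Naturality holds because B is a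
function of the operators in S(V).

Membership in the real category amounts to reality of the eigenvalues of all roots
(`hasRealRoots_of_sSup`, `sSup_eq_top_of_hasRealRoots`), a condition that passes to gBZ.

Most of the work is the existence of Λ, that is, the relations of ℋ_n for the operators (t_s + 1)
φ(α) - 1. Functions of an operator are replaced by polynomials with the right Taylor expansions at
its eigenvalues. Moving polynomials past t_s reduces each relation to the vanishing of one
polynomial operator, and a polynomial acts by zero once it vanishes to high order at every weight
(`eq_zero_of_vanishesTo`). Vanishing is tested on lines in generic directions, where it becomes an
identity in the domain of power series between x, y, e^x, e^y, checked in the fraction field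
(`braidPoly_eq_zero`, `quadraticPoly_eq_zero`, `crossPoly_eq_zero`). Matsumoto's theorem then
produces T_w from the T_s. -/

noncomputable section

namespace HeckeBZ

/-! ### Entire functions of an operator as interpolating polynomials. -/

section FunctionalCalculus

open Polynomial

/-- The coefficients of an entire function. -/
def IsEntire (a : ℕ → ℂ) : Prop := ∀ R : ℝ, 0 ≤ R → Summable fun r => ‖a r‖ * R ^ r

/-- The Taylor expansion at `z` of `∑_r a_r z^r`. -/
def jet (a : ℕ → ℂ) (z : ℂ) : PowerSeries ℂ :=
  PowerSeries.mk fun j => ∑' r, a r * ((r.choose j : ℂ) * z ^ (r - j))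

/-- `P` agrees with the expansion `F z` at each `z ∈ Z` up to order `r`. -/
def Approx (P : ℂ[X]) (Z : Set ℂ) (r : ℕ) (F : ℂ → PowerSeries ℂ) : Prop :=
  ∀ z ∈ Z, PowerSeries.X ^ r ∣ ((taylor z P : ℂ[X]) : PowerSeries ℂ) - F z

/-- The left side is a single term of the binomial expansion of (R + 1)^r. Convergence at radius R +
1 therefore dominates every Taylor coefficient at radius R. -/
theorem choose_mul_pow_le (R : ℝ) (hR : 0 ≤ R) (r j : ℕ) :
    (r.choose j : ℝ) * R ^ (r - j) ≤ (R + 1) ^ r := by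
  rcases lt_or_ge r j with h | h
  · rw [Nat.choose_eq_zero_of_lt h]
    simp only [Nat.cast_zero, zero_mul]
    positivity
  · rw [add_pow]
    have := Finset.single_le_sum (f := fun m => R ^ m * 1 ^ (r - m) * (r.choose m : ℝ))
      (s := Finset.range (r + 1)) (fun m _ => by positivity)
      (a := r - j) (by simp)
    simp only [one_pow, mul_one] at this
    rw [Nat.choose_symm h] at this
    simp only [one_pow, mul_one]
    linarith

theorem IsEntire.summable {a : ℕ → ℂ} (ha : IsEntire a) (z : ℂ) (j : ℕ) :
    Summable fun r => a r * ((r.choose j : ℂ) * z ^ (r - j)) := by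
  refine Summable.of_norm_bounded (ha (‖z‖ + 1) (by positivity)) fun r => ?_
  rw [norm_mul, norm_mul, norm_pow, Complex.norm_natCast]
  exact mul_le_mul_of_nonneg_left (choose_mul_pow_le _ (norm_nonneg _) _ _) (norm_nonneg _)

theorem isEntire_exp : IsEntire fun r => ((r.factorial : ℂ))⁻¹ := by
  intro R _
  refine (Real.summable_pow_div_factorial R).congr fun r => ?_
  rw [norm_inv, Complex.norm_natCast, div_eq_inv_mul]

theorem isEntire_E : IsEntire fun r => (((r + 1).factorial : ℂ))⁻¹ := by
  intro R hR
  refine Summable.of_nonneg_of_le (fun r => by positivity) (fun r => ?_)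
    (Real.summable_pow_div_factorial R)
  rw [norm_inv, Complex.norm_natCast, div_eq_inv_mul]
  gcongr
  omega

/-- Binomial theorem for A = z + nilpotent. The sum has d terms whatever r is, so that summing a
power series over r can later be done termwise in j. -/
theorem pow_apply_of_generalized {V : Type*} [AddCommGroup V] [Module ℂ V] (A : Module.End ℂ V)
    (z : ℂ) (d : ℕ) (y : V) (hy : ((A - algebraMap ℂ _ z) ^ d) y = 0) (r : ℕ) :
    (A ^ r) y = ∑ j ∈ Finset.range d,
      ((r.choose j : ℂ) * z ^ (r - j)) • ((A - algebraMap ℂ _ z) ^ j) y := by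
  set B := A - algebraMap ℂ (Module.End ℂ V) z with hB
  have hz : ∀ j, d ≤ j → (B ^ j) y = 0 := fun j hj => by
    rw [← Nat.sub_add_cancel hj, pow_add, Module.End.mul_apply, hy, map_zero]
  have hA : A = B + algebraMap ℂ _ z := by rw [hB]; abel
  rw [hA, (Algebra.commute_algebraMap_right z B).add_pow, LinearMap.sum_apply]
  have key : ∀ j, (B ^ j * algebraMap ℂ (Module.End ℂ V) z ^ (r - j) *
      ((r.choose j : ℕ) : Module.End ℂ V)) y = ((r.choose j : ℂ) * z ^ (r - j)) • (B ^ j) y := by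
    intro j
    rw [← map_pow, ← map_natCast (algebraMap ℂ (Module.End ℂ V)), mul_assoc, ← map_mul,
      Module.End.mul_apply, Module.algebraMap_end_apply, map_smul, mul_comm]
  simp only [key]
  rcases le_total d (r + 1) with h | h
  · symm
    refine Finset.sum_subset (Finset.range_mono h) fun j _ hj => ?_
    rw [hz j (by simpa using hj), smul_zero]
  · refine Finset.sum_subset (Finset.range_mono h) fun j _ hj => ?_
    rw [Nat.choose_eq_zero_of_lt (by simpa using hj), Nat.cast_zero, zero_mul, zero_smul]

theorem aeval_apply_of_generalized {V : Type*} [AddCommGroup V] [Module ℂ V] (A : Module.End ℂ V)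
    (z : ℂ) (d : ℕ) (y : V) (hy : ((A - algebraMap ℂ _ z) ^ d) y = 0) (P : ℂ[X]) :
    aeval A P y = ∑ j ∈ Finset.range d,
      (taylor z P).coeff j • ((A - algebraMap ℂ _ z) ^ j) y := by
  set B := A - algebraMap ℂ (Module.End ℂ V) z with hB
  have hz : ∀ j, d ≤ j → (B ^ j) y = 0 := fun j hj => by
    rw [← Nat.sub_add_cancel hj, pow_add, Module.End.mul_apply, hy, map_zero]
  have h1 : aeval A P = aeval B (taylor z P) := by
    rw [taylor_apply, aeval_comp]
    congr 1
    simp [hB]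
  rw [h1, aeval_eq_sum_range, LinearMap.sum_apply]
  simp only [LinearMap.smul_apply]
  rcases le_total d ((taylor z P).natDegree + 1) with h | h
  · symm
    refine Finset.sum_subset (Finset.range_mono h) fun j _ hj => ?_
    rw [hz j (by simpa using hj), smul_zero]
  · refine Finset.sum_subset (Finset.range_mono h) fun j _ hj => ?_
    rw [coeff_eq_zero_of_natDegree_lt (by simpa using hj), zero_smul]

/-- The generalized eigenspaces span, and a nonzero vector in one of them forces z to be a true
eigenvalue. Any exponent at least the dimension will do. -/
theorem generalized_induction {V : Type*} [AddCommGroup V] [Module ℂ V] [FiniteDimensional ℂ V]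
    (A : Module.End ℂ V) {d : ℕ} (hd : Module.finrank ℂ V ≤ d) {p : V → Prop}
    (zero : p 0) (add : ∀ x y, p x → p y → p (x + y))
    (mem : ∀ z, A.HasEigenvalue z → ∀ y, ((A - algebraMap ℂ _ z) ^ d) y = 0 → p y) (y : V) :
    p y := by
  have hy : y ∈ ⨆ μ, A.maxGenEigenspace μ := by
    rw [Module.End.iSup_maxGenEigenspace_eq_top]; trivial
  induction hy using Submodule.iSup_induction' with
  | mem z y hy =>
    by_cases h0 : y = 0
    · rw [h0]; exact zero
    rw [Module.End.maxGenEigenspace_eq_genEigenspace_finrank] at hy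
    have hy' := (A.genEigenspace z).mono
      (show ((Module.finrank ℂ V : ℕ) : ℕ∞) ≤ (d : ℕ∞) by exact_mod_cast hd) hy
    refine mem z ?_ y (by simpa [Module.End.mem_genEigenspace_nat, Algebra.algebraMap_eq_smul_one] using hy')
    refine Module.End.hasEigenvalue_of_hasGenEigenvalue (k := Module.finrank ℂ V) ?_
    intro hbot
    rw [hbot] at hy
    exact h0 hy
  | zero => exact zero
  | add x y _ _ hx hy => exact add x y hx hy

/-- On a generalized eigenspace at z both operators are determined by the first d Taylor
coefficients at z, and these agree by hypothesis. -/
theorem opSeries_eq_aeval {V : Type u} [AddCommGroup V] [Module ℂ V] [FiniteDimensional ℂ V]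
    {a : ℕ → ℂ} (ha : IsEntire a) (A : Module.End ℂ V) {P : ℂ[X]} {d : ℕ}
    (hd : Module.finrank ℂ V ≤ d) (hP : Approx P {z | A.HasEigenvalue z} d (jet a)) :
    opSeries a A = aeval A P := by
  set b := Module.finBasis ℂ V
  have key : ∀ y : V, HasSum (fun r => a r • b.equivFun ((A ^ r) y)) (b.equivFun (aeval A P y)) := by
    refine generalized_induction A hd ?_ ?_ ?_
    · simp
    · intro x y hx hy
      simpa only [map_add, smul_add] using hx.add hy
    · intro z hz y hy
      have hc := PowerSeries.X_pow_dvd_iff.1 (hP z hz)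
      rw [aeval_apply_of_generalized A z d y hy, map_sum]
      simp only [pow_apply_of_generalized A z d y hy, map_sum, map_smul, Finset.smul_sum, smul_smul]
      refine hasSum_sum fun j hj => ?_
      have := hc j (by simpa using hj)
      rw [map_sub, Polynomial.coeff_coe, sub_eq_zero] at this
      rw [this, jet, PowerSeries.coeff_mk]
      exact (ha.summable z j).hasSum.smul_const _
  -- The series is defined through matrix entries, so convergence on basis vectors is transported
  -- entry by entry.
  have hm : HasSum (fun r => a r • LinearMap.toMatrixAlgEquiv b A ^ r)
      (LinearMap.toMatrixAlgEquiv b (aeval A P)) := by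
    refine Pi.hasSum.2 fun i => Pi.hasSum.2 fun j => ?_
    have h := Pi.hasSum.1 (key (b j)) i
    have e : ∀ r, (a r • LinearMap.toMatrixAlgEquiv b A ^ r) i j =
        (a r • b.equivFun ((A ^ r) (b j))) i := fun r => by
      rw [← map_pow, Matrix.smul_apply, LinearMap.toMatrixAlgEquiv_apply]; rfl
    simp only [e]
    simpa [LinearMap.toMatrixAlgEquiv_apply] using h
  rw [opSeries, hm.tsum_eq]
  exact Matrix.toLinAlgEquiv_toMatrixAlgEquiv b _

theorem jet_exp (z : ℂ) : jet (fun r => ((r.factorial : ℂ))⁻¹) z =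
    PowerSeries.C (Complex.exp z) * PowerSeries.exp ℂ := by
  ext j
  rw [jet, PowerSeries.coeff_mk, PowerSeries.coeff_C_mul, PowerSeries.coeff_exp]
  have hs := isEntire_exp.summable z j
  rw [← hs.sum_add_tsum_nat_add j, Finset.sum_eq_zero, zero_add, Complex.exp_eq_exp_ℂ,
    NormedSpace.exp_eq_tsum_div, ← tsum_mul_right]
  · refine tsum_congr fun r => ?_
    have h := Nat.add_choose_mul_factorial_mul_factorial r j
    have h' : ((r + j).choose j : ℂ) * r.factorial * j.factorial = (r + j).factorial := by
      rw [← h, ← Nat.choose_symm_add]; push_cast; ring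
    have h1 : (r.factorial : ℂ) ≠ 0 := by exact_mod_cast r.factorial_ne_zero
    have h2 : (j.factorial : ℂ) ≠ 0 := by exact_mod_cast j.factorial_ne_zero
    have h3 : ((r + j).factorial : ℂ) ≠ 0 := by exact_mod_cast (r + j).factorial_ne_zero
    rw [Nat.add_sub_cancel]
    simp only [map_div₀, map_one, map_natCast]
    field_simp
    rw [← h']; ring
  · intro r hr
    rw [Nat.choose_eq_zero_of_lt (by simpa using hr)]
    simp

/-- The equation z E(z) = e^z - 1, expanded around z; on coefficients it is Pascal's rule. -/
theorem jet_E_mul (z : ℂ) :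
    (PowerSeries.C z + PowerSeries.X) * jet (fun r => (((r + 1).factorial : ℂ))⁻¹) z =
      PowerSeries.C (Complex.exp z) * PowerSeries.exp ℂ - 1 := by
  rw [← jet_exp]
  ext j
  have hE := isEntire_E.summable z
  have hx := (isEntire_exp.summable z j).tsum_eq_zero_add
  simp only [jet, map_sub, PowerSeries.coeff_mk]
  rw [hx, add_mul, map_add, PowerSeries.coeff_C_mul, PowerSeries.coeff_mk, ← tsum_mul_left]
  cases j with
  | zero =>
    simp only [PowerSeries.coeff_zero_X_mul, Nat.choose_zero_right, PowerSeries.coeff_zero_one,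
      Nat.factorial_zero, Nat.cast_one, Nat.sub_zero, pow_zero, inv_one, mul_one, one_mul, add_zero,
      add_sub_cancel_left]
    exact tsum_congr fun r => by rw [pow_succ]; ring
  | succ j =>
    rw [mul_comm PowerSeries.X, PowerSeries.coeff_succ_mul_X, PowerSeries.coeff_mk,
      ← Summable.tsum_add ((hE (j+1)).mul_left z) (hE j)]
    simp only [PowerSeries.coeff_one, Nat.succ_ne_zero, if_false, sub_zero, Nat.choose_zero_succ,
      Nat.cast_zero, zero_mul, mul_zero, zero_add]
    refine tsum_congr fun r => ?_
    rw [Nat.choose_succ_succ, Nat.add_sub_add_right]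
    rcases lt_or_ge r (j + 1) with h | h
    · rw [Nat.choose_eq_zero_of_lt h]; push_cast; ring
    · have : r - j = (r - (j + 1)) + 1 := by omega
      rw [this, pow_succ]; push_cast; ring

/-- Hermite interpolation: the ideals generated by (X - z)^r are pairwise coprime, so the Chinese
remainder theorem applies. -/
theorem exists_approx (Z : Set ℂ) (hZ : Z.Finite) (r : ℕ) (F : ℂ → PowerSeries ℂ) :
    ∃ P : ℂ[X], Approx P Z r F := by
  have := hZ.to_subtype
  obtain ⟨P, hP⟩ := Ideal.exists_forall_sub_mem_ideal
    (I := fun z : Z => Ideal.span {(X - C (z : ℂ)) ^ r}) (by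
      intro z w hzw
      rw [Function.onFun, Ideal.isCoprime_span_singleton_iff]
      refine IsCoprime.pow ?_
      exact Polynomial.pairwise_coprime_X_sub_C Subtype.val_injective hzw)
    -- Translating by -z turns the truncated expansion in the local parameter into a polynomial in X
    -- - z.
    (fun z => taylor (-(z : ℂ)) (PowerSeries.trunc r (F z)))
  refine ⟨P, fun z hz => ?_⟩
  obtain ⟨Q, hQ⟩ := Ideal.mem_span_singleton.1 (hP ⟨z, hz⟩)
  have h1 := congrArg (taylor z) hQ
  rw [map_sub, taylor_taylor, add_neg_cancel, taylor_zero, taylor_mul, taylor_pow] at h1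
  have h2 : taylor z P = PowerSeries.trunc r (F z) + X ^ r * taylor z Q := by
    rw [sub_eq_iff_eq_add'] at h1
    rw [h1]; simp
  rw [h2]
  refine PowerSeries.X_pow_dvd_iff.2 fun j hj => ?_
  rw [map_sub, Polynomial.coeff_coe, Polynomial.coeff_add, PowerSeries.coeff_trunc, if_pos hj,
    Polynomial.coeff_X_pow_mul', if_neg (by omega), add_zero, sub_self]

theorem Approx.mono {P : ℂ[X]} {Z Z' : Set ℂ} {r r' : ℕ} {F : ℂ → PowerSeries ℂ}
    (h : Approx P Z r F) (hZ : Z' ⊆ Z) (hr : r' ≤ r) : Approx P Z' r' F :=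
  fun z hz => (pow_dvd_pow _ hr).trans (h z (hZ hz))

theorem Approx.congr {P : ℂ[X]} {Z : Set ℂ} {r : ℕ} {F G : ℂ → PowerSeries ℂ}
    (h : Approx P Z r F) (hFG : ∀ z ∈ Z, F z = G z) : Approx P Z r G :=
  fun z hz => hFG z hz ▸ h z hz

theorem Approx.mul {P Q : ℂ[X]} {Z : Set ℂ} {r : ℕ} {F G : ℂ → PowerSeries ℂ}
    (hP : Approx P Z r F) (hQ : Approx Q Z r G) : Approx (P * Q) Z r (fun z => F z * G z) := by
  intro z hz
  rw [taylor_mul, Polynomial.coe_mul]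
  convert dvd_add ((hP z hz).mul_right ((taylor z Q : ℂ[X]) : PowerSeries ℂ))
    ((hQ z hz).mul_left (F z)) using 1
  ring

/-- The operator depends on the prescribed expansions only and not on the interpolating polynomial,
which makes polynomials interchangeable below. -/
theorem aeval_eq_of_approx {V : Type*} [AddCommGroup V] [Module ℂ V] [FiniteDimensional ℂ V]
    (A : Module.End ℂ V) {P Q : ℂ[X]} {d : ℕ} (hd : Module.finrank ℂ V ≤ d)
    {F : ℂ → PowerSeries ℂ} (hP : Approx P {z | A.HasEigenvalue z} d F)
    (hQ : Approx Q {z | A.HasEigenvalue z} d F) : aeval A P = aeval A Q := by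
  refine LinearMap.ext (generalized_induction A hd ?_ ?_ ?_)
  · simp
  · intro x y hx hy
    rw [map_add, map_add, hx, hy]
  · intro z hz y hy
    rw [aeval_apply_of_generalized A z d y hy, aeval_apply_of_generalized A z d y hy]
    refine Finset.sum_congr rfl fun j hj => ?_
    have h1 := PowerSeries.X_pow_dvd_iff.1 (hP z hz) j (by simpa using hj)
    have h2 := PowerSeries.X_pow_dvd_iff.1 (hQ z hz) j (by simpa using hj)
    rw [map_sub, Polynomial.coeff_coe, sub_eq_zero] at h1 h2
    rw [h1, h2]

end FunctionalCalculus

/-! ### Polynomials acting on generalized weight vectors. -/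

section Weights

open MvPolynomial

variable {σ : Type}

/-- The restriction of a polynomial to the line `t ↦ x + t v`. -/
def lineExp (x v : σ → ℂ) : MvPolynomial σ ℂ →ₐ[ℂ] PowerSeries ℂ :=
  aeval fun c => PowerSeries.C (x c) + PowerSeries.C (v c) * PowerSeries.X

/-- The polynomial `f` vanishes to order `N` at `x` (tested on lines in generic directions). -/
def VanishesTo (f : MvPolynomial σ ℂ) (x : σ → ℂ) (N : ℕ) : Prop :=
  ∀ v : σ → ℂ, Function.Injective v → PowerSeries.X ^ N ∣ lineExp x v f

theorem lineExp_zero_of_isHomogeneous [Fintype σ] (v : σ → ℂ) {h : MvPolynomial σ ℂ} {k : ℕ}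
    (hh : h.IsHomogeneous k) :
    lineExp 0 v h = PowerSeries.C (eval v h) * PowerSeries.X ^ k := by
  rw [lineExp, aeval_def, eval₂_eq', eval_eq', map_sum, Finset.sum_mul]
  refine Finset.sum_congr rfl fun s hs => ?_
  have hk := hh (mem_support_iff.1 hs)
  rw [← hk, Finsupp.weight_apply, Finsupp.sum_fintype _ _ (by simp)]
  simp [mul_pow, Finset.prod_mul_distrib, Finset.prod_pow_eq_pow_sum, mul_assoc]

theorem coeff_lineExp_zero [Fintype σ] (v : σ → ℂ) (g : MvPolynomial σ ℂ) (k : ℕ) :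
    PowerSeries.coeff k (lineExp 0 v g) = eval v (homogeneousComponent k g) := by
  conv_lhs => rw [← sum_homogeneousComponent g]
  simp only [map_sum, lineExp_zero_of_isHomogeneous v (homogeneousComponent_isHomogeneous _ g),
    PowerSeries.coeff_C_mul, PowerSeries.coeff_X_pow]
  by_cases hk : k < g.totalDegree + 1
  · rw [Finset.sum_eq_single k]
    · simp
    · intro j _ hj
      rw [if_neg (Ne.symm hj), mul_zero]
    · intro hj
      exact absurd (Finset.mem_range.2 hk) hj
  · rw [homogeneousComponent_eq_zero _ _ (by omega), map_zero]
    refine Finset.sum_eq_zero fun j hj => ?_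
    rw [if_neg (by have := Finset.mem_range.1 hj; omega), mul_zero]

/-- The product of all X_c - X_d with c ≠ d vanishes at every non-injective v, so h times this
nonzero product vanishes everywhere. -/
theorem eq_zero_of_eval_injective [Fintype σ] [DecidableEq σ] (h : MvPolynomial σ ℂ)
    (hv : ∀ v : σ → ℂ, Function.Injective v → eval v h = 0) : h = 0 := by
  set D : MvPolynomial σ ℂ := ∏ p : σ × σ, if p.1 = p.2 then 1 else X p.1 - X p.2 with hD
  have hD0 : D ≠ 0 := by
    refine Finset.prod_ne_zero_iff.2 fun p _ => ?_
    split_ifs with hp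
    · exact one_ne_zero
    · rw [sub_ne_zero]
      exact fun h => hp (X_injective h)
  have : h * D = 0 := by
    refine MvPolynomial.funext fun v => ?_
    rw [map_mul, map_zero]
    by_cases hi : Function.Injective v
    · rw [hv v hi, zero_mul]
    · rw [Function.Injective] at hi
      push Not at hi
      obtain ⟨c, d, hcd, hne⟩ := hi
      rw [hD, map_prod, Finset.prod_eq_zero (Finset.mem_univ (c, d)), mul_zero]
      simp [hne, hcd]
  exact (mul_eq_zero.1 this).resolve_right hD0

theorem lineExp_translate (x v : σ → ℂ) (f : MvPolynomial σ ℂ) :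
    lineExp 0 v (aeval (fun c => X c + C (x c)) f) = lineExp x v f := by
  have : (lineExp 0 v).comp (aeval fun c => X c + C (x c)) = lineExp x v := by
    refine algHom_ext fun c => ?_
    simp [lineExp, ← algebraMap_eq, add_comm]
  exact DFunLike.congr_fun this f

variable {V : Type*} [AddCommGroup V] [Module ℂ V]

/-- `y` is annihilated by `(X_c - x_c)^d` for all `c`. -/
def GenWeight (ρ : MvPolynomial σ ℂ →ₐ[ℂ] Module.End ℂ V) (d : ℕ) (x : σ → ℂ) (y : V) : Prop :=
  ∀ c, ((ρ (X c) - algebraMap ℂ _ (x c)) ^ d) y = 0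

/-- After translation of x to the origin, all homogeneous components of degree at most d|σ| are
zero. A monomial of larger degree contains some X_c^d by pigeonhole, and this factor kills y. -/
theorem GenWeight.apply_eq_zero [Fintype σ] {ρ : MvPolynomial σ ℂ →ₐ[ℂ] Module.End ℂ V} {d : ℕ} {x : σ → ℂ}
    {y : V} (hy : GenWeight ρ d x y) {f : MvPolynomial σ ℂ}
    (hf : VanishesTo f x (d * Fintype.card σ + 1)) : ρ f y = 0 := by
  classical
  set g : MvPolynomial σ ℂ := aeval (fun c => X c + C (x c)) f with hg
  have hcomp : ∀ k < d * Fintype.card σ + 1, homogeneousComponent k g = 0 := by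
    intro k hk
    refine eq_zero_of_eval_injective _ fun v hv => ?_
    rw [← coeff_lineExp_zero, hg, lineExp_translate]
    exact PowerSeries.X_pow_dvd_iff.1 (hf v hv) k hk
  set ρ' : MvPolynomial σ ℂ →ₐ[ℂ] Module.End ℂ V := ρ.comp (aeval fun c => X c - C (x c)) with hρ'
  have hfg : ρ f = ρ' g := by
    rw [hρ', AlgHom.comp_apply, hg]
    congr 1
    have : (aeval fun c => X c - C (x c)).comp (aeval fun c => X c + C (x c)) =
        AlgHom.id ℂ (MvPolynomial σ ℂ) := by
      refine algHom_ext fun c => ?_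
      simp [← algebraMap_eq]
    exact (DFunLike.congr_fun this f).symm
  have hX : ∀ c, ρ' (X c ^ d) y = 0 := by
    intro c
    have := hy c
    simpa [hρ', ← algebraMap_eq] using this
  rw [hfg, g.as_sum, map_sum, LinearMap.sum_apply]
  refine Finset.sum_eq_zero fun s hs => ?_
  have hdeg : d * Fintype.card σ + 1 ≤ s.degree := by
    by_contra! hlt
    have := congrArg (coeff s) (hcomp _ hlt)
    rw [coeff_homogeneousComponent, if_pos rfl] at this
    exact mem_support_iff.1 hs (by simpa using this)
  obtain ⟨c, hc⟩ : ∃ c, d ≤ s c := by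
    by_contra! hlt
    have h1 : s.degree ≤ ∑ c : σ, d := by
      rw [Finsupp.degree_eq_sum]
      exact Finset.sum_le_sum fun c _ => (hlt c).le
    rw [Finset.sum_const, Finset.card_univ, smul_eq_mul, mul_comm] at h1
    omega
  have : monomial s (coeff s g) = monomial (s - Finsupp.single c d) (coeff s g) * X c ^ d := by
    rw [X_pow_eq_monomial, monomial_mul, mul_one, tsub_add_cancel_of_le]
    simpa using hc
  rw [this, map_mul, Module.End.mul_apply, hX, map_zero]

/-- The variables act by commuting operators over ℂ, so their simultaneous generalized eigenspaces
span. -/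
theorem genWeight_induction [FiniteDimensional ℂ V] (ρ : MvPolynomial σ ℂ →ₐ[ℂ] Module.End ℂ V)
    {p : V → Prop} (zero : p 0) (add : ∀ x y, p x → p y → p (x + y))
    (mem : ∀ x y, y ≠ 0 → GenWeight ρ (Module.finrank ℂ V) x y → p y) (y : V) : p y := by
  have h := Module.End.iSup_iInf_maxGenEigenspace_eq_top_of_iSup_maxGenEigenspace_eq_top_of_commute
    (fun c => ρ (X c)) (fun c d _ => by
      change ρ (X c) * ρ (X d) = ρ (X d) * ρ (X c)
      rw [← map_mul, mul_comm, map_mul])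
    (fun c => Module.End.iSup_maxGenEigenspace_eq_top _)
  have hy : y ∈ (⊤ : Submodule ℂ V) := trivial
  rw [← h] at hy
  induction hy using Submodule.iSup_induction' with
  | mem x y hy =>
    by_cases h0 : y = 0
    · rw [h0]; exact zero
    refine mem x y h0 fun c => ?_
    have hc := (Submodule.mem_iInf _).1 hy c
    rw [Module.End.maxGenEigenspace_eq_genEigenspace_finrank, Module.End.mem_genEigenspace_nat] at hc
    simpa [Algebra.algebraMap_eq_smul_one] using hc
  | zero => exact zero
  | add x y _ _ hx hy => exact add x y hx hy

/-- The order to which a polynomial has to vanish at the weights in order to act by zero. -/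
abbrev killOrder (σ V : Type*) [Fintype σ] [AddCommGroup V] [Module ℂ V] : ℕ :=
  Module.finrank ℂ V * Fintype.card σ + 1

/-- `x` is a weight of the representation `ρ` of the polynomial ring. -/
def IsWeight (ρ : MvPolynomial σ ℂ →ₐ[ℂ] Module.End ℂ V) (x : σ → ℂ) : Prop :=
  ∃ y ≠ 0, GenWeight ρ (Module.finrank ℂ V) x y

/-- The bridge from operator identities to power series: every relation in the construction of Λ is
reduced to this criterion. -/
theorem eq_zero_of_vanishesTo [Fintype σ] [FiniteDimensional ℂ V]
    (ρ : MvPolynomial σ ℂ →ₐ[ℂ] Module.End ℂ V) {f : MvPolynomial σ ℂ}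
    (hf : ∀ x, IsWeight ρ x → VanishesTo f x (killOrder σ V)) : ρ f = 0 := by
  refine LinearMap.ext (genWeight_induction ρ (by simp) ?_ ?_)
  · intro x y hx hy
    rw [map_add, map_add, hx, hy]
  · intro x y h0 hy
    exact hy.apply_eq_zero (hf x ⟨y, h0, hy⟩)

/-- A high power of f - f(x) vanishes to high order at x, hence kills the weight vector, which is
thus a generalized eigenvector of f. -/
theorem IsWeight.hasEigenvalue [Fintype σ] {ρ : MvPolynomial σ ℂ →ₐ[ℂ] Module.End ℂ V} {x : σ → ℂ}
    (hx : IsWeight ρ x) (f : MvPolynomial σ ℂ) : (ρ f).HasEigenvalue (eval x f) := by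
  obtain ⟨y, h0, hy⟩ := hx
  refine Module.End.hasEigenvalue_of_hasGenEigenvalue (k := killOrder σ V) fun hbot => h0 ?_
  have h1 : ∀ v, PowerSeries.X ∣ lineExp x v (f - C (eval x f)) := by
    intro v
    rw [PowerSeries.X_dvd_iff]
    have : (PowerSeries.constantCoeff (R := ℂ)).comp (lineExp x v : MvPolynomial σ ℂ →+* _) =
        eval x := by
      refine MvPolynomial.ringHom_ext (fun r => ?_) fun c => ?_
      · simp [lineExp]
      · simp [lineExp]
    refine (DFunLike.congr_fun this (f - C (eval x f))).trans ?_
    simp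
  have h2 := hy.apply_eq_zero (f := (f - C (eval x f)) ^ killOrder σ V) (fun v _ => by
    rw [map_pow]; exact pow_dvd_pow_of_dvd (h1 v) _)
  have h3 : y ∈ (ρ f).genEigenspace (eval x f) (killOrder σ V) := by
    rw [Module.End.mem_genEigenspace_nat]
    rw [← algebraMap_eq] at h2
    simpa [Algebra.algebraMap_eq_smul_one] using h2
  rw [hbot] at h3
  exact h3

/-- With w ≠ 0, the series u + wX is a unit if u ≠ 0 and a unit times X otherwise. Dividing by it
costs at most one order. -/
theorem dvd_of_dvd_linear_mul {u w : ℂ} (hw : w ≠ 0) {N : ℕ} {F : PowerSeries ℂ}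
    (h : PowerSeries.X ^ (N + 1) ∣ (PowerSeries.C u + PowerSeries.C w * PowerSeries.X) * F) :
    PowerSeries.X ^ N ∣ F := by
  by_cases hu : u = 0
  · subst hu
    rw [map_zero, zero_add, pow_succ', mul_comm (PowerSeries.C w), mul_assoc] at h
    have h1 := (mul_dvd_mul_iff_left PowerSeries.X_ne_zero).1 h
    have hC : IsUnit (PowerSeries.C w) := (isUnit_iff_ne_zero.2 hw).map _
    exact (hC.dvd_mul_left).1 h1
  · have hC : IsUnit (PowerSeries.C u + PowerSeries.C w * PowerSeries.X) := by
      rw [PowerSeries.isUnit_iff_constantCoeff]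
      simpa using hu
    exact (pow_dvd_pow _ (Nat.le_succ N)).trans ((hC.dvd_mul_left).1 h)

theorem rescale_C (w a : ℂ) : PowerSeries.rescale w (PowerSeries.C a) = PowerSeries.C a := by
  ext j
  rw [PowerSeries.coeff_rescale, PowerSeries.coeff_C]
  split_ifs with h
  · rw [h, pow_zero, one_mul]
  · rw [mul_zero]

theorem aeval_linear_eq_rescale (u w : ℂ) (P : Polynomial ℂ) :
    Polynomial.aeval (PowerSeries.C u + PowerSeries.C w * PowerSeries.X) P =
      PowerSeries.rescale w ((Polynomial.taylor u P : Polynomial ℂ) : PowerSeries ℂ) := by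
  induction P using Polynomial.induction_on with
  | C a => simp [rescale_C]
  | add p q hp hq => rw [map_add, map_add, Polynomial.coe_add, map_add, hp, hq]
  | monomial k a h =>
    rw [pow_succ, ← mul_assoc, map_mul, h, Polynomial.taylor_mul, Polynomial.coe_mul, map_mul]
    simp [add_comm, PowerSeries.rescale_X, rescale_C]

/-- On the line, P(l) is P(u + wt), the Taylor expansion of P at u rescaled by w; rescaling
preserves divisibility by powers of the parameter. -/
theorem Approx.lineExp_dvd {P : Polynomial ℂ} {Z : Set ℂ} {r : ℕ} {F : ℂ → PowerSeries ℂ}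
    (hP : Approx P Z r F) {x v : σ → ℂ} {l : MvPolynomial σ ℂ} {u w : ℂ} (hu : u ∈ Z)
    (hl : lineExp x v l = PowerSeries.C u + PowerSeries.C w * PowerSeries.X) :
    PowerSeries.X ^ r ∣ lineExp x v (Polynomial.aeval l P) - PowerSeries.rescale w (F u) := by
  rw [← Polynomial.aeval_algHom_apply, hl, aeval_linear_eq_rescale, ← map_sub]
  obtain ⟨G, hG⟩ := hP u hu
  rw [hG, map_mul, map_pow, PowerSeries.rescale_X, mul_pow]
  exact (dvd_mul_left _ _).mul_right _

end Weights

/-! ### The graded Hecke algebra, its central elements, and real root spectra. -/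

section Graded

open MvPolynomial

variable {m : ℕ} {n : Fin m → ℕ}

/-- The action of the Weyl group on `S(V)`. -/
abbrev act (w : Weyl n) : Poly n →ₐ[ℂ] Poly n := rename (Equiv.sigmaCongrRight w)

theorem act_lin (w : Weyl n) (v : Coord n → ℂ) : act w (lin v) = lin (permute w v) := by
  simp only [act, lin, map_sum, map_smul, rename_X]
  refine Fintype.sum_equiv (Equiv.sigmaCongrRight w) _ _ fun c => ?_
  change v c • X _ = v ⟨c.1, (w c.1).symm (w c.1 c.2)⟩ • X _
  rw [Equiv.symm_apply_apply]

theorem lin_root (k : Fin m) (a b : Fin (n k)) :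
    (lin (root k a b) : Poly n) = X ⟨k, a⟩ - X ⟨k, b⟩ := by
  rw [← GradedHecke.lin_single, ← GradedHecke.lin_single]
  simp only [lin, root, Pi.sub_apply, sub_smul, Finset.sum_sub_distrib]

theorem X_sub_X_ne_zero {c d : Coord n} (h : c ≠ d) : (X c - X d : Poly n) ≠ 0 := by
  rw [sub_ne_zero]
  exact fun h' => h (X_injective h')

theorem mk_ne_mk {k : Fin m} {a b : Fin (n k)} (h : a ≠ b) : (⟨k, a⟩ : Coord n) ≠ ⟨k, b⟩ :=
  fun h' => h (eq_of_heq (Sigma.mk.inj h').2)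

theorem ne_of_succ {N : ℕ} {a b : Fin N} (hab : (a : ℕ) + 1 = b) : a ≠ b := by
  rintro rfl; omega

theorem act_simple_X_left (k : Fin m) (a b : Fin (n k)) :
    act (simple k a b) (X ⟨k, a⟩) = X ⟨k, b⟩ := by
  simp [simple, rename_X]

theorem act_simple_X_right (k : Fin m) (a b : Fin (n k)) :
    act (simple k a b) (X ⟨k, b⟩) = X ⟨k, a⟩ := by
  simp [simple, rename_X]

theorem act_simple_X_of_ne (k : Fin m) (a b : Fin (n k)) (c : Coord n) (h1 : c ≠ ⟨k, a⟩)
    (h2 : c ≠ ⟨k, b⟩) : act (simple k a b) (X c) = X c := by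
  obtain ⟨k', c⟩ := c
  simp only [rename_X, Equiv.sigmaCongrRight_apply]
  congr 2
  by_cases hk : k' = k
  · subst hk
    rw [simple, Pi.mulSingle_eq_same, Equiv.swap_apply_of_ne_of_ne]
    · rintro rfl; exact h1 rfl
    · rintro rfl; exact h2 rfl
  · rw [simple, Pi.mulSingle_eq_of_ne hk]; rfl

theorem act_simple_act_simple (k : Fin m) (a b : Fin (n k)) (f : Poly n) :
    act (simple k a b) (act (simple k a b) f) = f := by
  rw [act, rename_rename]
  convert rename_id_apply f
  funext ⟨k', c⟩
  simp only [Function.comp, Equiv.sigmaCongrRight_apply, id]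
  congr 1
  by_cases hk : k' = k
  · subst hk
    simp [simple]
  · simp [simple, Pi.mulSingle_eq_of_ne hk]

/-- Twisted Leibniz rule: fc - s(f)s(c) = (f - s(f)) s(c) + f (c - s(c)). -/
theorem exists_divided_difference (k : Fin m) (a b : Fin (n k)) (f : Poly n) :
    ∃ g : Poly n, g * (X ⟨k, a⟩ - X ⟨k, b⟩) = f - act (simple k a b) f := by
  induction f using MvPolynomial.induction_on with
  | C c => exact ⟨0, by simp⟩
  | add f g hf hg =>
    obtain ⟨f', hf⟩ := hf
    obtain ⟨g', hg⟩ := hg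
    exact ⟨f' + g', by rw [add_mul, hf, hg, map_add]; ring⟩
  | mul_X f c hf =>
    obtain ⟨f', hf⟩ := hf
    obtain ⟨e, he⟩ : ∃ e : Poly n, e * (X ⟨k, a⟩ - X ⟨k, b⟩) = X c - act (simple k a b) (X c) := by
      by_cases h1 : c = ⟨k, a⟩
      · subst h1
        exact ⟨1, by rw [act_simple_X_left, one_mul]⟩
      by_cases h2 : c = ⟨k, b⟩
      · subst h2
        exact ⟨-1, by rw [act_simple_X_right]; ring⟩
      exact ⟨0, by rw [act_simple_X_of_ne k a b c h1 h2]; ring⟩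
    refine ⟨f' * act (simple k a b) (X c) + f * e, ?_⟩
    rw [map_mul]
    linear_combination act (simple k a b) (X c) * hf + f * he

namespace GradedHecke

variable (q : ℝ)

/-- The cross relation passes from V to S(V) by the same twisted Leibniz rule as the divided
difference. -/
theorem ofPoly_mul_t (k : Fin m) (a b : Fin (n k)) (hab : (a : ℕ) + 1 = b) (f g : Poly n)
    (hg : g * (X ⟨k, a⟩ - X ⟨k, b⟩) = f - act (simple k a b) f) :
    ofPoly q n f * t q (simple k a b) = t q (simple k a b) * ofPoly q n (act (simple k a b) f) +
      (Real.log q : ℂ) • ofPoly q n g := by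
  -- The induction has to build g together with the relation; cancelling the root identifies it with
  -- the given one.
  suffices h : ∃ g : Poly n, g * (X ⟨k, a⟩ - X ⟨k, b⟩) = f - act (simple k a b) f ∧
      ofPoly q n f * t q (simple k a b) =
        t q (simple k a b) * ofPoly q n (act (simple k a b) f) +
          (Real.log q : ℂ) • ofPoly q n g by
    obtain ⟨g', h1, h2⟩ := h
    rw [h2, mul_right_cancel₀ (X_sub_X_ne_zero (mk_ne_mk (ne_of_succ hab))) (h1.trans hg.symm)]
  clear hg g
  induction f using MvPolynomial.induction_on with
  | C c =>
    refine ⟨0, by simp, ?_⟩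
    rw [← algebraMap_eq, AlgHom.commutes, AlgHom.commutes, AlgHom.commutes, map_zero, smul_zero,
      add_zero]
    exact Algebra.commutes c (t q (simple k a b))
  | add f g hf hg =>
    obtain ⟨f', hf, hf2⟩ := hf
    obtain ⟨g', hg, hg2⟩ := hg
    refine ⟨f' + g', by rw [add_mul, hf, hg, map_add]; ring, ?_⟩
    rw [map_add, add_mul, hf2, hg2, map_add, map_add, map_add, mul_add, smul_add]
    abel
  | mul_X f c hf =>
    obtain ⟨f', hf, hf2⟩ := hf
    set v : Coord n → ℂ := Pi.single c 1 with hv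
    have he2 := cross q k a b hab v
    rw [sub_eq_iff_eq_add, ← act_lin, hv, lin_single] at he2
    obtain ⟨e, he⟩ := exists_divided_difference k a b (X c : Poly n)
    have hev : e = algebraMap ℂ _ (v ⟨k, a⟩ - v ⟨k, b⟩) := by
      refine mul_right_cancel₀ (X_sub_X_ne_zero (mk_ne_mk (ne_of_succ hab))) (he.trans ?_)
      by_cases h1 : c = ⟨k, a⟩
      · subst h1
        rw [act_simple_X_left, hv, Pi.single_eq_same,
          Pi.single_eq_of_ne (mk_ne_mk (ne_of_succ hab)).symm]
        simp
      by_cases h2 : c = ⟨k, b⟩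
      · subst h2
        rw [act_simple_X_right, hv, Pi.single_eq_same,
          Pi.single_eq_of_ne (mk_ne_mk (ne_of_succ hab))]
        simp
      rw [act_simple_X_of_ne k a b c h1 h2, hv, Pi.single_eq_of_ne (Ne.symm h1),
        Pi.single_eq_of_ne (Ne.symm h2)]
      simp
    refine ⟨f' * act (simple k a b) (X c) + f * e, ?_, ?_⟩
    · rw [map_mul]
      linear_combination act (simple k a b) (X c) * hf + f * he
    · rw [map_mul, mul_assoc, he2, mul_add, ← mul_assoc, hf2, hev]
      simp only [map_mul, map_add, AlgHom.commutes]
      rw [add_mul, mul_assoc, smul_mul_assoc, smul_add, add_comm, add_assoc, ← Algebra.commutes]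
      simp only [Algebra.smul_def]
      congr 2
      rw [← mul_assoc, ← Algebra.commutes (Real.log q : ℂ) (ofPoly q n f * _)]

theorem ofPoly_commute_t_simple (k : Fin m) (a b : Fin (n k)) (hab : (a : ℕ) + 1 = b) {f : Poly n}
    (hf : act (simple k a b) f = f) : Commute (ofPoly q n f) (t q (simple k a b)) := by
  have := ofPoly_mul_t q k a b hab f 0 (by rw [hf, zero_mul, sub_self])
  rw [hf, map_zero, smul_zero, add_zero] at this
  exact this

/-- For an invariant polynomial all divided differences vanish, so the correction terms of the cross
relations disappear. -/
theorem ofPoly_commute_of_mem_invariants {f : Poly n} (hf : f ∈ invariants n)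
    (z : GradedHecke q n) : Commute (ofPoly q n f) z := by
  have := mem_of_generators q (Subalgebra.centralizer ℂ {ofPoly q n f}) ?_ ?_ z
  · exact (Subalgebra.mem_centralizer_iff ℂ).1 this _ rfl
  · intro w
    refine (Subalgebra.mem_centralizer_iff ℂ).2 ?_
    rintro _ rfl
    change Commute _ _
    induction w using weyl_induction with
    | one => rw [t_one]; exact Commute.one_right _
    | step w k a b hab _ _ ih =>
      rw [← t_mul]
      exact ih.mul_right (ofPoly_commute_t_simple q k a b hab (hf _))
  · intro v
    refine (Subalgebra.mem_centralizer_iff ℂ).2 ?_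
    rintro _ rfl
    rw [← map_mul, mul_comm, map_mul]

end GradedHecke

variable (q : ℝ) {M : Type u} [AddCommGroup M] [Module ℂ M] [Module (GradedHecke q n) M]
  [IsScalarTower ℂ (GradedHecke q n) M]

/-- All roots have real eigenvalues in the representation `ρ` of `S(V)`. -/
def HasRealRoots {V : Type*} [AddCommGroup V] [Module ℂ V] (ρ : Poly n →ₐ[ℂ] Module.End ℂ V) :
    Prop :=
  ∀ (k : Fin m) (a b : Fin (n k)) (μ : ℂ),
    (ρ (X ⟨k, a⟩ - X ⟨k, b⟩)).HasEigenvalue μ → μ.im = 0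

/-- The action of `S(V)` on an `ℍ_n`-module. -/
abbrev polyAction (M : Type u) [AddCommGroup M] [Module ℂ M] [Module (GradedHecke q n) M]
    [IsScalarTower ℂ (GradedHecke q n) M] : Poly n →ₐ[ℂ] Module.End ℂ M :=
  (Algebra.lsmul ℂ ℂ M).comp (GradedHecke.ofPoly q n)

/-- The product F of μ - wα over w in the Weyl group is invariant, and κ = F(ζ) is nonzero because
each root is real at ζ and μ is not. Since F - κ is nilpotent on N, F is invertible there, and μ - α
divides F. -/
theorem IsKilledByPower.mem_range {N : Submodule (GradedHecke q n) M} {ζ : Coord n → ℂ}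
    (hζ : IsRealPoint n ζ) (hN : IsKilledByPower q n N ζ) (k : Fin m) (a b : Fin (n k)) {μ : ℂ}
    (hμ : μ.im ≠ 0) {x : M} (hx : x ∈ N) :
    ∃ y, polyAction q M (C μ - (X ⟨k, a⟩ - X ⟨k, b⟩)) y = x := by
  obtain ⟨r, hr⟩ := hN
  set α : Poly n := X ⟨k, a⟩ - X ⟨k, b⟩ with hα
  set F : Poly n := ∏ w : Weyl n, (C μ - act w α) with hF
  have hinv : F ∈ invariants n := by
    intro w
    change act w F = F
    rw [hF, map_prod]
    refine Fintype.prod_equiv (Equiv.mulLeft w) _ _ fun w' => ?_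
    rw [map_sub, algHom_C]
    simp only [act, rename_rename]
    rfl
  have hF0 : eval ζ F ≠ 0 := by
    rw [hF, map_prod, Finset.prod_ne_zero_iff]
    intro w _ h0
    rw [map_sub, eval_C, sub_eq_zero] at h0
    apply hμ
    rw [h0, hα]
    simpa using hζ k (w k a) (w k b)
  set κ := eval ζ F with hκ
  set z : invariants n := ⟨F, hinv⟩ - algebraMap ℂ _ κ with hz
  have hzJ : z ∈ centralIdeal ζ := by
    rw [centralIdeal, RingHom.mem_ker, hz, map_sub, AlgHom.commutes]
    simp [hκ]
  have h1 := hr _ (Ideal.pow_mem_pow hzJ r) x hx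
  have hzF : ((z ^ r : invariants n) : Poly n) = (F - C κ) ^ r := by
    simp [hz, algebraMap_eq]
  -- F divides (F - κ)^r - (-κ)^r. The first power kills x, so F·U acts on x by the nonzero scalar
  -- -(-κ)^r.
  obtain ⟨U, hU⟩ := sub_dvd_pow_sub_pow (F - C κ) (- C κ) r
  rw [sub_neg_eq_add, sub_add_cancel] at hU
  obtain ⟨G, hG⟩ : (C μ - act 1 α) ∣ F := Finset.dvd_prod_of_mem _ (Finset.mem_univ 1)
  have hact : act 1 α = α := by
    convert rename_id_apply α
    exact congrArg DFunLike.coe Equiv.sigmaCongrRight_refl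
  rw [hact] at hG
  have h2 : polyAction q M ((C μ - α) * (G * U)) x = - (-κ) ^ r • x := by
    rw [← mul_assoc, ← hG, ← hU, map_sub, LinearMap.sub_apply]
    rw [hzF] at h1
    change GradedHecke.ofPoly q n ((F - C κ) ^ r) • x - _ = _
    rw [h1, zero_sub, ← C_neg, ← C_pow, ← algebraMap_eq, AlgHom.commutes, Module.algebraMap_end_apply,
      neg_smul]
  refine ⟨(- (-κ) ^ r)⁻¹ • polyAction q M (G * U) x, ?_⟩
  rw [map_smul, ← Module.End.mul_apply, ← map_mul, h2, smul_smul, inv_mul_cancel₀, one_smul]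
  exact neg_ne_zero.2 (pow_ne_zero _ (neg_ne_zero.2 hF0))

/-- For non-real μ, the operator μ - α is surjective on each summand, hence on M, hence injective by
finite dimension. -/
theorem hasRealRoots_of_sSup [FiniteDimensional ℂ M]
    (h : sSup {N : Submodule (GradedHecke q n) M |
      ∃ ζ, IsRealPoint n ζ ∧ IsKilledByPower q n N ζ} = ⊤) : HasRealRoots (polyAction (n := n) q M) := by
  intro k a b μ hμ
  by_contra hne
  set B := polyAction q M (C μ - (X ⟨k, a⟩ - X ⟨k, b⟩))
  have hsurj : Function.Surjective B := by
    intro x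
    have hx : x ∈ (⊤ : Submodule (GradedHecke q n) M) := trivial
    rw [← h, sSup_eq_iSup'] at hx
    induction hx using Submodule.iSup_induction' with
    | mem N x hx =>
      obtain ⟨ζ, h1, h2⟩ := N.2
      exact h2.mem_range q h1 k a b hne hx
    | zero => exact ⟨0, map_zero _⟩
    | add x y _ _ hx hy =>
      obtain ⟨x', rfl⟩ := hx
      obtain ⟨y', rfl⟩ := hy
      exact ⟨x' + y', map_add _ _ _⟩
  have hinj := LinearMap.injective_iff_surjective.2 hsurj
  obtain ⟨y, hy⟩ := hμ.exists_hasEigenvector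
  refine hy.2 (hinj ?_)
  rw [map_zero]
  change polyAction q M (C μ - _) y = 0
  rw [map_sub, LinearMap.sub_apply, hy.apply_eq_smul, ← algebraMap_eq, AlgHom.commutes,
    Module.algebraMap_end_apply, sub_self]

theorem HasRealRoots.isRealPoint {V : Type*} [AddCommGroup V] [Module ℂ V]
    {ρ : Poly n →ₐ[ℂ] Module.End ℂ V} (h : HasRealRoots ρ) {x : Coord n → ℂ} (hx : IsWeight ρ x) :
    IsRealPoint n x := by
  intro k a b
  have := h k a b _ (hx.hasEigenvalue _)
  simpa using this

/-- Restriction to a line through ζ maps the ideal into (X), hence its N-th power into (X^N). -/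
theorem vanishesTo_of_mem_centralIdeal_pow {ζ : Coord n → ℂ} {N : ℕ} {z : invariants n}
    (hz : z ∈ centralIdeal ζ ^ N) : VanishesTo (z : Poly n) ζ N := by
  intro v _
  set φ : invariants n →+* PowerSeries ℂ :=
    (lineExp ζ v : Poly n →+* PowerSeries ℂ).comp (invariants n).val.toRingHom
  have h1 : centralIdeal ζ ≤ (Ideal.span {PowerSeries.X}).comap φ := by
    intro y hy
    rw [Ideal.mem_comap, Ideal.mem_span_singleton, PowerSeries.X_dvd_iff]
    rw [centralIdeal, RingHom.mem_ker] at hy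
    have : (PowerSeries.constantCoeff (R := ℂ)).comp (lineExp ζ v : Poly n →+* _) =
        (aeval ζ : Poly n →ₐ[ℂ] ℂ).toRingHom := by
      refine MvPolynomial.ringHom_ext (fun r => ?_) fun c => ?_
      · simp [lineExp]
      · simp [lineExp]
    exact (DFunLike.congr_fun this (y : Poly n)).trans hy
  have h2 := Ideal.le_comap_pow φ N (Ideal.pow_right_mono h1 N hz)
  rw [Ideal.mem_comap, Ideal.span_singleton_pow, Ideal.mem_span_singleton] at h2
  exact h2

/-- Converse of `hasRealRoots_of_sSup`. A vector of generalized weight ζ is killed by a fixed power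
of the central ideal at ζ, the vectors so killed form a submodule by centrality, and ζ is real
because every root takes an eigenvalue as its value there. -/
theorem sSup_eq_top_of_hasRealRoots [FiniteDimensional ℂ M] (h : HasRealRoots (polyAction (n := n) q M)) :
    sSup {N : Submodule (GradedHecke q n) M |
      ∃ ζ, IsRealPoint n ζ ∧ IsKilledByPower q n N ζ} = ⊤ := by
  refine eq_top_iff.2 fun y _ => ?_
  induction y using genWeight_induction (polyAction (n := n) q M) with
  | zero => exact zero_mem _
  | add x y hx hy => exact add_mem (hx trivial) (hy trivial)
  | mem ζ y h0 hy =>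
    let N : Submodule (GradedHecke q n) M :=
      { carrier := {y | ∀ z ∈ centralIdeal ζ ^ killOrder (Coord n) M,
          GradedHecke.ofPoly q n (z : Poly n) • y = 0}
        zero_mem' := fun z _ => smul_zero _
        add_mem' := fun hx hy z hz => by rw [smul_add, hx z hz, hy z hz, add_zero]
        smul_mem' := fun c x hx z hz => by
          rw [smul_smul, (GradedHecke.ofPoly_commute_of_mem_invariants q z.2 c).eq, ← smul_smul,
            hx z hz, smul_zero] }
    have hN : N ∈ {N : Submodule (GradedHecke q n) M |
        ∃ ζ, IsRealPoint n ζ ∧ IsKilledByPower q n N ζ} :=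
      ⟨ζ, h.isRealPoint ⟨y, h0, hy⟩, _, fun z hz x hx => hx z hz⟩
    exact le_sSup hN fun z hz => hy.apply_eq_zero (vanishesTo_of_mem_centralIdeal_pow hz)

end Graded

/-! ### Rational identities behind the quadratic, braid and Bernstein relations. -/

section RationalIdentities

variable {R : Type*} [CommRing R]

/-- The obstruction to the braid relation, cleared of denominators, as a function of the values
`P₁, P₂, P₃, P₄` of a function at the roots `x, y, x + y, -x`. -/
def braidPoly (x y c q P₁ P₂ P₃ P₄ : R) : R :=
  (x * y * ((x + y) * P₄ + c * (P₄ - P₂)) + c * (x + y) * (y * P₁ + c * (P₁ - P₃)) -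
    c * y * ((x + y) * P₄ + c * (P₄ - P₂))) * P₃ +
    (x + y) * (y * P₁ + c * (P₁ - P₃)) * (x * P₂ + c * (P₂ - P₃)) -
    x * y * (x + y) * (q + P₂ * P₃)

theorem map_braidPoly {S F : Type*} [CommRing S] [FunLike F R S] [RingHomClass F R S] (φ : F)
    (x y c q P₁ P₂ P₃ P₄ : R) : φ (braidPoly x y c q P₁ P₂ P₃ P₄) =
      braidPoly (φ x) (φ y) (φ c) (φ q) (φ P₁) (φ P₂) (φ P₃) (φ P₄) := by
  simp only [braidPoly, map_add, map_sub, map_mul]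

/-- Here e and f stand for e^x and e^y, and the hypotheses determine P₁, …, P₄ as the values of φ at
x, y, x + y, -x. Substitution leaves an identity of rational functions. -/
theorem braidPoly_eq_zero_of_field {K : Type*} [Field K] {x y c q e f P₁ P₂ P₃ P₄ : K}
    (hx : x + c ≠ 0) (hx' : -x + c ≠ 0) (hy : y + c ≠ 0) (hz : x + y + c ≠ 0)
    (he : e - 1 ≠ 0) (he0 : e ≠ 0) (hf : f - 1 ≠ 0) (hef : e * f - 1 ≠ 0)
    (h1 : (x + c) * (e - 1) * P₁ = (q * e - 1) * x)
    (h2 : (y + c) * (f - 1) * P₂ = (q * f - 1) * y)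
    (h3 : (x + y + c) * (e * f - 1) * P₃ = (q * (e * f) - 1) * (x + y))
    (h4 : (-x + c) * (e⁻¹ - 1) * P₄ = (q * e⁻¹ - 1) * (-x)) :
    braidPoly x y c q P₁ P₂ P₃ P₄ = 0 := by
  have he' : 1 - e ≠ 0 := by rw [← neg_sub]; exact neg_ne_zero.2 he
  have e1 : P₁ = (q * e - 1) * x / ((x + c) * (e - 1)) := by field_simp; linear_combination h1
  have e2 : P₂ = (q * f - 1) * y / ((y + c) * (f - 1)) := by field_simp; linear_combination h2
  have e3 : P₃ = (q * (e * f) - 1) * (x + y) / ((x + y + c) * (e * f - 1)) := by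
    field_simp; linear_combination h3
  have hi : e⁻¹ - 1 = (1 - e) / e := by field_simp
  have e4 : P₄ = (q - e) * (-x) / ((-x + c) * (1 - e)) := by
    field_simp at h4 ⊢; linear_combination h4
  rw [e1, e2, e3, e4, braidPoly]
  field_simp
  ring

/-- Passage to the fraction field; this version is applied to power series along a line, where e' is
the expansion of e^(-x). -/
theorem braidPoly_eq_zero [IsDomain R] {x y c q e f e' P₁ P₂ P₃ P₄ : R}
    (hx : x + c ≠ 0) (hx' : -x + c ≠ 0) (hy : y + c ≠ 0) (hz : x + y + c ≠ 0)
    (he : e - 1 ≠ 0) (hee : e * e' = 1) (hf : f - 1 ≠ 0) (hef : e * f - 1 ≠ 0)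
    (h1 : (x + c) * (e - 1) * P₁ = (q * e - 1) * x)
    (h2 : (y + c) * (f - 1) * P₂ = (q * f - 1) * y)
    (h3 : (x + y + c) * (e * f - 1) * P₃ = (q * (e * f) - 1) * (x + y))
    (h4 : (-x + c) * (e' - 1) * P₄ = (q * e' - 1) * (-x)) :
    braidPoly x y c q P₁ P₂ P₃ P₄ = 0 := by
  set φ := algebraMap R (FractionRing R)
  have hi := IsFractionRing.injective R (FractionRing R)
  have ne : ∀ {a : R}, a ≠ 0 → φ a ≠ 0 := fun h => (map_ne_zero_iff φ hi).2 h
  have hee' : φ e' = (φ e)⁻¹ := by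
    refine eq_inv_of_mul_eq_one_right ?_
    rw [← map_mul, hee, map_one]
  refine hi ?_
  change φ _ = φ _
  rw [map_braidPoly, map_zero]
  refine braidPoly_eq_zero_of_field (e := φ e) (f := φ f) ?_ ?_ ?_ ?_ ?_ ?_ ?_ ?_ ?_ ?_ ?_ ?_
  · simpa using ne hx
  · simpa using ne hx'
  · simpa using ne hy
  · simpa using ne hz
  · simpa using ne he
  · exact ne (left_ne_zero_of_mul_eq_one hee)
  · simpa using ne hf
  · simpa using ne hef
  · simpa using congrArg φ h1
  · simpa using congrArg φ h2
  · simpa using congrArg φ h3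
  · rw [← hee']; simpa using congrArg φ h4

/-- The obstruction to the quadratic relation, cleared of denominators. -/
def quadraticPoly (x c q P P' : R) : R := (P' + P) * x + c * (P - P') - (1 + q) * x

theorem map_quadraticPoly {S F : Type*} [CommRing S] [FunLike F R S] [RingHomClass F R S] (φ : F)
    (x c q P P' : R) : φ (quadraticPoly x c q P P') =
      quadraticPoly (φ x) (φ c) (φ q) (φ P) (φ P') := by
  simp only [quadraticPoly, map_add, map_sub, map_mul, map_one]

/-- The obstruction to the Bernstein relation, cleared of denominators. -/
def crossPoly (x c q P s s' F : R) : R := (s - s') * ((P - 1) * x + c * P) - (q - 1) * F * x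

theorem map_crossPoly {S F : Type*} [CommRing S] [FunLike F R S] [RingHomClass F R S] (φ : F)
    (x c q P s s' f : R) : φ (crossPoly x c q P s s' f) =
      crossPoly (φ x) (φ c) (φ q) (φ P) (φ s) (φ s') (φ f) := by
  simp only [crossPoly, map_add, map_sub, map_mul, map_one]

theorem quadraticPoly_eq_zero [IsDomain R] {x c q e e' P P' : R}
    (hx : x + c ≠ 0) (hx' : -x + c ≠ 0) (he : e - 1 ≠ 0) (hee : e * e' = 1)
    (h1 : (x + c) * (e - 1) * P = (q * e - 1) * x)
    (h2 : (-x + c) * (e' - 1) * P' = (q * e' - 1) * (-x)) :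
    quadraticPoly x c q P P' = 0 := by
  rw [quadraticPoly]
  have h2' : (-x + c) * (e - 1) * P' = (q - e) * x := by
    linear_combination -e * h2 + ((-x + c) * P' - q * (-x)) * hee
  refine (mul_eq_zero.1 (?_ : ((x + c) * (-x + c) * (e - 1)) * _ = 0)).resolve_left
    (mul_ne_zero (mul_ne_zero hx hx') he)
  linear_combination (-x + c) * (x + c) * h1 + (x + c) * (x - c) * h2'

theorem crossPoly_eq_zero [IsDomain R] {x c q e e' P s s' F : R}
    (he : e - 1 ≠ 0) (hee : e * e' = 1)
    (h1 : (x + c) * (e - 1) * P = (q * e - 1) * x) (hF : F * (1 - e') = s - s') :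
    crossPoly x c q P s s' F = 0 := by
  rw [crossPoly]
  refine (mul_eq_zero.1 (?_ : (e - 1) * _ = 0)).resolve_left he
  rw [← hF]
  linear_combination F * (1 - e') * h1 + (F * x * (1 - q)) * hee

end RationalIdentities

/-! ### Expansions of E, φ and the exponential along a line. -/

section Jets

open PowerSeries

/-- The expansion at `z` of `(e^z - 1) / z`. -/
abbrev jetE (z : ℂ) : ℂ⟦X⟧ := jet (fun r => (((r + 1).factorial : ℂ))⁻¹) z

/-- The expansion at `z` of `((e^{z+c} - 1) / (z + c)) / ((e^z - 1) / z)`. -/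
def jetPhi (c z : ℂ) : ℂ⟦X⟧ := jetE (z + c) * (jetE z)⁻¹

/-- E(0) = 1, and at a real z ≠ 0 a zero of E would give e^z = 1. Reality of the roots enters the
construction through this fact. -/
theorem constantCoeff_jetE_ne_zero {z : ℂ} (hz : z.im = 0) : constantCoeff (jetE z) ≠ 0 := by
  have h := jet_E_mul z
  by_cases h0 : z = 0
  · subst h0
    have h1 := congrArg (coeff 1) h
    rw [map_zero, zero_add, ← zero_add 1, coeff_succ_X_mul, map_sub, Complex.exp_zero, map_one,
      one_mul, coeff_exp, coeff_one] at h1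
    rw [coeff_zero_eq_constantCoeff] at h1
    rw [h1]
    norm_num
  · intro hE
    have h1 := congrArg constantCoeff h
    simp only [map_mul, map_add, map_sub, map_one, constantCoeff_C, constantCoeff_X, add_zero,
      constantCoeff_exp, mul_one] at h1
    rw [hE, mul_zero, eq_comm, sub_eq_zero] at h1
    have hr : z = (z.re : ℂ) := Complex.ext rfl (by simpa using hz)
    rw [hr] at h1 h0
    have h2 : Real.exp z.re = 1 := by exact_mod_cast h1
    rw [Real.exp_eq_one_iff] at h2
    exact h0 (by rw [h2]; rfl)

theorem jetPhi_mul_jetE (c : ℂ) {z : ℂ} (hz : z.im = 0) : jetPhi c z * jetE z = jetE (z + c) := by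
  rw [jetPhi, mul_assoc, PowerSeries.inv_mul_cancel _ (constantCoeff_jetE_ne_zero hz), mul_one]

/-- The expansion of the exponential along the line `u + w t`. -/
def expLine (u w : ℂ) : ℂ⟦X⟧ := C (Complex.exp u) * rescale w (exp ℂ)

/-- The linear function `u + w t`. -/
abbrev line (u w : ℂ) : ℂ⟦X⟧ := C u + C w * X

theorem expLine_mul (u w u' w' : ℂ) :
    expLine u w * expLine u' w' = expLine (u + u') (w + w') := by
  rw [expLine, expLine, expLine, Complex.exp_add, map_mul, ← exp_mul_exp_eq_exp_add]
  ring

theorem expLine_zero : expLine 0 0 = 1 := by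
  simp [expLine]

theorem expLine_sub_one_ne_zero (u : ℂ) {w : ℂ} (hw : w ≠ 0) : expLine u w - 1 ≠ 0 := by
  intro h
  have h1 := congrArg (coeff 1) h
  rw [expLine, map_sub, coeff_C_mul, coeff_rescale, coeff_exp, coeff_one] at h1
  simp [hw] at h1

theorem line_ne_zero (u : ℂ) {w : ℂ} (hw : w ≠ 0) : line u w ≠ 0 := by
  intro h
  have h1 := congrArg (coeff 1) h
  simp [coeff_C] at h1
  exact hw h1

theorem line_add_C_ne_zero (u c : ℂ) {w : ℂ} (hw : w ≠ 0) : line u w + C c ≠ 0 := by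
  have : line u w + C c = line (u + c) w := by rw [line, line, map_add]; ring
  rw [this]
  exact line_ne_zero _ hw

/-- The defining equation of φ with denominators cleared, from z E(z) = e^z - 1 at u and at u + c,
followed by rescaling. -/
theorem jetPhi_spec (c : ℂ) {u : ℂ} (hu : u.im = 0) (w : ℂ) :
    (line u w + C c) * (expLine u w - 1) * rescale w (jetPhi c u) =
      (C (Complex.exp c) * expLine u w - 1) * line u w := by
  have h1 := jetPhi_mul_jetE c hu
  have h2 := jet_E_mul u
  have h3 := jet_E_mul (u + c)
  have h : (C u + X + C c) * (C (Complex.exp u) * exp ℂ - 1) * jetPhi c u =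
      (C (Complex.exp c) * (C (Complex.exp u) * exp ℂ) - 1) * (C u + X) := by
    rw [Complex.exp_add, map_mul, map_add] at h3
    rw [← h2]
    linear_combination (C u + X + C c) * (C u + X) * h1 + (C u + X) * h3
  have h4 := congrArg (rescale w) h
  simp only [map_mul, map_add, map_sub, map_one, rescale_C, rescale_X] at h4
  exact h4

end Jets

/-! ### Polynomial operators that vanish because of the rational identities. -/

section Brackets

open MvPolynomial

variable {m : ℕ} {n : Fin m → ℕ}

/-- The root `ε_(k,a) - ε_(k,b)` as an element of `S(V)`. -/
abbrev rt (k : Fin m) (a b : Fin (n k)) : Poly n := X ⟨k, a⟩ - X ⟨k, b⟩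

theorem lineExp_C {σ : Type} (x v : σ → ℂ) (c : ℂ) : lineExp x v (C c) = PowerSeries.C c := by
  rw [← algebraMap_eq, AlgHom.commutes]; rfl

theorem lineExp_X_sub_X {σ : Type} (x v : σ → ℂ) (c d : σ) :
    lineExp x v (X c - X d) = line (x c - x d) (v c - v d) := by
  simp only [lineExp, map_sub, aeval_X, line]; ring

theorem line_swap (u u' w w' : ℂ) : line (u' - u) (w' - w) = -line (u - u') (w - w') := by
  simp only [line, map_sub]; ring

theorem line_add (u u' w w' : ℂ) : line (u + u') (w + w') = line u w + line u' w' := by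
  simp only [line, map_add]; ring

theorem expLine_swap (u u' w w' : ℂ) :
    expLine (u - u') (w - w') * expLine (u' - u) (w' - w) = 1 := by
  rw [expLine_mul, sub_add_sub_cancel, sub_add_sub_cancel, sub_self, sub_self, expLine_zero]

/-- Injectivity of v makes X_c - X_d non-constant on the line, so removing this factor costs one
order. This is the source of the summands 1 and 3 added to `killOrder`. -/
theorem VanishesTo.of_mul {σ : Type} {f : MvPolynomial σ ℂ} {x : σ → ℂ} {N : ℕ} {c d : σ}
    (hcd : c ≠ d) (h : VanishesTo (f * (X c - X d)) x (N + 1)) : VanishesTo f x N := by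
  intro v hv
  have := h v hv
  rw [map_mul, mul_comm, lineExp_X_sub_X] at this
  exact dvd_of_dvd_linear_mul (sub_ne_zero.2 fun h' => hcd (hv h')) this

variable {V : Type*} [AddCommGroup V] [Module ℂ V] {ρ : Poly n →ₐ[ℂ] Module.End ℂ V}

/-- The eigenvalues of the roots. -/
def rootSpec (ρ : Poly n →ₐ[ℂ] Module.End ℂ V) : Set ℂ :=
  {μ | ∃ (k : Fin m) (a b : Fin (n k)), (ρ (rt k a b)).HasEigenvalue μ}

theorem finite_rootSpec [FiniteDimensional ℂ V] : (rootSpec ρ).Finite := by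
  have : rootSpec ρ = ⋃ (k : Fin m) (a : Fin (n k)) (b : Fin (n k)),
      {μ | (ρ (rt k a b)).HasEigenvalue μ} := by
    ext μ; simp [rootSpec]
  rw [this]
  exact Set.finite_iUnion fun k => Set.finite_iUnion fun a => Set.finite_iUnion fun b =>
    Module.End.finite_hasEigenvalue _

theorem IsWeight.sub_mem_rootSpec {x : Coord n → ℂ} (hx : IsWeight ρ x) (k : Fin m)
    (a b : Fin (n k)) : x ⟨k, a⟩ - x ⟨k, b⟩ ∈ rootSpec ρ :=
  ⟨k, a, b, by simpa using hx.hasEigenvalue (rt k a b)⟩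

/-- The expansion along a line of `φ` at the root `ε_(k,a) - ε_(k,b)`. -/
abbrev phiLine (c : ℂ) (x v : Coord n → ℂ) (k : Fin m) (a b : Fin (n k)) : PowerSeries ℂ :=
  PowerSeries.rescale (v ⟨k, a⟩ - v ⟨k, b⟩) (jetPhi c (x ⟨k, a⟩ - x ⟨k, b⟩))

theorem IsRealPoint.phiLine_spec {x : Coord n → ℂ} (hx : IsRealPoint n x) (c : ℂ)
    (v : Coord n → ℂ) (k : Fin m) (a b : Fin (n k)) :
    (line (x ⟨k, a⟩ - x ⟨k, b⟩) (v ⟨k, a⟩ - v ⟨k, b⟩) + PowerSeries.C c) *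
      (expLine (x ⟨k, a⟩ - x ⟨k, b⟩) (v ⟨k, a⟩ - v ⟨k, b⟩) - 1) * phiLine c x v k a b =
    (PowerSeries.C (Complex.exp c) *
      expLine (x ⟨k, a⟩ - x ⟨k, b⟩) (v ⟨k, a⟩ - v ⟨k, b⟩) - 1) *
      line (x ⟨k, a⟩ - x ⟨k, b⟩) (v ⟨k, a⟩ - v ⟨k, b⟩) :=
  jetPhi_spec c (hx k a b) _

theorem Approx.mk_lineExp {p : Polynomial ℂ} {r : ℕ} {c : ℂ}
    (hp : Approx p (rootSpec ρ) r (jetPhi c)) {x : Coord n → ℂ} (hx : IsWeight ρ x)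
    (v : Coord n → ℂ) (k : Fin m) (a b : Fin (n k)) :
    Ideal.Quotient.mk (Ideal.span {(PowerSeries.X : PowerSeries ℂ) ^ r})
      (lineExp x v (Polynomial.aeval (rt k a b) p)) =
    Ideal.Quotient.mk _ (phiLine c x v k a b) := by
  rw [Ideal.Quotient.mk_eq_mk_iff_sub_mem, Ideal.mem_span_singleton]
  exact hp.lineExp_dvd (hx.sub_mem_rootSpec k a b) (lineExp_X_sub_X _ _ _ _)

theorem dvd_iff_mk_eq_zero {r : ℕ} {F : PowerSeries ℂ} : PowerSeries.X ^ r ∣ F ↔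
    Ideal.Quotient.mk (Ideal.span {(PowerSeries.X : PowerSeries ℂ) ^ r}) F = 0 := by
  rw [Ideal.Quotient.eq_zero_iff_mem, Ideal.mem_span_singleton]

theorem sub_ne_zero_of_injective {v : Coord n → ℂ} (hv : Function.Injective v) {k : Fin m}
    {a b : Fin (n k)} (hab : a ≠ b) : v ⟨k, a⟩ - v ⟨k, b⟩ ≠ 0 :=
  sub_ne_zero.2 fun h => mk_ne_mk hab (hv h)

section

variable [FiniteDimensional ℂ V]

/-- Multiplied by the root, the bracket becomes `quadraticPoly`. Modulo a power of the line
parameter p may be replaced by φ, where that polynomial vanishes. -/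
theorem quadratic_bracket (hρ : HasRealRoots ρ) {p : Polynomial ℂ} {c : ℂ} {r : ℕ}
    (hr : killOrder (Coord n) V + 1 ≤ r)
    (hp : Approx p (rootSpec ρ) r (jetPhi c)) {k : Fin m} {a b : Fin (n k)} (hab : a ≠ b)
    {G : Poly n} (hG : G * rt k a b =
      C c * (Polynomial.aeval (rt k a b) p - Polynomial.aeval (rt k b a) p)) :
    ρ (Polynomial.aeval (rt k b a) p + Polynomial.aeval (rt k a b) p + G -
      C (1 + Complex.exp c)) = 0 := by
  replace hp := hp.mono subset_rfl hr
  refine eq_zero_of_vanishesTo ρ fun x hx => VanishesTo.of_mul (mk_ne_mk hab) fun v hv => ?_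
  have hxr := hρ.isRealPoint hx
  have hv0 := sub_ne_zero_of_injective hv hab
  have h2 := hxr.phiLine_spec c v k b a
  rw [line_swap] at h2
  have hc : -line (x ⟨k, a⟩ - x ⟨k, b⟩) (v ⟨k, a⟩ - v ⟨k, b⟩) + PowerSeries.C c ≠ 0 := by
    rw [← line_swap]; exact line_add_C_ne_zero _ _ (sub_ne_zero_of_injective hv hab.symm)
  have key := congrArg (Ideal.Quotient.mk (Ideal.span {(PowerSeries.X : PowerSeries ℂ) ^
    (killOrder (Coord n) V + 1)})) (quadraticPoly_eq_zero (line_add_C_ne_zero _ c hv0) hc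
      (expLine_sub_one_ne_zero _ hv0) (expLine_swap _ _ _ _) (hxr.phiLine_spec c v k a b) h2)
  rw [dvd_iff_mk_eq_zero]
  have e : (Polynomial.aeval (rt k b a) p + Polynomial.aeval (rt k a b) p + G -
      C (1 + Complex.exp c)) * (X ⟨k, a⟩ - X ⟨k, b⟩) =
      quadraticPoly (rt k a b) (C c) (C (Complex.exp c)) (Polynomial.aeval (rt k a b) p)
        (Polynomial.aeval (rt k b a) p) := by
    rw [quadraticPoly, ← hG, map_add, map_one]; ring
  rw [e, map_quadraticPoly, map_quadraticPoly, hp.mk_lineExp hx v k a b, hp.mk_lineExp hx v k b a,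
    lineExp_C, lineExp_C, lineExp_X_sub_X]
  rw [map_quadraticPoly, map_zero] at key
  exact key

/-- The elements D, D', E, D₂ are the correction terms produced when polynomials cross the two
reflections. Multiplication by the three positive roots turns the bracket into `braidPoly`, which
vanishes for φ. -/
theorem braid_bracket (hρ : HasRealRoots ρ) {p : Polynomial ℂ} {c : ℂ} {r : ℕ}
    (hr : killOrder (Coord n) V + 3 ≤ r)
    (hp : Approx p (rootSpec ρ) r (jetPhi c))
    {k : Fin m} {a b a' b' a'' b'' : Fin (n k)} (hab : a ≠ b) (hbd : a' ≠ b') (had : a'' ≠ b'')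
    (hv : ∀ x : Coord n → ℂ, x ⟨k, a''⟩ - x ⟨k, b''⟩ =
      (x ⟨k, a⟩ - x ⟨k, b⟩) + (x ⟨k, a'⟩ - x ⟨k, b'⟩))
    (hs : rt k a'' b'' = rt k a b + rt k a' b')
    {D D' E D₂ : Poly n}
    (hD : D * rt k a' b' = C c * (Polynomial.aeval (rt k a b) p - Polynomial.aeval (rt k a'' b'') p))
    (hD' : D' * rt k a b = C c * (Polynomial.aeval (rt k a' b') p - Polynomial.aeval (rt k a'' b'') p))
    (hE : E * rt k a'' b'' = C c * (Polynomial.aeval (rt k b a) p - Polynomial.aeval (rt k a' b') p))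
    (hD₂ : D₂ * rt k a b = C c * (Polynomial.aeval (rt k a b) p + D -
      (Polynomial.aeval (rt k b a) p + E))) :
    ρ ((Polynomial.aeval (rt k b a) p + E + D₂) * Polynomial.aeval (rt k a'' b'') p +
      (Polynomial.aeval (rt k a b) p + D) * (Polynomial.aeval (rt k a' b') p + D') -
      C (Complex.exp c) - Polynomial.aeval (rt k a' b') p * Polynomial.aeval (rt k a'' b'') p) = 0 := by
  replace hp := hp.mono subset_rfl hr
  refine eq_zero_of_vanishesTo ρ fun x hx => VanishesTo.of_mul (mk_ne_mk hab)
    (VanishesTo.of_mul (mk_ne_mk hbd) (VanishesTo.of_mul (mk_ne_mk had) fun v hi => ?_))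
  have hxr := hρ.isRealPoint hx
  have hvab := sub_ne_zero_of_injective hi hab
  have hvbd := sub_ne_zero_of_injective hi hbd
  have hvad := sub_ne_zero_of_injective hi had
  have hl : line (x ⟨k, a''⟩ - x ⟨k, b''⟩) (v ⟨k, a''⟩ - v ⟨k, b''⟩) =
      line (x ⟨k, a⟩ - x ⟨k, b⟩) (v ⟨k, a⟩ - v ⟨k, b⟩) +
      line (x ⟨k, a'⟩ - x ⟨k, b'⟩) (v ⟨k, a'⟩ - v ⟨k, b'⟩) := by
    rw [← line_add, hv, hv]
  have he : expLine (x ⟨k, a''⟩ - x ⟨k, b''⟩) (v ⟨k, a''⟩ - v ⟨k, b''⟩) =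
      expLine (x ⟨k, a⟩ - x ⟨k, b⟩) (v ⟨k, a⟩ - v ⟨k, b⟩) *
      expLine (x ⟨k, a'⟩ - x ⟨k, b'⟩) (v ⟨k, a'⟩ - v ⟨k, b'⟩) := by
    rw [expLine_mul, hv, hv]
  have h4 := hxr.phiLine_spec c v k b a
  rw [line_swap] at h4
  have h3 := hxr.phiLine_spec c v k a'' b''
  have hz := line_add_C_ne_zero (x ⟨k, a''⟩ - x ⟨k, b''⟩) c hvad
  have hef := expLine_sub_one_ne_zero (x ⟨k, a''⟩ - x ⟨k, b''⟩) hvad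
  rw [hl, he] at h3
  rw [hl] at hz
  rw [he] at hef
  have hc : -line (x ⟨k, a⟩ - x ⟨k, b⟩) (v ⟨k, a⟩ - v ⟨k, b⟩) + PowerSeries.C c ≠ 0 := by
    rw [← line_swap]; exact line_add_C_ne_zero _ _ (sub_ne_zero_of_injective hi hab.symm)
  have key := congrArg (Ideal.Quotient.mk (Ideal.span {(PowerSeries.X : PowerSeries ℂ) ^
    (killOrder (Coord n) V + 3)})) (braidPoly_eq_zero (line_add_C_ne_zero _ c hvab) hc
      (line_add_C_ne_zero _ c hvbd) hz (expLine_sub_one_ne_zero _ hvab) (expLine_swap _ _ _ _)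
      (expLine_sub_one_ne_zero _ hvbd) hef (hxr.phiLine_spec c v k a b)
      (hxr.phiLine_spec c v k a' b') h3 h4)
  rw [dvd_iff_mk_eq_zero]
  have e : ((Polynomial.aeval (rt k b a) p + E + D₂) * Polynomial.aeval (rt k a'' b'') p +
      (Polynomial.aeval (rt k a b) p + D) * (Polynomial.aeval (rt k a' b') p + D') -
      C (Complex.exp c) - Polynomial.aeval (rt k a' b') p * Polynomial.aeval (rt k a'' b'') p) *
      (X ⟨k, a⟩ - X ⟨k, b⟩) * (X ⟨k, a'⟩ - X ⟨k, b'⟩) * (X ⟨k, a''⟩ - X ⟨k, b''⟩) =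
      braidPoly (rt k a b) (rt k a' b') (C c) (C (Complex.exp c)) (Polynomial.aeval (rt k a b) p)
        (Polynomial.aeval (rt k a' b') p) (Polynomial.aeval (rt k a'' b'') p)
        (Polynomial.aeval (rt k b a) p) := by
    change _ * rt k a b * rt k a' b' * rt k a'' b'' = _
    generalize Polynomial.aeval (rt k a b) p = P₁ at *
    generalize Polynomial.aeval (rt k a' b') p = P₂ at *
    generalize Polynomial.aeval (rt k a'' b'') p = P₃ at *
    generalize Polynomial.aeval (rt k b a) p = P₄ at *
    rw [hs] at hE ⊢
    generalize rt k a b = α at *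
    generalize rt k a' b' = β at *
    rw [braidPoly]
    -- The coefficients eliminate E, D₂, D and D' by means of their defining equations.
    linear_combination (α * β * P₃ - C c * β * P₃) * hE + β * (α + β) * P₃ * hD₂ +
      ((α + β) * (α * P₂ + α * D') + C c * (α + β) * P₃) * hD +
      (α + β) * (β * P₁ + C c * (P₁ - P₃)) * hD'
  rw [e, map_braidPoly, map_braidPoly, hp.mk_lineExp hx v k a b, hp.mk_lineExp hx v k a' b',
    hp.mk_lineExp hx v k a'' b'', hp.mk_lineExp hx v k b a, lineExp_C, lineExp_C, lineExp_X_sub_X,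
    lineExp_X_sub_X]
  rw [map_braidPoly, map_zero] at key
  exact key

end

/-- The value at `x` of a weight in the lattice. -/
def pairing (y : Coord n → ℤ) (x : Coord n → ℂ) : ℂ := ∑ c, (y c : ℂ) * x c

theorem pairing_add (y y' : Coord n → ℤ) (x : Coord n → ℂ) :
    pairing (y + y') x = pairing y x + pairing y' x := by
  simp [pairing, add_mul, Finset.sum_add_distrib]

theorem pairing_neg_root (k : Fin m) (a b : Fin (n k)) (x : Coord n → ℂ) :
    pairing (-root k a b) x = x ⟨k, b⟩ - x ⟨k, a⟩ := by
  simp only [pairing, root, Pi.neg_apply, Pi.sub_apply, Int.cast_sub, neg_sub,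
    sub_mul, Finset.sum_sub_distrib, Pi.single_apply, Int.cast_ite, Int.cast_one, Int.cast_zero,
    ite_mul, one_mul, zero_mul, Finset.sum_ite_eq', Finset.mem_univ, if_true]

/-- A lattice element as an element of `S(V)`. -/
abbrev linZ (y : Coord n → ℤ) : Poly n := lin fun c => (y c : ℂ)

theorem lineExp_linZ (x v : Coord n → ℂ) (y : Coord n → ℤ) :
    lineExp x v (linZ y) = line (pairing y x) (pairing y v) := by
  simp only [lineExp, linZ, lin, map_sum, map_smul, aeval_X, line, pairing, smul_add,
    Finset.sum_add_distrib, Finset.sum_mul, map_mul, PowerSeries.smul_eq_C_mul, mul_assoc]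

/-- The expansion along a line of an element of `ℂ[X]`, where `θ_y = e^y`. -/
def lineLaurent (x v : Coord n → ℂ) : Laurent n →ₐ[ℂ] PowerSeries ℂ :=
  AddMonoidAlgebra.lift ℂ _ _
    { toFun := fun y => expLine (pairing y.toAdd x) (pairing y.toAdd v)
      map_one' := by
        rw [toAdd_one]
        simp [pairing, expLine_zero]
      map_mul' := fun y y' => by rw [toAdd_mul, pairing_add, pairing_add, expLine_mul] }

theorem lineLaurent_monom (x v : Coord n → ℂ) (y : Coord n → ℤ) :
    lineLaurent x v (monom y) = expLine (pairing y x) (pairing y v) := by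
  simp [lineLaurent, monom]

/-- The polynomial `g` has the same expansion as `f ∈ ℂ[X]` at all weights, up to order `N`. -/
def Represents (ρ : Poly n →ₐ[ℂ] Module.End ℂ V) (f : Laurent n) (g : Poly n) (N : ℕ) : Prop :=
  ∀ x, IsWeight ρ x → ∀ v : Coord n → ℂ, Function.Injective v →
    PowerSeries.X ^ N ∣ lineExp x v g - lineLaurent x v f

/-- The Taylor expansion of the exponential. -/
abbrev jetExp : ℂ → PowerSeries ℂ := jet fun r => ((r.factorial : ℂ))⁻¹

theorem jetExp_eq (z : ℂ) :
    jetExp z = PowerSeries.C (Complex.exp z) * PowerSeries.exp ℂ := jet_exp z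

/-- Along a line, a lattice element is a linear function, so interpolating the exponential at its
eigenvalues reproduces the expansion of θ_y. -/
theorem represents_monom {P : Polynomial ℂ} {N : ℕ} {y : Coord n → ℤ}
    (hP : Approx P {z | (ρ (linZ y)).HasEigenvalue z} N jetExp) :
    Represents ρ (monom y) (Polynomial.aeval (linZ y) P) N := by
  intro x hx v _
  have he : eval x (linZ y) = pairing y x := by
    simp [linZ, lin, pairing, smul_eval]
  have h := hP.lineExp_dvd (x := x) (v := v) (he ▸ hx.hasEigenvalue (linZ y)) (lineExp_linZ x v y)
  rw [jetExp_eq, map_mul, rescale_C] at h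
  rwa [lineLaurent_monom]

theorem Represents.mono {f : Laurent n} {g : Poly n} {N N' : ℕ} (h : Represents ρ f g N)
    (hN : N' ≤ N) : Represents ρ f g N' :=
  fun x hx v hv => (pow_dvd_pow _ hN).trans (h x hx v hv)

/-- Same scheme with `crossPoly`: the divisibility relation for f in ℂ[X] becomes one between
exponentials on each line. -/
theorem cross_bracket [FiniteDimensional ℂ V] (hρ : HasRealRoots ρ) {p : Polynomial ℂ} {c : ℂ} {r : ℕ}
    (hr : killOrder (Coord n) V + 1 ≤ r)
    (hp : Approx p (rootSpec ρ) r (jetPhi c)) {k : Fin m} {a b : Fin (n k)} (hab : a ≠ b)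
    {y y' : Coord n → ℤ} {f : Laurent n} {g s s' G : Poly n}
    (hf : f * (1 - monom (-root k a b)) = monom y - monom y')
    (hg : Represents ρ f g r) (hs : Represents ρ (monom y) s r) (hs' : Represents ρ (monom y') s' r)
    (hG : G * rt k a b = C c * (s' - s)) :
    ρ (Polynomial.aeval (rt k a b) p * s - s - G * Polynomial.aeval (rt k a b) p -
      s' * Polynomial.aeval (rt k a b) p + s' - C (Complex.exp c - 1) * g) = 0 := by
  replace hp := hp.mono subset_rfl hr
  refine eq_zero_of_vanishesTo ρ fun x hx => VanishesTo.of_mul (mk_ne_mk hab) fun v hv => ?_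
  have hv0 := sub_ne_zero_of_injective hv hab
  have hmk : ∀ {f : Laurent n} {g : Poly n}, Represents ρ f g r →
      Ideal.Quotient.mk (Ideal.span {(PowerSeries.X : PowerSeries ℂ) ^
        (killOrder (Coord n) V + 1)}) (lineExp x v g) =
      Ideal.Quotient.mk _ (lineLaurent x v f) := fun h => by
    rw [Ideal.Quotient.mk_eq_mk_iff_sub_mem, Ideal.mem_span_singleton]
    exact h.mono hr x hx v hv
  have hF := congrArg (lineLaurent x v) hf
  rw [map_mul, map_sub, map_sub, map_one, lineLaurent_monom x v (-root k a b), pairing_neg_root,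
    pairing_neg_root] at hF
  have key := congrArg (Ideal.Quotient.mk (Ideal.span {(PowerSeries.X : PowerSeries ℂ) ^
    (killOrder (Coord n) V + 1)})) (crossPoly_eq_zero (expLine_sub_one_ne_zero _ hv0)
      (expLine_swap _ _ _ _) ((hρ.isRealPoint hx).phiLine_spec c v k a b) hF)
  rw [dvd_iff_mk_eq_zero]
  have e : (Polynomial.aeval (rt k a b) p * s - s - G * Polynomial.aeval (rt k a b) p -
      s' * Polynomial.aeval (rt k a b) p + s' - C (Complex.exp c - 1) * g) *
        (X ⟨k, a⟩ - X ⟨k, b⟩) =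
      crossPoly (rt k a b) (C c) (C (Complex.exp c)) (Polynomial.aeval (rt k a b) p) s s' g := by
    rw [crossPoly, map_sub C, map_one]
    linear_combination - Polynomial.aeval (rt k a b) p * hG
  rw [e, map_crossPoly, map_crossPoly, hp.mk_lineExp hx v k a b, hmk hs, hmk hs', hmk hg,
    lineExp_C, lineExp_C, lineExp_X_sub_X]
  rw [map_crossPoly, map_zero] at key
  exact key

end Brackets

/-! ### The action of the lattice by exponentials. -/

section Theta

open MvPolynomial

variable {m : ℕ} {n : Fin m → ℕ} {V : Type u} [AddCommGroup V] [Module ℂ V]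
  [FiniteDimensional ℂ V] (ρ : Poly n →ₐ[ℂ] Module.End ℂ V)

theorem Represents.congr_apply {ρ : Poly n →ₐ[ℂ] Module.End ℂ V} {f : Laurent n} {g g' : Poly n}
    (h : Represents ρ f g (killOrder (Coord n) V)) (h' : Represents ρ f g' (killOrder (Coord n) V)) :
    ρ g = ρ g' := by
  rw [← sub_eq_zero, ← map_sub]
  refine eq_zero_of_vanishesTo ρ fun x hx v hv => ?_
  rw [map_sub]
  simpa using dvd_sub (h x hx v hv) (h' x hx v hv)

theorem opExp_eq_aeval {P : Polynomial ℂ} {N : ℕ} (hN : Module.finrank ℂ V ≤ N) {f : Poly n}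
    (hP : Approx P {z | (ρ f).HasEigenvalue z} N jetExp) :
    opExp (ρ f) = ρ (Polynomial.aeval f P) := by
  rw [opExp, opSeries_eq_aeval isEntire_exp (ρ f) hN hP, Polynomial.aeval_algHom_apply]

/-- Both sides are polynomial operators whose polynomials represent the same Laurent monomial along
every generic line through a weight. -/
theorem opExp_linZ_add (y y' : Coord n → ℤ) :
    opExp (ρ (linZ (y + y'))) = opExp (ρ (linZ y)) * opExp (ρ (linZ y')) := by
  obtain ⟨P, hP⟩ := exists_approx
    ({z | (ρ (linZ (y + y'))).HasEigenvalue z} ∪ ({z | (ρ (linZ y)).HasEigenvalue z} ∪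
      {z | (ρ (linZ y')).HasEigenvalue z}))
    ((Module.End.finite_hasEigenvalue _).union ((Module.End.finite_hasEigenvalue _).union
      (Module.End.finite_hasEigenvalue _)))
    -- Two bounds are needed: `killOrder` to compare representatives, the dimension to evaluate the
    -- exponential. The first does not dominate the second when there are no coordinates.
    (killOrder (Coord n) V + Module.finrank ℂ V) jetExp
  have h1 := hP.mono Set.subset_union_left le_rfl
  have h23 := hP.mono Set.subset_union_right le_rfl
  have h2 := h23.mono Set.subset_union_left le_rfl
  have h3 := h23.mono Set.subset_union_right le_rfl
  rw [opExp_eq_aeval ρ (Nat.le_add_left _ _) h1, opExp_eq_aeval ρ (Nat.le_add_left _ _) h2,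
    opExp_eq_aeval ρ (Nat.le_add_left _ _) h3, ← map_mul]
  refine Represents.congr_apply (f := monom (y + y'))
    ((represents_monom h1).mono (Nat.le_add_right _ _)) fun x hx v hv => ?_
  have e2 := (represents_monom h2).mono (Nat.le_add_right _ _) x hx v hv
  have e3 := (represents_monom h3).mono (Nat.le_add_right _ _) x hx v hv
  rw [lineLaurent_monom] at e2 e3 ⊢
  rw [pairing_add, pairing_add, ← expLine_mul, map_mul]
  convert dvd_add (e2.mul_right (lineExp x v (Polynomial.aeval (linZ y') P)))
    (e3.mul_left (expLine (pairing y x) (pairing y v))) using 1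
  ring

theorem opExp_zero : opExp (0 : Module.End ℂ V) = 1 := by
  obtain ⟨P, hP⟩ := exists_approx {0} (Set.finite_singleton 0) (Module.finrank ℂ V + 1) jetExp
  have hs : {z | (0 : Module.End ℂ V).HasEigenvalue z} ⊆ {0} := by
    intro z hz
    obtain ⟨y, hy⟩ := hz.exists_hasEigenvector
    have := hy.apply_eq_smul
    rw [LinearMap.zero_apply, eq_comm, smul_eq_zero] at this
    exact this.resolve_right hy.2
  rw [opExp, opSeries_eq_aeval isEntire_exp _ (Nat.le_succ _) (hP.mono hs le_rfl)]
  have h := PowerSeries.X_pow_dvd_iff.1 (hP 0 rfl) 0 (Nat.succ_pos _)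
  rw [jetExp_eq, Polynomial.taylor_zero] at h
  simp [sub_eq_zero] at h
  rw [← map_zero (algebraMap ℂ (Module.End ℂ V)), Polynomial.aeval_algebraMap_apply,
    Polynomial.coe_aeval_eq_eval, ← Polynomial.coeff_zero_eq_eval_zero, h, map_one]

/-- The action of `ℂ[X]` in which `θ_y` acts by `e^y`. -/
def expAction : Laurent n →ₐ[ℂ] Module.End ℂ V :=
  AddMonoidAlgebra.lift ℂ _ _
    { toFun := fun y => opExp (ρ (linZ y.toAdd))
      map_one' := by
        have : (linZ (0 : Coord n → ℤ)) = (0 : Poly n) := by simp [linZ, lin]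
        rw [toAdd_one, this, map_zero, opExp_zero]
      map_mul' := fun y y' => by rw [toAdd_mul, opExp_linZ_add] }

theorem expAction_monom (y : Coord n → ℤ) : expAction ρ (monom y) = opExp (ρ (linZ y)) := by
  simp [expAction, monom]

theorem exists_represents (f : Laurent n) (N : ℕ) :
    ∃ g, Represents ρ f g N ∧ ρ g = expAction ρ f := by
  induction f using AddMonoidAlgebra.induction_on with
  | of y =>
    obtain ⟨P, hP⟩ := exists_approx {z | (ρ (linZ y)).HasEigenvalue z}
      (Module.End.finite_hasEigenvalue _) (N + Module.finrank ℂ V) jetExp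
    refine ⟨_, (represents_monom hP).mono (Nat.le_add_right _ _), ?_⟩
    rw [← opExp_eq_aeval ρ (Nat.le_add_left _ _) hP]
    exact (expAction_monom ρ y).symm
  | add f f' h h' =>
    obtain ⟨g, hg, e⟩ := h
    obtain ⟨g', hg', e'⟩ := h'
    refine ⟨g + g', fun x hx v hv => ?_, by rw [map_add, map_add, e, e']⟩
    rw [map_add, map_add, add_sub_add_comm]
    exact dvd_add (hg x hx v hv) (hg' x hx v hv)
  | smul z f h =>
    obtain ⟨g, hg, e⟩ := h
    refine ⟨z • g, fun x hx v hv => ?_, by rw [map_smul, map_smul, e]⟩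
    rw [map_smul, map_smul, ← smul_sub, PowerSeries.smul_eq_C_mul]
    exact (hg x hx v hv).mul_left _

end Theta

/-! ### Matsumoto's theorem for products of symmetric groups. -/

section Matsumoto

variable {m : ℕ} {n : Fin m → ℕ}

theorem simple_apply_same (k : Fin m) (a b : Fin (n k)) :
    (simple k a b : Weyl n) k = Equiv.swap a b := Pi.mulSingle_eq_same _ _

theorem simple_apply_of_ne {k k' : Fin m} (h : k' ≠ k) (a b : Fin (n k)) :
    (simple k a b : Weyl n) k' = 1 := Pi.mulSingle_eq_of_ne h _

theorem simple_mul_self (k : Fin m) (a b : Fin (n k)) :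
    (simple k a b : Weyl n) * simple k a b = 1 := by
  rw [simple, ← Pi.mulSingle_mul, Equiv.swap_mul_self, Pi.mulSingle_one]

theorem mul_simple_cancel (w : Weyl n) (k : Fin m) (a b : Fin (n k)) :
    w * simple k a b * simple k a b = w := by
  rw [mul_assoc, simple_mul_self, mul_one]

theorem len_mul_simple {w : Weyl n} {k : Fin m} {a b : Fin (n k)} (hab : (a : ℕ) + 1 = b)
    (h : w k a < w k b) : len (w * simple k a b) = len w + 1 := by
  unfold len
  rw [← Finset.add_sum_erase _ _ (Finset.mem_univ k),
    ← Finset.add_sum_erase (a := k) _ (fun k => (inversions (w k)).card) (Finset.mem_univ k)]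
  have : ∑ x ∈ Finset.univ.erase k, (inversions ((w * simple k a b) x)).card =
      ∑ x ∈ Finset.univ.erase k, (inversions (w x)).card := by
    refine Finset.sum_congr rfl fun x hx => ?_
    rw [Pi.mul_apply, simple_apply_of_ne (Finset.ne_of_mem_erase hx), mul_one]
  rw [this, Pi.mul_apply, simple_apply_same, inversions_mul_swap _ _ _ hab h]
  ring

theorem len_mul_simple_of_descent {w : Weyl n} {k : Fin m} {a b : Fin (n k)}
    (hab : (a : ℕ) + 1 = b) (h : w k b < w k a) : len (w * simple k a b) + 1 = len w := by
  have h1 := len_mul_simple (w := w * simple k a b) hab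
    (by simpa [simple_apply_same] using h)
  rw [mul_simple_cancel] at h1
  exact h1.symm

theorem lt_of_len_mul_simple {w : Weyl n} {k : Fin m} {a b : Fin (n k)} (hab : (a : ℕ) + 1 = b)
    (h : len (w * simple k a b) = len w + 1) : w k a < w k b := by
  by_contra hcon
  have := len_mul_simple_of_descent hab (lt_of_le_of_ne (not_lt.1 hcon)
    fun h' => ne_of_succ hab ((w k).injective h').symm)
  omega

theorem len_mul_simple_le (w : Weyl n) {k : Fin m} {a b : Fin (n k)} (hab : (a : ℕ) + 1 = b) :
    len (w * simple k a b) ≤ len w + 1 := by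
  by_cases h : w k a < w k b
  · exact (len_mul_simple hab h).le
  · have := len_mul_simple_of_descent hab (lt_of_le_of_ne (not_lt.1 h)
      fun h' => ne_of_succ hab ((w k).injective h').symm)
    omega

theorem len_mul_le (w w' : Weyl n) : len (w * w') ≤ len w + len w' := by
  induction w' using weyl_induction with
  | one => simp
  | step w' k a b hab _ h ih =>
    rw [← mul_assoc, h]
    exact (len_mul_simple_le _ hab).trans (by omega)

theorem simple_commute {k k' : Fin m} {a b : Fin (n k)} {a' b' : Fin (n k')}
    (h : k ≠ k' ∨ ((b : ℕ) < a' ∧ (a : ℕ) < a' ∧ (a : ℕ) < b' ∧ (b : ℕ) < b')) :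
    Commute (simple k a b : Weyl n) (simple k' a' b') := by
  by_cases hk : k = k'
  · subst hk
    obtain ⟨h1, h2, h3, h4⟩ := h.resolve_left (fun h => h rfl)
    refine Commute.map (f := MonoidHom.mulSingle (fun k => Equiv.Perm (Fin (n k))) k) ?_
    refine (Equiv.Perm.disjoint_iff_disjoint_support.2 ?_).commute
    rw [Finset.disjoint_left]
    intro x hx hx'
    rw [Equiv.Perm.mem_support, Equiv.swap_apply_ne_self_iff] at hx hx'
    rcases hx.2 with rfl | rfl <;> rcases hx'.2 with rfl | rfl <;> omega
  · exact Pi.mulSingle_commute hk _ _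

theorem simple_braid {k : Fin m} {a b d : Fin (n k)} (hab : a ≠ b) (hbd : b ≠ d) (had : a ≠ d) :
    (simple k a b * simple k b d * simple k a b : Weyl n) =
      simple k b d * simple k a b * simple k b d := by
  simp only [simple, ← Pi.mulSingle_mul]
  congr 1
  have h1 := Equiv.swap_mul_swap_mul_swap (x := d) (y := b) (z := a) hbd.symm had.symm
  have h2 := Equiv.swap_mul_swap_mul_swap (x := a) (y := b) (z := d) hab had
  rw [Equiv.swap_comm b a, Equiv.swap_comm d b, Equiv.swap_comm a d] at h1
  rw [h1, h2]

theorem mul_simple_apply_left (w : Weyl n) (k : Fin m) (a b : Fin (n k)) :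
    (w * simple k a b) k a = w k b := by
  rw [Pi.mul_apply, simple_apply_same, Equiv.Perm.mul_apply, Equiv.swap_apply_left]

theorem mul_simple_apply_right (w : Weyl n) (k : Fin m) (a b : Fin (n k)) :
    (w * simple k a b) k b = w k a := by
  rw [Pi.mul_apply, simple_apply_same, Equiv.Perm.mul_apply, Equiv.swap_apply_right]

variable {A : Type*} [Monoid A] (τ : ∀ k : Fin m, Fin (n k) → Fin (n k) → A)

/-- `x` is the product of the `τ`'s along a reduced expression of `w`. -/
inductive ReducedProduct : Weyl n → A → Prop
  | one : ReducedProduct 1 1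
  | step (w : Weyl n) (x : A) (k : Fin m) (a b : Fin (n k)) (hab : (a : ℕ) + 1 = b)
      (h : w k a < w k b) (hw : ReducedProduct w x) :
      ReducedProduct (w * simple k a b) (x * τ k a b)

theorem ReducedProduct.exists_of (w : Weyl n) : ∃ x, ReducedProduct τ w x := by
  induction w using weyl_induction with
  | one => exact ⟨1, .one⟩
  | step w k a b hab _ h ih =>
    obtain ⟨x, hx⟩ := ih
    exact ⟨_, .step w x k a b hab (lt_of_len_mul_simple hab h) hx⟩

variable {τ}

/-- Induction on the length of w. Two reduced expressions with different last letters are both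
compared with expressions ending in the longest element of the rank-two subgroup generated by these
letters; there the commutation or braid relation applies. -/
theorem ReducedProduct.unique
    (hfar : ∀ (k k' : Fin m) (a b : Fin (n k)) (a' b' : Fin (n k')), (a : ℕ) + 1 = b →
      (a' : ℕ) + 1 = b' → (k ≠ k' ∨ (b : ℕ) < a') → Commute (τ k a b) (τ k' a' b'))
    (hadj : ∀ (k : Fin m) (a b d : Fin (n k)), (a : ℕ) + 1 = b → (b : ℕ) + 1 = d →
      τ k a b * τ k b d * τ k a b = τ k b d * τ k a b * τ k b d)
    {w : Weyl n} {x y : A} (hx : ReducedProduct τ w x) (hy : ReducedProduct τ w y) : x = y := by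
  induction hN : len w using Nat.strong_induction_on generalizing w x y with
  | _ N ih =>
  -- Commuting last letters s and s': both sides are compared with a reduced product of w s s'.
  have far : ∀ (w : Weyl n) (k k' : Fin m) (a b : Fin (n k)) (a' b' : Fin (n k')) (x y : A),
      (a : ℕ) + 1 = b → (a' : ℕ) + 1 = b' → (k ≠ k' ∨ (b : ℕ) < a') → len w = N →
      w k b < w k a → w k' b' < w k' a' → ReducedProduct τ (w * simple k a b) x →
      ReducedProduct τ (w * simple k' a' b') y → x * τ k a b = y * τ k' a' b' := by
    intro w k k' a b a' b' x y hab hab' hkk hl hd hd' hx hy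
    have hc : Commute (simple k a b : Weyl n) (simple k' a' b') :=
      simple_commute (hkk.imp_right fun h => ⟨h, by omega, by omega, by omega⟩)
    obtain ⟨z, hz⟩ := ReducedProduct.exists_of τ (w * simple k a b * simple k' a' b')
    have e1 : (w * simple k a b) k' a' = w k' a' ∧ (w * simple k a b) k' b' = w k' b' := by
      by_cases hk : k = k'
      · subst hk
        have := hkk.resolve_left fun h => h rfl
        rw [Pi.mul_apply, simple_apply_same, Equiv.Perm.mul_apply, Equiv.Perm.mul_apply,
          Equiv.swap_apply_of_ne_of_ne, Equiv.swap_apply_of_ne_of_ne]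
        · exact ⟨rfl, rfl⟩
        all_goals rw [Ne, Fin.ext_iff]; omega
      · rw [Pi.mul_apply, simple_apply_of_ne (Ne.symm hk), mul_one]; exact ⟨rfl, rfl⟩
    have e2 : (w * simple k' a' b') k a = w k a ∧ (w * simple k' a' b') k b = w k b := by
      by_cases hk : k = k'
      · subst hk
        have := hkk.resolve_left fun h => h rfl
        rw [Pi.mul_apply, simple_apply_same, Equiv.Perm.mul_apply, Equiv.Perm.mul_apply,
          Equiv.swap_apply_of_ne_of_ne, Equiv.swap_apply_of_ne_of_ne]
        · exact ⟨rfl, rfl⟩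
        all_goals rw [Ne, Fin.ext_iff]; omega
      · rw [Pi.mul_apply, simple_apply_of_ne hk, mul_one]; exact ⟨rfl, rfl⟩
    have l1 := len_mul_simple_of_descent hab hd
    have l2 := len_mul_simple_of_descent hab' hd'
    have z1 := ReducedProduct.step _ z k' a' b' hab' (by
      rwa [mul_simple_apply_left, mul_simple_apply_right, e1.1, e1.2]) hz
    have hz' := hz
    rw [mul_assoc, hc.eq, ← mul_assoc] at hz'
    have z2 := ReducedProduct.step _ z k a b hab (by
      rwa [mul_simple_apply_left, mul_simple_apply_right, e2.1, e2.2]) hz'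
    rw [mul_simple_cancel] at z1 z2
    rw [ih _ (by omega) hx z1 rfl, ih _ (by omega) hy z2 rfl, mul_assoc, mul_assoc,
      (hfar k k' a b a' b' hab hab' hkk).eq]
  -- Adjacent last letters s and u: w takes decreasing values at a, b, d, so it has reduced
  -- expressions ending in both sus and usu, completed from a common reduced product of w·sus.
  have adj : ∀ (w : Weyl n) (k : Fin m) (a b d : Fin (n k)) (x y : A),
      (a : ℕ) + 1 = b → (b : ℕ) + 1 = d → len w = N →
      w k b < w k a → w k d < w k b → ReducedProduct τ (w * simple k a b) x →
      ReducedProduct τ (w * simple k b d) y → x * τ k a b = y * τ k b d := by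
    intro w k a b d x y hab hbd hl hd hd' hx hy
    have nab : a ≠ b := ne_of_succ hab
    have nbd : b ≠ d := ne_of_succ hbd
    have nad : a ≠ d := by rw [Ne, Fin.ext_iff]; omega
    have hbr : w * simple k a b * simple k b d * simple k a b =
        w * simple k b d * simple k a b * simple k b d := by
      simp only [mul_assoc]
      congr 1
      simpa only [mul_assoc] using simple_braid nab nbd nad
    obtain ⟨z, hz⟩ := ReducedProduct.exists_of τ (w * simple k a b * simple k b d * simple k a b)
    have hz' := hz
    rw [hbr] at hz'
    have sa : Equiv.swap a b d = d := Equiv.swap_apply_of_ne_of_ne nad.symm nbd.symm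
    have sd : Equiv.swap b d a = a := Equiv.swap_apply_of_ne_of_ne nab nad
    have l1 := len_mul_simple_of_descent hab hd
    have l2 := len_mul_simple_of_descent hbd hd'
    have z1 := ReducedProduct.step _ z k a b hab (by
      simpa [simple_apply_same, sa, sd] using hd') hz
    rw [mul_simple_cancel] at z1
    have z1 := ReducedProduct.step _ _ k b d hbd (by
      simpa [simple_apply_same, sa, sd] using hd'.trans hd) z1
    have z2 := ReducedProduct.step _ z k b d hbd (by
      simpa [simple_apply_same, sa, sd] using hd) hz'
    rw [mul_simple_cancel] at z1 z2
    have z2 := ReducedProduct.step _ _ k a b hab (by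
      simpa [simple_apply_same, sa, sd] using hd'.trans hd) z2
    rw [mul_simple_cancel] at z2
    rw [ih _ (by omega) hx z1 rfl, ih _ (by omega) hy z2 rfl]
    simpa only [mul_assoc] using congrArg (z * ·) (hadj k a b d hab hbd)
  have desc : ∀ (w : Weyl n) (k : Fin m) (a b : Fin (n k)), w k a < w k b →
      (w * simple k a b) k b < (w * simple k a b) k a := by
    intro w k a b h
    simpa [simple_apply_same] using h
  have main : ∀ (w : Weyl n) (k k' : Fin m) (a b : Fin (n k)) (a' b' : Fin (n k')) (x y : A),
      (a : ℕ) + 1 = b → (a' : ℕ) + 1 = b' → len w = N →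
      w k b < w k a → w k' b' < w k' a' → ReducedProduct τ (w * simple k a b) x →
      ReducedProduct τ (w * simple k' a' b') y → x * τ k a b = y * τ k' a' b' := by
    intro w k k' a b a' b' x y hab hab' hl hd hd' hx hy
    by_cases hk : k = k'
    · subst hk
      rcases lt_trichotomy (a : ℕ) a' with h | h | h
      · by_cases hb : (b : ℕ) = a'
        · obtain rfl : b = a' := Fin.ext hb
          exact adj w k a b b' x y hab hab' hl hd hd' hx hy
        · exact far w k k a b a' b' x y hab hab' (Or.inr (by omega)) hl hd hd' hx hy
      · obtain rfl : a = a' := Fin.ext h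
        obtain rfl : b = b' := Fin.ext (by omega)
        have l1 := len_mul_simple_of_descent hab hd
        rw [ih _ (by omega) hx hy rfl]
      · by_cases hb : (b' : ℕ) = a
        · obtain rfl : b' = a := Fin.ext hb
          exact (adj w k a' b' b y x hab' hab hl hd' hd hy hx).symm
        · exact (far w k k a' b' a b y x hab' hab (Or.inr (by omega)) hl hd' hd hy hx).symm
    · exact far w k k' a b a' b' x y hab hab' (Or.inl hk) hl hd hd' hx hy
  have len_one : len (1 : Weyl n) = 0 := by
    simp only [len, Finset.sum_eq_zero_iff, Finset.card_eq_zero]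
    intro x _
    ext ⟨c, d⟩
    simpa [mem_inversions] using fun h => le_of_lt h
  -- Separating the two indices lets both derivations be split by cases.
  generalize hw' : w = w' at hy
  cases hx with
  | one =>
    cases hy with
    | one => rfl
    | step w x k a b hab h hw =>
      have := len_mul_simple hab h
      rw [← hw', len_one] at this
      omega
  | step w x k a b hab h hx =>
    have h1 := desc _ _ _ _ h
    cases hy with
    | one =>
      have := len_mul_simple hab h
      rw [hw', len_one] at this
      omega
    | step w₂ y k' a' b' hab' h' hy =>
      have h2 := desc _ _ _ _ h'
      rw [← hw'] at h2
      refine main _ k k' a b a' b' x y hab hab' hN h1 h2 ?_ ?_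
      · rwa [mul_simple_cancel]
      · rwa [hw', mul_simple_cancel]

/-- T w is the product along any reduced expression. Multiplicativity follows by removing the last
letter of w'. -/
theorem exists_mul_of_braid
    (hfar : ∀ (k k' : Fin m) (a b : Fin (n k)) (a' b' : Fin (n k')), (a : ℕ) + 1 = b →
      (a' : ℕ) + 1 = b' → (k ≠ k' ∨ (b : ℕ) < a') → Commute (τ k a b) (τ k' a' b'))
    (hadj : ∀ (k : Fin m) (a b d : Fin (n k)), (a : ℕ) + 1 = b → (b : ℕ) + 1 = d →
      τ k a b * τ k b d * τ k a b = τ k b d * τ k a b * τ k b d) :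
    ∃ T : Weyl n → A, T 1 = 1 ∧
      (∀ (k : Fin m) (a b : Fin (n k)), (a : ℕ) + 1 = b → T (simple k a b) = τ k a b) ∧
      ∀ w w', len (w * w') = len w + len w' → T w * T w' = T (w * w') := by
  choose T hT using ReducedProduct.exists_of τ
  have h1 : T 1 = 1 := (hT 1).unique hfar hadj .one
  have hs : ∀ (w : Weyl n) (k : Fin m) (a b : Fin (n k)), (a : ℕ) + 1 = b → w k a < w k b →
      T (w * simple k a b) = T w * τ k a b := fun w k a b hab h =>
    (hT _).unique hfar hadj (.step w _ k a b hab h (hT w))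
  refine ⟨T, h1, ?_, ?_⟩
  · intro k a b hab
    have := hs 1 k a b hab (by simp only [Pi.one_apply, Equiv.Perm.one_apply, Fin.lt_def]; omega)
    rwa [one_mul, h1, one_mul] at this
  · intro w w' h
    induction w' using weyl_induction with
    | one => rw [h1, mul_one, mul_one]
    | step w' k a b hab _ hl ih =>
      rw [← mul_assoc] at h ⊢
      -- Subadditivity of the length forces w w' to be length-additive after the last letter is
      -- removed as well.
      have e1 := len_mul_simple_le (w * w') hab
      have e2 := len_mul_le w w'
      rw [hs w' k a b hab (lt_of_len_mul_simple hab hl),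
        hs _ k a b hab (lt_of_len_mul_simple hab (by omega)), ← ih (by omega), mul_assoc]

end Matsumoto

/-! ### Noncommutative identities reducing relations to brackets. -/

section RingIdentities

variable {A : Type*} [Ring A]

/-- Moving P to the right of s creates sP' + G; then s is absorbed by (s + 1)s = s + 1 and the
bracket remains. -/
theorem sign_mul_sq {s P P' G κ : A} (hs : s * s = 1) (h : P * s = s * P' + G)
    (hB : P' + P + G - κ = 0) (hκ : κ * P = P * κ) :
    (s + 1) * P * ((s + 1) * P) = (s + 1) * P * κ := by
  have e1 : (s + 1) * P * ((s + 1) * P) = (s + 1) * (P * s + P) * P := by noncomm_ring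
  have e2 : (s + 1) * (s * P' + G + P) * P =
      (s + 1) * (P' + P + G - κ) * P + (s + 1) * κ * P + (s * s - 1) * P' * P := by noncomm_ring
  rw [e1, h, e2, hB, hs, sub_self, mul_zero, zero_mul, zero_mul, zero_mul, zero_add, add_zero,
    mul_assoc, hκ, mul_assoc]

theorem bernstein_of_bracket {s P x x' G F : A} (h : x' * s = s * x + G) (hPx : P * x = x * P)
    (hB : P * x - x - G * P - x' * P + x' - F = 0) :
    ((s + 1) * P - 1) * x - x' * ((s + 1) * P - 1) = F := by
  have e : ((s + 1) * P - 1) * x - x' * ((s + 1) * P - 1) =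
      s * (P * x) + P * x - x - (x' * s) * P - x' * P + x' := by noncomm_ring
  rw [e, h, hPx]
  rw [hPx] at hB
  have e2 : s * (x * P) + x * P - x - (s * x + G) * P - x' * P + x' =
      (x * P - x - G * P - x' * P + x' - F) + F := by noncomm_ring
  rw [e2, hB, zero_add]

/-- All polynomials move to the right and stray factors s are absorbed by s + 1. The bracket removes
the rest. The group part that survives expands to sus + su + us + s + u + 1. -/
theorem sign_mul_sign_mul_sign {s u Pa Pb Pg D D' P₄ D₂ Q : A} (hs : s * s = 1)
    (h1 : Pb * s = s * Pg + D') (h2 : Pa * u = u * Pg + D) (h3 : Pg * s = s * Pb - D')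
    (h4 : (Pa + D) * s = s * P₄ + D₂) (h6 : Pg * D' = D' * Pg) (h7 : Pg * Pb = Pb * Pg)
    (hQ : ∀ x, Q * x = x * Q)
    (h5 : (P₄ + D₂) * Pg + (Pa + D) * (Pb + D') - Q - Pb * Pg = 0) :
    (s + 1) * Pa * ((u + 1) * Pb) * ((s + 1) * Pa) - Q * ((s + 1) * Pa) =
      (s + 1) * (u * s + u + 1) * (Pb * Pg * Pa) := by
  have e1 : (s + 1) * Pa * ((u + 1) * Pb) * ((s + 1) * Pa) =
      (s + 1) * ((Pa * u + Pa) * (Pb * s + Pb)) * Pa := by noncomm_ring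
  have e2 : (u * Pg + D + Pa) * (s * Pg + D' + Pb) =
      u * (Pg * s) * Pg + u * (Pg * D') + u * (Pg * Pb) + ((Pa + D) * s) * Pg +
        (Pa + D) * (Pb + D') := by noncomm_ring
  have e3 : (Pa + D) * (Pb + D') = Q + Pb * Pg - (P₄ + D₂) * Pg := by
    rw [← sub_eq_zero, ← h5]; noncomm_ring
  rw [e1, h1, h2, e2, h3, h4, h6, h7, e3, hQ]
  have e4 : (s + 1) * (u * (s * Pb - D') * Pg + u * (D' * Pg) + u * (Pb * Pg) +
      (s * P₄ + D₂) * Pg + (Q + Pb * Pg - (P₄ + D₂) * Pg)) * Pa - (s + 1) * Pa * Q =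
      (s + 1) * (u * s + u + 1) * (Pb * Pg * Pa) + (s * s - 1) * (P₄ * Pg * Pa) +
        ((s + 1) * (Q * Pa) - (s + 1) * (Pa * Q)) := by noncomm_ring
  rw [e4, hs, hQ, sub_self, zero_mul, sub_self, add_zero, add_zero]

/-- Since N² = N(1 + Q), the braid relation for N - 1 and N' - 1 follows from symmetry of NN'N - QN.
-/
theorem braid_of_sign_braid {N N' Q : A} (h : N * N = N * (1 + Q)) (h' : N' * N' = N' * (1 + Q))
    (hQ : ∀ x, Q * x = x * Q) (hb : N * N' * N - Q * N = N' * N * N' - Q * N') :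
    (N - 1) * (N' - 1) * (N - 1) = (N' - 1) * (N - 1) * (N' - 1) := by
  rw [hQ, hQ] at hb
  have e : (N - 1) * (N' - 1) * (N - 1) = (N * N' * N - N * Q) - N * N' - N' * N -
      (N * N - N * (1 + Q)) + N + N' - 1 := by noncomm_ring
  have e' : (N' - 1) * (N - 1) * (N' - 1) = (N' * N * N' - N' * Q) - N * N' - N' * N -
      (N' * N' - N' * (1 + Q)) + N + N' - 1 := by noncomm_ring
  rw [e, e', hb, h, h', sub_self, sub_self]

end RingIdentities

/-! ### Hecke relations for the operators (t_s + 1) φ(α) - 1. -/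

section Operators

open MvPolynomial

variable {m : ℕ} {n : Fin m → ℕ} (q : ℝ)

theorem act_aeval (w : Weyl n) (f : Poly n) (p : Polynomial ℂ) :
    act w (Polynomial.aeval f p) = Polynomial.aeval (act w f) p :=
  (Polynomial.aeval_algHom_apply (act w) f p).symm

theorem act_simple_rt_self (k : Fin m) (a b : Fin (n k)) :
    act (simple k a b) (rt k a b) = rt k b a := by
  rw [map_sub, act_simple_X_left, act_simple_X_right]

theorem act_simple_rt_right {k : Fin m} {a b d : Fin (n k)} (had : a ≠ d) (hbd : b ≠ d) :
    act (simple k a b) (rt k b d) = rt k a d := by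
  rw [map_sub, act_simple_X_right,
    act_simple_X_of_ne k a b ⟨k, d⟩ (mk_ne_mk had.symm) (mk_ne_mk hbd.symm)]

theorem act_simple_rt_left' {k : Fin m} {a b d : Fin (n k)} (had : a ≠ d) (hbd : b ≠ d) :
    act (simple k a b) (rt k d a) = rt k d b := by
  rw [map_sub, act_simple_X_left,
    act_simple_X_of_ne k a b ⟨k, d⟩ (mk_ne_mk had.symm) (mk_ne_mk hbd.symm)]

theorem exists_cross (k : Fin m) (a b : Fin (n k)) (c : ℂ) (f : Poly n) :
    ∃ g : Poly n, g * rt k a b = C c * (f - act (simple k a b) f) := by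
  obtain ⟨g, hg⟩ := exists_divided_difference k a b f
  exact ⟨C c * g, by rw [mul_assoc, hg]⟩

variable {V : Type u} [AddCommGroup V] [Module ℂ V] (R : GradedHecke q n →ₐ[ℂ] Module.End ℂ V)

/-- The restriction of a representation of `ℍ_n` to `S(V)`. -/
abbrev polyRep : Poly n →ₐ[ℂ] Module.End ℂ V := R.comp (GradedHecke.ofPoly q n)

/-- The operator `(t_s + 1) p(α) - 1`. -/
def lusztigOp (p : Polynomial ℂ) (k : Fin m) (a b : Fin (n k)) : Module.End ℂ V :=
  (R (GradedHecke.t q (simple k a b)) + 1) * polyRep q R (Polynomial.aeval (rt k a b) p) - 1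

/-- The cross relation with log q absorbed into g, and with g and s(f) characterized by equations so
that brackets can be fed in directly. -/
theorem polyRep_mul_t {k : Fin m} {a b : Fin (n k)} (hab : (a : ℕ) + 1 = b) {f f' g : Poly n}
    (hf : act (simple k a b) f = f') (hg : g * rt k a b = C (Real.log q : ℂ) * (f - f')) :
    polyRep q R f * R (GradedHecke.t q (simple k a b)) =
      R (GradedHecke.t q (simple k a b)) * polyRep q R f' + polyRep q R g := by
  subst hf
  obtain ⟨g', hg'⟩ := exists_divided_difference k a b f
  have : g = C (Real.log q : ℂ) * g' := by
    refine mul_right_cancel₀ (X_sub_X_ne_zero (mk_ne_mk (ne_of_succ hab))) (hg.trans ?_)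
    rw [mul_assoc, hg']
  have h := congrArg R (GradedHecke.ofPoly_mul_t q k a b hab f g' hg')
  rw [map_mul, map_add, map_mul, map_smul] at h
  refine h.trans ?_
  rw [this, map_mul, ← algebraMap_eq, AlgHom.commutes, ← Algebra.smul_def]
  rfl

theorem t_simple_mul_self (k : Fin m) (a b : Fin (n k)) :
    R (GradedHecke.t q (simple k a b)) * R (GradedHecke.t q (simple k a b)) = 1 := by
  rw [← map_mul, GradedHecke.t_mul, simple_mul_self, GradedHecke.t_one, map_one]

theorem polyRep_commute (f g : Poly n) : polyRep q R f * polyRep q R g =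
    polyRep q R g * polyRep q R f := by
  rw [← map_mul, mul_comm, map_mul]

theorem polyRep_commute_t {k : Fin m} {a b : Fin (n k)} (hab : (a : ℕ) + 1 = b) {f : Poly n}
    (hf : act (simple k a b) f = f) :
    Commute (polyRep q R f) (R (GradedHecke.t q (simple k a b))) :=
  (GradedHecke.ofPoly_commute_t_simple q k a b hab hf).map R

theorem exp_log_eq {q : ℝ} (hq : 1 < q) : Complex.exp (Real.log q : ℂ) = q := by
  rw [← Complex.ofReal_exp, Real.exp_log (by linarith)]

variable {q R} [FiniteDimensional ℂ V] (hq : 1 < q) (hR : HasRealRoots (polyRep q R))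
  {p : Polynomial ℂ} {r : ℕ} (hr : killOrder (Coord n) V + 3 ≤ r)
  (hp : Approx p (rootSpec (polyRep q R)) r (jetPhi (Real.log q)))
include hR hq hr hp

theorem lusztigOp_quadratic {k : Fin m} {a b : Fin (n k)} (hab : (a : ℕ) + 1 = b) :
    (lusztigOp q R p k a b + 1) * (lusztigOp q R p k a b + 1) =
      (lusztigOp q R p k a b + 1) * (1 + algebraMap ℂ _ (q : ℂ)) := by
  obtain ⟨G, hG⟩ := exists_cross k a b (Real.log q : ℂ) (Polynomial.aeval (rt k a b) p)
  have ha : act (simple k a b) (Polynomial.aeval (rt k a b) p) = Polynomial.aeval (rt k b a) p := by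
    rw [act_aeval, act_simple_rt_self]
  rw [ha] at hG
  have hB := quadratic_bracket hR (by omega) hp (ne_of_succ hab) hG
  rw [exp_log_eq hq, map_sub, map_add, map_add, map_add C, map_one, map_add, map_one,
    ← algebraMap_eq, AlgHom.commutes] at hB
  rw [lusztigOp, sub_add_cancel]
  refine sign_mul_sq (t_simple_mul_self q R k a b) (polyRep_mul_t q R hab ha hG) hB ?_
  rw [add_mul, mul_add, one_mul, mul_one, Algebra.commutes]

/-- The two exponentials are interpolated by one polynomial, so that s carries one to the other and
a single cross relation applies. -/
theorem lusztigOp_bernstein {k : Fin m} {a b : Fin (n k)} (hab : (a : ℕ) + 1 = b)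
    {y : Coord n → ℤ} {f : Laurent n}
    (hf : f * (1 - monom (-root k a b)) = monom y - monom (permute (simple k a b) y)) :
    lusztigOp q R p k a b * expAction (polyRep q R) (monom y) -
      expAction (polyRep q R) (monom (permute (simple k a b) y)) * lusztigOp q R p k a b =
      ((q : ℂ) - 1) • expAction (polyRep q R) f := by
  set ρ := polyRep q R
  set y' := permute (simple k a b) y with hy'
  have hperm : act (simple k a b) (linZ y') = linZ y := by
    rw [hy', linZ, show (fun c => ((permute (simple k a b) y c : ℤ) : ℂ)) =
      permute (simple k a b) (fun c => (y c : ℂ)) from rfl, ← act_lin, act_simple_act_simple]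
  obtain ⟨E, hE⟩ := exists_approx
    ({z | (ρ (linZ y)).HasEigenvalue z} ∪ {z | (ρ (linZ y')).HasEigenvalue z})
    ((Module.End.finite_hasEigenvalue _).union (Module.End.finite_hasEigenvalue _))
    (r + Module.finrank ℂ V) jetExp
  have h1 := hE.mono Set.subset_union_left le_rfl
  have h2 := hE.mono Set.subset_union_right le_rfl
  obtain ⟨g, hg, hgf⟩ := exists_represents ρ f r
  obtain ⟨G, hG⟩ := exists_cross k a b (Real.log q : ℂ) (Polynomial.aeval (linZ y') E)
  have ha : act (simple k a b) (Polynomial.aeval (linZ y') E) = Polynomial.aeval (linZ y) E := by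
    rw [act_aeval, hperm]
  rw [ha] at hG
  have hB := cross_bracket hR (by omega) hp (ne_of_succ hab) hf hg
    ((represents_monom h1).mono (Nat.le_add_right _ _))
    ((represents_monom h2).mono (Nat.le_add_right _ _)) hG
  rw [expAction_monom, expAction_monom, opExp_eq_aeval ρ (Nat.le_add_left _ _) h1,
    opExp_eq_aeval ρ (Nat.le_add_left _ _) h2, ← hgf, lusztigOp]
  rw [exp_log_eq hq] at hB
  simp only [map_sub ρ, map_add ρ, map_mul ρ] at hB
  rw [← algebraMap_eq, AlgHom.commutes, ← Algebra.smul_def] at hB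
  exact bernstein_of_bracket (polyRep_mul_t q R hab ha hG) (polyRep_commute q R _ _) hB

-- Distant simple reflections fix each other's roots, so all four factors commute; the nature of p
-- plays no role.
omit hq hR hr hp [FiniteDimensional ℂ V] in
theorem lusztigOp_commute {k k' : Fin m} {a b : Fin (n k)} {a' b' : Fin (n k')}
    (hab : (a : ℕ) + 1 = b) (hab' : (a' : ℕ) + 1 = b') (h : k ≠ k' ∨ (b : ℕ) < a') :
    Commute (lusztigOp q R p k a b) (lusztigOp q R p k' a' b') := by
  have hc : Commute (simple k a b : Weyl n) (simple k' a' b') :=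
    simple_commute (h.imp_right fun h => ⟨h, by omega, by omega, by omega⟩)
  have hne : ∀ (c : Fin (n k)) (c' : Fin (n k')), (c : ℕ) ≤ b → (a' : ℕ) ≤ c' →
      (⟨k, c⟩ : Coord n) ≠ ⟨k', c'⟩ := by
    rintro c c' h1 h2 heq
    obtain ⟨rfl, h3⟩ := Sigma.mk.inj heq
    obtain rfl := eq_of_heq h3
    have := h.resolve_left fun h => h rfl
    omega
  have e1 : act (simple k' a' b') (rt k a b) = rt k a b := by
    rw [map_sub, act_simple_X_of_ne _ _ _ _ (hne a a' (by omega) le_rfl)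
      (hne a b' (by omega) (by omega)), act_simple_X_of_ne _ _ _ _ (hne b a' le_rfl le_rfl)
      (hne b b' le_rfl (by omega))]
  have e2 : act (simple k a b) (rt k' a' b') = rt k' a' b' := by
    rw [map_sub, act_simple_X_of_ne _ _ _ _ (hne a a' (by omega) le_rfl).symm
      (hne b a' le_rfl le_rfl).symm, act_simple_X_of_ne _ _ _ _
      (hne a b' (by omega) (by omega)).symm (hne b b' le_rfl (by omega)).symm]
  have c1 : Commute (polyRep q R (Polynomial.aeval (rt k a b) p))
      (R (GradedHecke.t q (simple k' a' b'))) :=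
    polyRep_commute_t q R hab' (by rw [act_aeval, e1])
  have c2 : Commute (polyRep q R (Polynomial.aeval (rt k' a' b') p))
      (R (GradedHecke.t q (simple k a b))) :=
    polyRep_commute_t q R hab (by rw [act_aeval, e2])
  have c3 : Commute (R (GradedHecke.t q (simple k a b))) (R (GradedHecke.t q (simple k' a' b'))) := by
    rw [Commute, SemiconjBy, ← map_mul, ← map_mul, GradedHecke.t_mul, GradedHecke.t_mul, hc.eq]
  have c4 : Commute (polyRep q R (Polynomial.aeval (rt k a b) p))
      (polyRep q R (Polynomial.aeval (rt k' a' b') p)) := polyRep_commute q R _ _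
  have c5 : Commute ((R (GradedHecke.t q (simple k a b)) + 1) *
      polyRep q R (Polynomial.aeval (rt k a b) p)) ((R (GradedHecke.t q (simple k' a' b')) + 1) *
      polyRep q R (Polynomial.aeval (rt k' a' b') p)) :=
    Commute.mul_left
      (((c3.add_right (Commute.one_right _)).add_left (Commute.one_left _)).mul_right
        (c2.symm.add_left (Commute.one_left _)))
      ((c1.add_right (Commute.one_right _)).mul_right c4)
  exact (c5.sub_right (Commute.one_right _)).sub_left (Commute.one_left _)

/-- The pair of adjacent simple roots is kept abstract, with their sum as a third root, so that the
result applies to both orders of the pair. -/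
theorem lusztigOp_sign_braid {k : Fin m} {a b a' b' a'' b'' : Fin (n k)} (hab : (a : ℕ) + 1 = b)
    (hab' : (a' : ℕ) + 1 = b') (hne : a'' ≠ b'')
    (hv : ∀ x : Coord n → ℂ, x ⟨k, a''⟩ - x ⟨k, b''⟩ =
      (x ⟨k, a⟩ - x ⟨k, b⟩) + (x ⟨k, a'⟩ - x ⟨k, b'⟩))
    (hs : rt k a'' b'' = rt k a b + rt k a' b')
    (h1 : act (simple k a b) (rt k a' b') = rt k a'' b'')
    (h2 : act (simple k a' b') (rt k a b) = rt k a'' b'') :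
    (R (GradedHecke.t q (simple k a b)) + 1) * polyRep q R (Polynomial.aeval (rt k a b) p) *
      ((R (GradedHecke.t q (simple k a' b')) + 1) *
        polyRep q R (Polynomial.aeval (rt k a' b') p)) *
      ((R (GradedHecke.t q (simple k a b)) + 1) * polyRep q R (Polynomial.aeval (rt k a b) p)) -
      algebraMap ℂ _ (q : ℂ) *
        ((R (GradedHecke.t q (simple k a b)) + 1) * polyRep q R (Polynomial.aeval (rt k a b) p)) =
    (R (GradedHecke.t q (simple k a b)) + 1) * (R (GradedHecke.t q (simple k a' b')) *
      R (GradedHecke.t q (simple k a b)) + R (GradedHecke.t q (simple k a' b')) + 1) *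
      (polyRep q R (Polynomial.aeval (rt k a' b') p) *
        polyRep q R (Polynomial.aeval (rt k a'' b'') p) *
        polyRep q R (Polynomial.aeval (rt k a b) p)) := by
  have h3 : act (simple k a b) (rt k a'' b'') = rt k a' b' := by
    rw [← h1, act_simple_act_simple]
  have a1 : act (simple k a b) (Polynomial.aeval (rt k a' b') p) =
      Polynomial.aeval (rt k a'' b'') p := by rw [act_aeval, h1]
  have a2 : act (simple k a' b') (Polynomial.aeval (rt k a b) p) =
      Polynomial.aeval (rt k a'' b'') p := by rw [act_aeval, h2]
  have a3 : act (simple k a b) (Polynomial.aeval (rt k a'' b'') p) =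
      Polynomial.aeval (rt k a' b') p := by rw [act_aeval, h3]
  have a4 : act (simple k a b) (Polynomial.aeval (rt k a b) p) =
      Polynomial.aeval (rt k b a) p := by rw [act_aeval, act_simple_rt_self]
  obtain ⟨D, hD⟩ := exists_cross k a' b' (Real.log q : ℂ) (Polynomial.aeval (rt k a b) p)
  obtain ⟨D', hD'⟩ := exists_cross k a b (Real.log q : ℂ) (Polynomial.aeval (rt k a' b') p)
  obtain ⟨D₂, hD₂⟩ := exists_cross k a b (Real.log q : ℂ) (Polynomial.aeval (rt k a b) p + D)
  -- Applying s to the equation for D gives that for E = s(D), the correction term needed when D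
  -- crosses s.
  have hE := congrArg (act (simple k a b)) hD
  rw [a2] at hD
  rw [a1] at hD'
  rw [a2, map_mul, h1, map_mul, algHom_C, map_sub, a3, a4, algebraMap_eq] at hE
  rw [map_add, a4] at hD₂
  have hB := braid_bracket hR (by omega) hp (ne_of_succ hab) (ne_of_succ hab') hne hv hs
    hD hD' hE hD₂
  rw [exp_log_eq hq] at hB
  simp only [map_sub (polyRep q R), map_add (polyRep q R), map_mul (polyRep q R)] at hB
  rw [← algebraMap_eq, AlgHom.commutes] at hB
  have c4 := polyRep_mul_t q R hab (by rw [map_add, a4]) hD₂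
  rw [map_add, map_add] at c4
  have c3 := polyRep_mul_t q R hab a3 (g := -D') (by rw [neg_mul, hD']; ring)
  rw [map_neg, ← sub_eq_add_neg] at c3
  exact sign_mul_sign_mul_sign (t_simple_mul_self q R k a b) (polyRep_mul_t q R hab a1 hD')
    (polyRep_mul_t q R hab' a2 hD) c3 c4 (polyRep_commute q R _ _) (polyRep_commute q R _ _)
    (fun x => Algebra.commutes _ x) hB

/-- The right-hand side of `lusztigOp_sign_braid` is the sum of the six elements of S₃ times φ of
the three positive roots, symmetric in the two reflections. -/
theorem lusztigOp_braid {k : Fin m} {a b d : Fin (n k)} (hab : (a : ℕ) + 1 = b)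
    (hbd : (b : ℕ) + 1 = d) :
    lusztigOp q R p k a b * lusztigOp q R p k b d * lusztigOp q R p k a b =
      lusztigOp q R p k b d * lusztigOp q R p k a b * lusztigOp q R p k b d := by
  have nab : a ≠ b := ne_of_succ hab
  have nbd : b ≠ d := ne_of_succ hbd
  have nad : a ≠ d := by rw [Ne, Fin.ext_iff]; omega
  have q1 := lusztigOp_quadratic hq hR hr hp hab
  have q2 := lusztigOp_quadratic hq hR hr hp hbd
  rw [lusztigOp, sub_add_cancel] at q1 q2
  refine braid_of_sign_braid q1 q2 (fun x => Algebra.commutes _ x) ?_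
  rw [lusztigOp_sign_braid hq hR hr hp hab hbd nad (fun x => by ring) (by simp only [rt]; ring)
      (act_simple_rt_right nad nbd) (act_simple_rt_left' nab.symm nad.symm),
    lusztigOp_sign_braid hq hR hr hp hbd hab nad (fun x => by ring) (by simp only [rt]; ring)
      (act_simple_rt_left' nab.symm nad.symm) (act_simple_rt_right nad nbd)]
  have hb : R (GradedHecke.t q (simple k a b)) * R (GradedHecke.t q (simple k b d)) *
      R (GradedHecke.t q (simple k a b)) = R (GradedHecke.t q (simple k b d)) *
      R (GradedHecke.t q (simple k a b)) * R (GradedHecke.t q (simple k b d)) := by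
    simp only [← map_mul, GradedHecke.t_mul, simple_braid nab nbd nad]
  have hP : polyRep q R (Polynomial.aeval (rt k b d) p) *
        polyRep q R (Polynomial.aeval (rt k a d) p) *
        polyRep q R (Polynomial.aeval (rt k a b) p) =
      polyRep q R (Polynomial.aeval (rt k a b) p) *
        polyRep q R (Polynomial.aeval (rt k a d) p) *
        polyRep q R (Polynomial.aeval (rt k b d) p) := by
    simp only [← map_mul]
    congr 1
    ring
  rw [hP]
  congr 1
  have e : ∀ x y : Module.End ℂ V, (x + 1) * (y * x + y + 1) =
      x * y * x + x * y + x + y * x + y + 1 := fun x y => by noncomm_ring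
  rw [e, e, hb]
  abel

end Operators

/-! ### Functional calculus and linear maps. -/

section Intertwining

open Polynomial

variable {V W : Type u} [AddCommGroup V] [Module ℂ V] [AddCommGroup W] [Module ℂ W]

theorem aeval_intertwine {f : V →ₗ[ℂ] W} {A : Module.End ℂ V} {B : Module.End ℂ W}
    (h : ∀ y, f (A y) = B (f y)) (P : ℂ[X]) (y : V) : f (aeval A P y) = aeval B P (f y) := by
  induction P using Polynomial.induction_on' generalizing y with
  | add p q hp hq => simp only [map_add, LinearMap.add_apply, hp, hq]
  | monomial k a =>
    simp only [aeval_monomial, Module.End.mul_apply, Module.algebraMap_end_apply, map_smul]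
    congr 1
    induction k generalizing y with
    | zero => rfl
    | succ k ih => simp only [pow_succ, Module.End.mul_apply, ih, h]

theorem hasEigenvalue_sub_of_add {A : Module.End ℂ V} {c z : ℂ}
    (h : (A + algebraMap ℂ _ c).HasEigenvalue z) : A.HasEigenvalue (z - c) := by
  obtain ⟨y, hy⟩ := h.exists_hasEigenvector
  refine Module.End.hasEigenvalue_of_hasEigenvector (x := y)
    ⟨Module.End.mem_eigenspace_iff.2 ?_, hy.2⟩
  have := hy.apply_eq_smul
  rw [LinearMap.add_apply, Module.algebraMap_end_apply] at this
  rw [sub_smul, ← this, add_sub_cancel_right]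

variable [FiniteDimensional ℂ V] [FiniteDimensional ℂ W]

/-- One polynomial interpolating at the eigenvalues of both operators computes both series. -/
theorem opSeries_intertwine {a : ℕ → ℂ} (ha : IsEntire a) {f : V →ₗ[ℂ] W} {A : Module.End ℂ V}
    {B : Module.End ℂ W} (h : ∀ y, f (A y) = B (f y)) (y : V) :
    f (opSeries a A y) = opSeries a B (f y) := by
  obtain ⟨P, hP⟩ := exists_approx ({z | A.HasEigenvalue z} ∪ {z | B.HasEigenvalue z})
    ((Module.End.finite_hasEigenvalue _).union (Module.End.finite_hasEigenvalue _))
    (Module.finrank ℂ V + Module.finrank ℂ W) (jet a)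
  rw [opSeries_eq_aeval ha A (Nat.le_add_right _ _) (hP.mono Set.subset_union_left le_rfl),
    opSeries_eq_aeval ha B (Nat.le_add_left _ _) (hP.mono Set.subset_union_right le_rfl),
    aeval_intertwine h]

/-- The jets of E are invertible at real points; interpolating their inverses gives the inverse
operator. -/
theorem isUnit_opE {A : Module.End ℂ V} (hA : ∀ z, A.HasEigenvalue z → z.im = 0) :
    IsUnit (opE A) := by
  have hfin := Module.End.finite_hasEigenvalue A
  obtain ⟨P, hP⟩ := exists_approx _ hfin (Module.finrank ℂ V) jetE
  obtain ⟨Q, hQ⟩ := exists_approx _ hfin (Module.finrank ℂ V) fun z => (jetE z)⁻¹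
  have h1 : Approx (1 : ℂ[X]) {z | A.HasEigenvalue z} (Module.finrank ℂ V) (fun _ => 1) :=
    fun z _ => by simp
  have h2 := (hP.mul hQ).congr (G := fun _ => 1) fun z hz =>
    PowerSeries.mul_inv_cancel _ (constantCoeff_jetE_ne_zero (hA z hz))
  have h3 := aeval_eq_of_approx A le_rfl h2 h1
  rw [opE, opSeries_eq_aeval isEntire_E A le_rfl hP]
  rw [map_mul, map_one] at h3
  refine ⟨⟨_, aeval A Q, h3, ?_⟩, rfl⟩
  rw [← map_mul, mul_comm, map_mul, h3]

/-- Identifies p(A) with E(A + c) E(A)⁻¹, written without the inverse. -/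
theorem aeval_mul_opE {A : Module.End ℂ V} (hA : ∀ z, A.HasEigenvalue z → z.im = 0) (c : ℂ)
    {p : ℂ[X]} {d : ℕ} (hd : Module.finrank ℂ V ≤ d)
    (hp : Approx p {z | A.HasEigenvalue z} d (jetPhi c)) :
    aeval A p * opE A = opE (A + algebraMap ℂ _ c) := by
  obtain ⟨P, hP⟩ := exists_approx _ (Module.End.finite_hasEigenvalue A) d jetE
  obtain ⟨Q, hQ⟩ := exists_approx ((· + c) '' {z | A.HasEigenvalue z})
    ((Module.End.finite_hasEigenvalue A).image _) d jetE
  have hQ1 : Approx Q {z | (A + algebraMap ℂ _ c).HasEigenvalue z} d jetE :=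
    hQ.mono (fun z hz => ⟨z - c, hasEigenvalue_sub_of_add hz, sub_add_cancel z c⟩) le_rfl
  -- Translating Q by c turns its jets at z + c into jets at z, so that E(A + c) is also a
  -- polynomial in A.
  have hQ2 : Approx (taylor c Q) {z | A.HasEigenvalue z} d (fun z => jetE (z + c)) := by
    intro z hz
    rw [taylor_taylor]
    exact hQ _ ⟨z, hz, rfl⟩
  have h := (hp.mul hP).congr (G := fun z => jetE (z + c)) fun z hz => jetPhi_mul_jetE c (hA z hz)
  have h3 := aeval_eq_of_approx A hd h hQ2
  rw [opE, opE, opSeries_eq_aeval isEntire_E A hd hP, opSeries_eq_aeval isEntire_E _ hd hQ1,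
    ← map_mul, h3, taylor_apply, aeval_comp]
  simp

end Intertwining

/-! ### Lusztig's action of the affine Hecke algebra. -/

section LusztigAction

open MvPolynomial

variable {m : ℕ} {n : Fin m → ℕ} (q : ℝ)

/-- The universal property of `ℋ_n`, for algebras in any universe. -/
def affineLift {B : Type u} [Ring B] [Algebra ℂ B] (f : AffineFree n →ₐ[ℂ] B)
    (hf : ∀ x y, AffineRel q n x y → f x = f y) : AffineHecke q n →ₐ[ℂ] B :=
  RingQuot.liftAlgHom ℂ ⟨f, fun x y h => hf x y h⟩

theorem affineLift_mk {B : Type u} [Ring B] [Algebra ℂ B] (f : AffineFree n →ₐ[ℂ] B)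
    (hf : ∀ x y, AffineRel q n x y → f x = f y) (x : AffineFree n) :
    affineLift q f hf (AffineHecke.mk q n x) = f x :=
  RingQuot.liftAlgHom_mkAlgHom_apply ℂ f (fun x y h => hf x y h) x

variable {q} {V : Type u} [AddCommGroup V] [Module ℂ V] [FiniteDimensional ℂ V]

/-- `Ψ` is obtained from `R` by Lusztig's reduction: `θ_x` acts as `e^x`, and `T_s + 1` as
`(t_s + 1) E(α + log q) E(α)⁻¹`. -/
structure IsLusztigAction (R : GradedHecke q n →ₐ[ℂ] Module.End ℂ V)
    (Ψ : AffineHecke q n →ₐ[ℂ] Module.End ℂ V) : Prop where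
  theta : ∀ y, Ψ (AffineHecke.theta q y) = opExp (polyRep q R (linZ y))
  T_add_one : ∀ (k : Fin m) (a b : Fin (n k)), (a : ℕ) + 1 = b →
    (Ψ (AffineHecke.T q (simple k a b)) + 1) * opE (polyRep q R (rt k a b)) =
      (R (GradedHecke.t q (simple k a b)) + 1) *
        opE (polyRep q R (rt k a b) + algebraMap ℂ _ (Real.log q : ℂ))

theorem HasRealRoots.exists_isLusztigAction (hq : 1 < q)
    {R : GradedHecke q n →ₐ[ℂ] Module.End ℂ V} (hR : HasRealRoots (polyRep q R)) :
    ∃ Ψ, IsLusztigAction R Ψ := by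
  obtain ⟨p, hp⟩ := exists_approx (rootSpec (polyRep q R)) finite_rootSpec
    -- `killOrder` + 3 serves the braid bracket, the strictest of the brackets; the dimension is
    -- added for the comparison with `opE`.
    (killOrder (Coord n) V + 3 + Module.finrank ℂ V) (jetPhi (Real.log q))
  have hr : killOrder (Coord n) V + 3 ≤ killOrder (Coord n) V + 3 + Module.finrank ℂ V :=
    Nat.le_add_right _ _
  obtain ⟨T, hT1, hTs, hTm⟩ := exists_mul_of_braid (τ := lusztigOp q R p)
    (fun k k' a b a' b' hab hab' h => lusztigOp_commute hab hab' h)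
    (fun k a b d hab hbd => lusztigOp_braid hq hR hr hp hab hbd)
  let Ψ : AffineHecke q n →ₐ[ℂ] Module.End ℂ V := affineLift q
    (FreeAlgebra.lift ℂ (Sum.elim T (expAction (polyRep q R)))) (by
    intro x y hxy
    cases hxy with
    | add f g => simp [AffineFree.A]
    | mul f g => simp [AffineFree.A]
    | scalar c =>
      simp only [AffineFree.A, FreeAlgebra.lift_ι_apply, Sum.elim_inr, AlgHom.commutes]
    | one => simp [AffineFree.T, hT1]
    | length w w' hl =>
      simp only [AffineFree.T, map_mul, FreeAlgebra.lift_ι_apply, Sum.elim_inl]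
      exact hTm w w' hl
    | quadratic k a b hab =>
      simp only [AffineFree.T, map_mul, map_add, map_sub, map_one, map_zero, AlgHom.commutes,
        FreeAlgebra.lift_ι_apply, Sum.elim_inl, hTs k a b hab]
      have := lusztigOp_quadratic hq hR hr hp hab
      rw [← sub_eq_zero] at this
      rw [← this]
      noncomm_ring
    | cross k a b hab x f hf =>
      simp only [AffineFree.T, AffineFree.A, map_mul, map_sub, map_smul,
        FreeAlgebra.lift_ι_apply, Sum.elim_inl, Sum.elim_inr, hTs k a b hab]
      exact lusztigOp_bernstein hq hR hr hp hab hf)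
  refine ⟨Ψ, fun y => ?_, fun k a b hab => ?_⟩
  · rw [← expAction_monom]
    refine (affineLift_mk q _ _ _).trans ?_
    simp [AffineFree.A]
  · have e1 : Ψ (AffineHecke.T q (simple k a b)) = lusztigOp q R p k a b := by
      refine (affineLift_mk q _ _ _).trans ?_
      simp [AffineFree.T, hTs k a b hab]
    rw [e1, lusztigOp, sub_add_cancel, mul_assoc, ← Polynomial.aeval_algHom_apply,
      aeval_mul_opE (hR k a b) _ (Nat.le_add_left _ _) (hp.mono (fun z hz => ⟨k, a, b, hz⟩) le_rfl)]

theorem AffineHecke.mem_of_simple_of_theta {S : Subalgebra ℂ (AffineHecke q n)}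
    (hT : ∀ (k : Fin m) (a b : Fin (n k)), (a : ℕ) + 1 = b →
      AffineHecke.T q (simple k a b) ∈ S)
    (hX : ∀ x, AffineHecke.theta q x ∈ S) (z : AffineHecke q n) : z ∈ S := by
  refine AffineHecke.mem_of_generators q S (fun w => ?_) hX z
  induction w using weyl_induction with
  | one => rw [AffineHecke.T_one]; exact S.one_mem
  | step w k a b hab h1 hl ih =>
    rw [← AffineHecke.T_mul q w _ (by rw [hl, h1])]
    exact S.mul_mem ih (hT k a b hab)

/-- Only the generators T_s and θ_x matter. For T_s, invertibility of E(α) on the source lets every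
vector be written as E(α)x, where both actions are given by functional calculus. Applied to the
identity map this also gives uniqueness of the action. -/
theorem IsLusztigAction.intertwine {W : Type u} [AddCommGroup W] [Module ℂ W]
    [FiniteDimensional ℂ W] {R : GradedHecke q n →ₐ[ℂ] Module.End ℂ V}
    {R' : GradedHecke q n →ₐ[ℂ] Module.End ℂ W} {Ψ : AffineHecke q n →ₐ[ℂ] Module.End ℂ V}
    {Ψ' : AffineHecke q n →ₐ[ℂ] Module.End ℂ W} (h : IsLusztigAction R Ψ)
    (h' : IsLusztigAction R' Ψ') (hR : HasRealRoots (polyRep q R)) {F : V →ₗ[ℂ] W}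
    (hF : ∀ z y, F (R z y) = R' z (F y)) (z : AffineHecke q n) (y : V) :
    F (Ψ z y) = Ψ' z (F y) := by
  let S : Subalgebra ℂ (AffineHecke q n) :=
    { carrier := {z | ∀ y, F (Ψ z y) = Ψ' z (F y)}
      mul_mem' := fun h h' y => by
        rw [map_mul, map_mul, Module.End.mul_apply, Module.End.mul_apply, h, h']
      add_mem' := fun h h' y => by
        rw [map_add, map_add, LinearMap.add_apply, LinearMap.add_apply, map_add, h, h']
      algebraMap_mem' := fun c y => by
        rw [AlgHom.commutes, AlgHom.commutes, Module.algebraMap_end_apply,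
          Module.algebraMap_end_apply, map_smul] }
  refine AffineHecke.mem_of_simple_of_theta (S := S) (fun k a b hab y => ?_) (fun x y => ?_) z y
  · obtain ⟨x, rfl⟩ : ∃ x, opE (polyRep q R (rt k a b)) x = y :=
      ((Module.End.isUnit_iff _).1 (isUnit_opE (hR k a b))).2 y
    have e := LinearMap.congr_fun (h.T_add_one k a b hab) x
    have e' := LinearMap.congr_fun (h'.T_add_one k a b hab) (F x)
    simp only [Module.End.mul_apply, LinearMap.add_apply, Module.End.one_apply] at e e'
    have h2 : F (opE (polyRep q R (rt k a b)) x) = opE (polyRep q R' (rt k a b)) (F x) :=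
      opSeries_intertwine isEntire_E (fun y => hF _ y) x
    have h3 : F (opE (polyRep q R (rt k a b) + algebraMap ℂ _ (Real.log q : ℂ)) x) =
        opE (polyRep q R' (rt k a b) + algebraMap ℂ _ (Real.log q : ℂ)) (F x) := by
      refine opSeries_intertwine isEntire_E (fun y => ?_) x
      rw [LinearMap.add_apply, LinearMap.add_apply, map_add, Module.algebraMap_end_apply,
        Module.algebraMap_end_apply, map_smul]
      exact congrArg (· + _) (hF _ y)
    rw [← eq_sub_iff_add_eq] at e e'
    rw [e, h2, e', map_sub, map_add, hF, h3, h2]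
  · rw [h.theta, h'.theta]
    exact opSeries_intertwine isEntire_exp (fun y => hF _ y) y

end LusztigAction

/-! ### Existence of Lusztig's functor. -/

section Functor

open scoped ModuleCat
open MvPolynomial

variable {q : ℝ} {m : ℕ} {n : Fin m → ℕ}

theorem RealCat.hasRealRoots {M : ModuleCat.{u} (GradedHecke q n)} (hM : RealCat.{u} q n M) :
    HasRealRoots (polyRep (n := n) q (Algebra.lsmul ℂ ℂ M)) :=
  haveI := hM.1
  hasRealRoots_of_sSup q hM.2

theorem realCat_of_hasRealRoots {M : ModuleCat.{u} (GradedHecke q n)} [FiniteDimensional ℂ M]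
    (h : HasRealRoots (polyRep (n := n) q (Algebra.lsmul ℂ ℂ M))) : RealCat.{u} q n M :=
  ⟨inferInstance, sSup_eq_top_of_hasRealRoots q h⟩

theorem exists_isLusztigAction (hq : 1 < q) (π : (RealCat.{u} q n).FullSubcategory) :
    have : FiniteDimensional ℂ π.obj := π.property.1
    ∃ Ψ, IsLusztigAction (Algebra.lsmul ℂ ℂ π.obj : GradedHecke q n →ₐ[ℂ] _) Ψ :=
  have : FiniteDimensional ℂ π.obj := π.property.1
  HasRealRoots.exists_isLusztigAction hq (RealCat.hasRealRoots π.property)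

/-- Lusztig's action of `ℋ_n` on a module in `RealCat`. -/
def lusztigAction (hq : 1 < q) (π : (RealCat.{u} q n).FullSubcategory) :
    AffineHecke q n →ₐ[ℂ] Module.End ℂ π.obj :=
  (exists_isLusztigAction hq π).choose

theorem isLusztigAction_lusztigAction (hq : 1 < q) (π : (RealCat.{u} q n).FullSubcategory) :
    have : FiniteDimensional ℂ π.obj := π.property.1
    IsLusztigAction (Algebra.lsmul ℂ ℂ π.obj : GradedHecke q n →ₐ[ℂ] _) (lusztigAction hq π) :=
  (exists_isLusztigAction hq π).choose_spec

theorem lusztigAction_intertwine (hq : 1 < q) {π π' : (RealCat.{u} q n).FullSubcategory}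
    (f : π ⟶ π') (h : AffineHecke q n) (y : π.obj) :
    f.hom.hom (lusztigAction hq π h y) = lusztigAction hq π' h (f.hom.hom y) := by
  have : FiniteDimensional ℂ π.obj := π.property.1
  have : FiniteDimensional ℂ π'.obj := π'.property.1
  exact (isLusztigAction_lusztigAction hq π).intertwine (isLusztigAction_lusztigAction hq π')
    (RealCat.hasRealRoots π.property) (F := f.hom.hom.restrictScalars ℂ)
    (fun z y => f.hom.hom.map_smul z y) h y

/-- The `ℋ_n`-module underlying Lusztig's functor. -/
def lusztigModule (hq : 1 < q) (π : (RealCat.{u} q n).FullSubcategory) : ModuleCat.{u} (AffineHecke q n) :=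
  letI := Module.compHom π.obj (lusztigAction hq π).toRingHom
  ModuleCat.of (AffineHecke q n) π.obj

/-- Lusztig's functor. -/
def lusztigFunctor (hq : 1 < q) : LusztigFunctor.{u} q n where
  functor :=
    { obj := fun π => lusztigModule hq π
      map := fun {π π'} f =>
        letI := Module.compHom π.obj (lusztigAction hq π).toRingHom
        letI := Module.compHom π'.obj (lusztigAction hq π').toRingHom
        ModuleCat.ofHom
          { toFun := fun y => f.hom.hom y
            map_add' := fun x y => map_add f.hom.hom x y
            map_smul' := fun h y => lusztigAction_intertwine hq f h y }
      map_id := fun π => rfl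
      map_comp := fun f g => rfl }
  equiv π :=
    { toFun := fun y => y
      invFun := fun y => y
      left_inv := fun _ => rfl
      right_inv := fun _ => rfl
      map_add' := fun _ _ => rfl
      map_smul' := fun c y => by
        change c • y = lusztigAction hq π (algebraMap ℂ _ c) y
        rw [AlgHom.commutes, Module.algebraMap_end_apply] }
  naturality f x := rfl
  theta_smul π x y :=
    have : FiniteDimensional ℂ π.obj := π.property.1
    LinearMap.congr_fun ((isLusztigAction_lusztigAction hq π).theta x) y
  T_smul π k a b hab y := by
    have : FiniteDimensional ℂ π.obj := π.property.1
    have e := LinearMap.congr_fun ((isLusztigAction_lusztigAction hq π).T_add_one k a b hab) y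
    have h1 : (lin (root k a b) : Poly n) = rt k a b := lin_root k a b
    simp only [h1, map_add, AlgHom.commutes, add_smul, one_smul] at e ⊢
    exact e

end Functor

/-! ### Sign projectors as projections onto common kernels. -/

section Sign

variable {m : ℕ} {n : Fin m → ℕ}

theorem len_inv_le (w : Weyl n) : len w⁻¹ ≤ len w := by
  induction w using weyl_induction with
  | one => rw [inv_one]
  | step w k a b hab h1 hl ih =>
    have hs : (simple k a b : Weyl n)⁻¹ = simple k a b := inv_eq_of_mul_eq_one_left (simple_mul_self k a b)
    rw [mul_inv_rev, hs, hl]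
    have := len_mul_le (simple k a b) w⁻¹
    omega

theorem len_inv (w : Weyl n) : len w⁻¹ = len w :=
  le_antisymm (len_inv_le w) (by simpa using len_inv_le w⁻¹)

theorem len_one : len (1 : Weyl n) = 0 := by
  refine Finset.sum_eq_zero fun k _ => Finset.card_eq_zero.2 ?_
  ext ⟨c, d⟩
  simpa [mem_inversions] using fun h => le_of_lt h

theorem len_simple {k : Fin m} {a b : Fin (n k)} (hab : (a : ℕ) + 1 = b) :
    len (simple k a b : Weyl n) = 1 := by
  have := len_mul_simple (w := (1 : Weyl n)) hab (show a < b by rw [Fin.lt_def]; omega)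
  rwa [one_mul, len_one] at this

theorem len_simple_mul (w : Weyl n) {k : Fin m} {a b : Fin (n k)} (hab : (a : ℕ) + 1 = b) :
    len (simple k a b * w) = len w + 1 ∨ len (simple k a b * w) + 1 = len w := by
  have hs : (simple k a b : Weyl n)⁻¹ = simple k a b := inv_eq_of_mul_eq_one_left (simple_mul_self k a b)
  have e : len (simple k a b * w) = len (w⁻¹ * simple k a b) := by
    rw [← len_inv, mul_inv_rev, hs]
  rw [e, ← len_inv w]
  rcases lt_or_gt_of_ne (fun h => ne_of_succ hab ((w⁻¹ k).injective h)) with h | h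
  · exact Or.inl (len_mul_simple hab h)
  · exact Or.inr (len_mul_simple_of_descent hab h)

/-- Pairing w with s w: the two terms cancel, so the sum equals its negative. The hypothesis for
increasing length suffices, as one member of each pair is the shorter one. Both projectors are
covered, with c = -1/q and c = -1. -/
theorem mul_sum_len_eq_zero {A : Type*} [Ring A] [Algebra ℂ A] {k : Fin m} {a b : Fin (n k)}
    (hab : (a : ℕ) + 1 = b) {c : ℂ} {N : A} {x : Weyl n → A}
    (h : ∀ w, len (simple k a b * w) = len w + 1 → c • (N * x (simple k a b * w)) = -(N * x w)) :
    N * ∑ w, c ^ len w • x w = 0 := by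
  set f : Weyl n → A := fun w => c ^ len w • (N * x w) with hf
  have h1 : ∀ w, len (simple k a b * w) = len w + 1 → f (simple k a b * w) = -f w := by
    intro w hw
    simp only [hf]
    rw [hw, pow_succ, mul_smul, h w hw, smul_neg]
  have h2 : ∀ w, f (simple k a b * w) = -f w := by
    intro w
    rcases len_simple_mul w hab with hw | hw
    · exact h1 w hw
    · have := h1 (simple k a b * w) (by rw [← mul_assoc, simple_mul_self, one_mul, hw])
      rw [← mul_assoc, simple_mul_self, one_mul] at this
      rw [this, neg_neg]
  have h3 : ∑ w, f w = -∑ w, f w := by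
    conv_lhs => rw [← Equiv.sum_comp (Equiv.mulLeft (simple k a b))]
    simp only [Equiv.coe_mulLeft, h2, Finset.sum_neg_distrib]
  have h4 : (2 : ℂ) • ∑ w, f w = 0 := by
    rw [two_smul]
    nth_rewrite 1 [h3]
    exact neg_add_cancel _
  rw [Finset.mul_sum]
  simp only [mul_smul_comm]
  exact (smul_eq_zero.1 h4).resolve_left two_ne_zero

variable {q : ℝ}

theorem AffineHecke.T_simple_add_one_mul_signProj (hq : q ≠ 0) {k : Fin m} {a b : Fin (n k)}
    (hab : (a : ℕ) + 1 = b) : (T q (simple k a b) + 1) * signProj q n = 0 := by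
  rw [signProj, mul_smul_comm, mul_sum_len_eq_zero hab, smul_zero]
  intro w hw
  have h := quadratic q k a b hab
  rw [mul_sub, sub_eq_zero, ← Algebra.commutes, ← Algebra.smul_def] at h
  rw [← T_mul q _ w (by rw [hw, len_simple hab, add_comm]), ← mul_assoc, h, smul_mul_assoc,
    smul_smul, div_mul_cancel₀ _ (by exact_mod_cast hq), neg_one_smul]

theorem GradedHecke.t_simple_add_one_mul_signProj {k : Fin m} {a b : Fin (n k)}
    (hab : (a : ℕ) + 1 = b) : (t q (simple k a b) + 1) * signProj q n = 0 := by
  rw [signProj, mul_smul_comm, mul_sum_len_eq_zero hab, smul_zero]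
  intro w _
  rw [← t_mul, ← mul_assoc, add_mul _ _ (t q (simple k a b)), t_mul, simple_mul_self, t_one,
    one_mul, neg_one_smul, add_comm]

variable {V : Type*} [AddCommGroup V] [Module ℂ V]

/-- On a vector killed by all T_s + 1, each T_w acts by (-1)^{l(w)}, so the projector fixes it. -/
theorem AffineHecke.mem_range_signProj_iff (hq : 0 < q)
    (σ : AffineHecke q n →ₐ[ℂ] Module.End ℂ V) (y : V) :
    (∃ x, σ (signProj q n) x = y) ↔
      ∀ (k : Fin m) (a b : Fin (n k)), (a : ℕ) + 1 = b → σ (T q (simple k a b) + 1) y = 0 := by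
  constructor
  · rintro ⟨x, rfl⟩ k a b hab
    rw [← Module.End.mul_apply, ← map_mul, T_simple_add_one_mul_signProj hq.ne' hab, map_zero,
      LinearMap.zero_apply]
  · intro h
    have hw : ∀ w, σ (T q w) y = (-1 : ℂ) ^ len w • y := by
      intro w
      induction w using weyl_induction with
      | one => rw [T_one, map_one, len_one, pow_zero, one_smul, Module.End.one_apply]
      | step w k a b hab h1 hl ih =>
        have h2 := h k a b hab
        rw [map_add, map_one, LinearMap.add_apply, Module.End.one_apply,
          add_eq_zero_iff_eq_neg] at h2
        rw [← T_mul q w _ (by rw [hl, h1]), map_mul, Module.End.mul_apply, h2, map_neg, ih, hl,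
          pow_succ, mul_neg_one, neg_smul]
    refine ⟨y, ?_⟩
    -- Positivity of q makes the normalizing Poincaré sum nonzero.
    have hz : (∑ w : Weyl n, (1 / (q : ℂ)) ^ len w) ≠ 0 := by
      have : 0 < ∑ w : Weyl n, (1 / q) ^ len w :=
        Finset.sum_pos (fun w _ => by positivity) ⟨1, Finset.mem_univ 1⟩
      exact_mod_cast this.ne'
    rw [signProj, map_smul, map_sum, LinearMap.smul_apply, LinearMap.sum_apply]
    simp only [map_smul, LinearMap.smul_apply, hw, smul_smul, ← mul_pow]
    rw [← Finset.sum_smul, smul_smul, show (-1 / (q : ℂ) * -1) = 1 / q by ring,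
      inv_mul_cancel₀ hz, one_smul]

theorem GradedHecke.mem_range_signProj_iff (σ : GradedHecke q n →ₐ[ℂ] Module.End ℂ V) (y : V) :
    (∃ x, σ (signProj q n) x = y) ↔
      ∀ (k : Fin m) (a b : Fin (n k)), (a : ℕ) + 1 = b → σ (t q (simple k a b) + 1) y = 0 := by
  constructor
  · rintro ⟨x, rfl⟩ k a b hab
    rw [← Module.End.mul_apply, ← map_mul, t_simple_add_one_mul_signProj hab, map_zero,
      LinearMap.zero_apply]
  · intro h
    have hw : ∀ w, σ (t q w) y = (-1 : ℂ) ^ len w • y := by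
      intro w
      induction w using weyl_induction with
      | one => rw [t_one, map_one, len_one, pow_zero, one_smul, Module.End.one_apply]
      | step w k a b hab h1 hl ih =>
        have h2 := h k a b hab
        rw [map_add, map_one, LinearMap.add_apply, Module.End.one_apply,
          add_eq_zero_iff_eq_neg] at h2
        rw [← t_mul q w, map_mul, Module.End.mul_apply, h2, map_neg, ih, hl,
          pow_succ, mul_neg_one, neg_smul]
    refine ⟨y, ?_⟩
    rw [signProj, map_smul, map_sum, LinearMap.smul_apply, LinearMap.sum_apply]
    simp only [map_smul, LinearMap.smul_apply, hw, smul_smul, ← mul_pow]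
    rw [← Finset.sum_smul, smul_smul, neg_one_mul, neg_neg]
    simp only [one_pow, Finset.sum_const, Finset.card_univ, nsmul_eq_mul, mul_one]
    rw [inv_mul_cancel₀ (Nat.cast_ne_zero.2 Fintype.card_ne_zero), one_smul]

end Sign

/-! ### Restriction to block subalgebras. -/

section Embedding

open MvPolynomial

variable {m : ℕ} {n p d : Fin m → ℕ} {q : ℝ} (h : ∀ k, d k + p k ≤ n k)

theorem GradedHecke.emb_ofPoly (f : Poly p) :
    emb q h (ofPoly q p f) = ofPoly q n (rename (embCoord h) f) := by
  change emb q h (mk q p _) = _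
  rw [emb, liftHom_mk]
  simp [GradedFree.A]

theorem rename_rt (k : Fin m) (a b : Fin (p k)) :
    rename (embCoord h) (rt k a b) = rt k (blk h k a) (blk h k b) := by
  rw [map_sub, rename_X, rename_X]; rfl

theorem rename_linZ (y : Coord p → ℤ) : rename (embCoord h) (linZ y) = linZ (embVec h y) := by
  rw [GradedHecke.rename_lin]
  congr 1
  funext c
  by_cases hc : ∃ c', embCoord h c' = c
  · obtain ⟨c', rfl⟩ := hc
    rw [embVec_apply, embVec_apply]
  · rw [embVec_apply_of_notMem h _ _ hc, embVec_apply_of_notMem h _ _ hc, Int.cast_zero]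

theorem act_rt (w : Weyl n) (k : Fin m) (a b : Fin (n k)) :
    act w (rt k a b) = rt k (w k a) (w k b) := by
  rw [map_sub, rename_X, rename_X]; rfl

variable {V : Type u} [AddCommGroup V] [Module ℂ V] {R : GradedHecke q n →ₐ[ℂ] Module.End ℂ V}

theorem polyRep_emb (f : Poly p) :
    polyRep q (R.comp (GradedHecke.emb q h)) f = polyRep q R (rename (embCoord h) f) :=
  congrArg R (GradedHecke.emb_ofPoly h f)

theorem HasRealRoots.emb (hR : HasRealRoots (polyRep q R)) :
    HasRealRoots (polyRep q (R.comp (GradedHecke.emb q h))) := by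
  intro k a b μ hμ
  rw [polyRep_emb, rename_rt] at hμ
  exact hR k _ _ μ hμ

theorem HasRealRoots.of_injective {W : Type*} [AddCommGroup W] [Module ℂ W]
    {ρ : Poly n →ₐ[ℂ] Module.End ℂ V} {ρ' : Poly n →ₐ[ℂ] Module.End ℂ W} (hρ : HasRealRoots ρ)
    {F : W →ₗ[ℂ] V} (hF : Function.Injective F) (h : ∀ f y, F (ρ' f y) = ρ f (F y)) :
    HasRealRoots ρ' := by
  intro k a b μ hμ
  obtain ⟨y, hy⟩ := hμ.exists_hasEigenvector
  refine hρ k a b μ (Module.End.hasEigenvalue_of_hasEigenvector (x := F y)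
    ⟨Module.End.mem_eigenspace_iff.2 ?_, fun h0 => hy.2 (hF (by rw [h0, map_zero]))⟩)
  rw [← h, hy.apply_eq_smul, map_smul]

variable [FiniteDimensional ℂ V]

/-- The block embeddings send simple roots to simple roots and lattice vectors to lattice vectors,
so Lusztig's formulas are preserved by restriction. -/
theorem IsLusztigAction.emb {Ψ : AffineHecke q n →ₐ[ℂ] Module.End ℂ V}
    (hΨ : IsLusztigAction R Ψ) :
    IsLusztigAction (R.comp (GradedHecke.emb q h)) (Ψ.comp (AffineHecke.emb q h)) where
  theta y := by
    rw [polyRep_emb, rename_linZ, AlgHom.comp_apply, AffineHecke.emb_theta, hΨ.theta]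
  T_add_one k a b hab := by
    rw [polyRep_emb, rename_rt, AlgHom.comp_apply, AlgHom.comp_apply R (GradedHecke.emb q h), AffineHecke.emb_T,
      GradedHecke.emb_t, embWeyl_simple]
    exact hΨ.T_add_one k _ _ (by rw [blk_val, blk_val]; omega)

theorem IsLusztigAction.T_add_one_eq {Ψ : AffineHecke q n →ₐ[ℂ] Module.End ℂ V}
    (hΨ : IsLusztigAction R Ψ) (hR : HasRealRoots (polyRep q R)) {p : Polynomial ℂ} {r : ℕ}
    (hr : Module.finrank ℂ V ≤ r) (hp : Approx p (rootSpec (polyRep q R)) r (jetPhi (Real.log q)))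
    {k : Fin m} {a b : Fin (n k)} (hab : (a : ℕ) + 1 = b) :
    Ψ (AffineHecke.T q (simple k a b)) + 1 = (R (GradedHecke.t q (simple k a b)) + 1) *
      polyRep q R (Polynomial.aeval (rt k a b) p) := by
  refine (isUnit_opE (hR k a b)).mul_right_cancel ?_
  rw [hΨ.T_add_one k a b hab, mul_assoc, ← Polynomial.aeval_algHom_apply,
    aeval_mul_opE (hR k a b) _ hr (hp.mono (fun z hz => ⟨k, a, b, hz⟩) le_rfl)]

end Embedding

/-! ### The operator B relating the two sign spaces. -/

section Twist

open MvPolynomial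

variable {m : ℕ} {n i d : Fin m → ℕ} {q : ℝ}

/-- The positive roots of `R_i`. -/
def posRoots (i : Fin m → ℕ) : Finset (Σ k : Fin m, Fin (i k) × Fin (i k)) :=
  Finset.univ.filter fun x => x.2.1 < x.2.2

/-- The product of the `p(β)` over the positive roots `β` of `R_i`, embedded in `R_n`. -/
def rootProd (h : ∀ k, d k + i k ≤ n k) (p : Polynomial ℂ)
    (s : Finset (Σ k : Fin m, Fin (i k) × Fin (i k))) : Poly n :=
  ∏ x ∈ s, Polynomial.aeval (rt x.1 (blk h x.1 x.2.1) (blk h x.1 x.2.2)) p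

/-- The action of the Weyl group on pairs of coordinates. -/
def rootPerm (w : Weyl i) : Equiv.Perm (Σ k : Fin m, Fin (i k) × Fin (i k)) :=
  Equiv.sigmaCongrRight fun k => (w k).prodCongr (w k)

theorem act_embWeyl_rootProd (h : ∀ k, d k + i k ≤ n k) (p : Polynomial ℂ)
    (s : Finset (Σ k : Fin m, Fin (i k) × Fin (i k))) (w : Weyl i) :
    act (embWeyl h w) (rootProd h p s) = rootProd h p (s.map (rootPerm w).toEmbedding) := by
  rw [rootProd, map_prod, rootProd, Finset.prod_map]
  refine Finset.prod_congr rfl fun x _ => ?_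
  rw [act_aeval, act_rt, embWeyl_apply, embWeyl_apply]
  rfl

theorem act_rootProd_of_disjoint {i' d' : Fin m → ℕ} (h : ∀ k, d k + i k ≤ n k)
    (h' : ∀ k, d' k + i' k ≤ n k) (hd : ∀ k, d' k + i' k ≤ d k) (p : Polynomial ℂ)
    (s : Finset (Σ k : Fin m, Fin (i k) × Fin (i k))) (w : Weyl i') :
    act (embWeyl h' w) (rootProd h p s) = rootProd h p s := by
  have hn : ∀ k a, embWeyl h' w k (blk h k a) = blk h k a := fun k a =>
    embWeyl_apply_of_notMem _ _ _ _ fun hcon => by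
      have h1 := (mem_range_blk h' k _).1 hcon
      have := hd k
      rw [blk_val] at h1
      omega
  rw [rootProd, map_prod]
  exact Finset.prod_congr rfl fun x _ => by rw [act_aeval, act_rt, hn, hn]

theorem swap_lt_swap {N : ℕ} {a b c e : Fin N} (hab : (a : ℕ) + 1 = b) (hce : c < e)
    (hne : ¬(c = a ∧ e = b)) : Equiv.swap a b c < Equiv.swap a b e := by
  simp only [Equiv.swap_apply_def, Fin.lt_def, Fin.ext_iff] at *
  split_ifs <;> simp_all <;> omega

/-- A simple reflection permutes the positive roots other than its own. By cardinality, one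
inclusion is enough. -/
theorem map_posRoots_erase {k : Fin m} {a b : Fin (i k)} (hab : (a : ℕ) + 1 = b) :
    ((posRoots i).erase ⟨k, a, b⟩).map (rootPerm (simple k a b)).toEmbedding =
      (posRoots i).erase ⟨k, a, b⟩ := by
  refine Finset.eq_of_subset_of_card_le ?_ (Finset.card_map _).ge
  intro y hy
  obtain ⟨⟨k', c, e⟩, hx, rfl⟩ := Finset.mem_map.1 hy
  obtain ⟨hne, hx⟩ := Finset.mem_erase.1 hx
  have hlt : c < e := (Finset.mem_filter.1 hx).2
  change (⟨k', simple k a b k' c, simple k a b k' e⟩ : Σ k : Fin m, Fin (i k) × Fin (i k)) ∈ _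
  by_cases hk : k' = k
  · subst hk
    rw [simple_apply_same]
    refine Finset.mem_erase.2 ⟨fun heq => ?_, Finset.mem_filter.2 ⟨Finset.mem_univ _,
      swap_lt_swap hab hlt fun h => hne (by rw [h.1, h.2])⟩⟩
    obtain ⟨h1, h2⟩ := Prod.mk.inj (eq_of_heq (Sigma.mk.inj heq).2)
    rw [Equiv.swap_apply_eq_iff, Equiv.swap_apply_left] at h1
    rw [Equiv.swap_apply_eq_iff, Equiv.swap_apply_right] at h2
    rw [h1, h2, Fin.lt_def] at hlt
    omega
  · rw [simple_apply_of_ne hk]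
    exact Finset.mem_erase.2 ⟨fun heq => hk (Sigma.mk.inj heq).1,
      Finset.mem_filter.2 ⟨Finset.mem_univ _, hlt⟩⟩

variable {V : Type u} [AddCommGroup V] [Module ℂ V] [FiniteDimensional ℂ V]

/-- φ(β) is a quotient of E(β + c) and E(β), both invertible: c is real, so the shifted spectrum
stays real. -/
theorem isUnit_aeval_root {ρ : Poly n →ₐ[ℂ] Module.End ℂ V} (hρ : HasRealRoots ρ) {c : ℝ}
    {p : Polynomial ℂ} {r : ℕ} (hr : Module.finrank ℂ V ≤ r)
    (hp : Approx p (rootSpec ρ) r (jetPhi c)) (k : Fin m) (a b : Fin (n k)) :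
    IsUnit (ρ (Polynomial.aeval (rt k a b) p)) := by
  have h := aeval_mul_opE (hρ k a b) c hr (hp.mono (fun z hz => ⟨k, a, b, hz⟩) le_rfl)
  have h1 : IsUnit (opE (ρ (rt k a b) + algebraMap ℂ _ (c : ℂ))) := isUnit_opE fun z hz => by
    simpa using hρ k a b _ (hasEigenvalue_sub_of_add hz)
  rw [← h, Polynomial.aeval_algHom_apply] at h1
  obtain ⟨u, hu⟩ := isUnit_opE (hρ k a b)
  rw [← hu] at h1
  exact (Units.isUnit_mul_units _ u).1 h1

theorem isUnit_rootProd (h : ∀ k, d k + i k ≤ n k) {ρ : Poly n →ₐ[ℂ] Module.End ℂ V}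
    (hρ : HasRealRoots ρ) {c : ℝ} {p : Polynomial ℂ} {r : ℕ} (hr : Module.finrank ℂ V ≤ r)
    (hp : Approx p (rootSpec ρ) r (jetPhi c)) (s) : IsUnit (ρ (rootProd h p s)) := by
  classical
  induction s using Finset.induction_on with
  | empty => rw [rootProd, Finset.prod_empty, map_one]; exact isUnit_one
  | insert x s hx ih =>
    rw [rootProd, Finset.prod_insert hx, map_mul]
    exact (isUnit_aeval_root hρ hr hp _ _ _).mul ih

theorem exists_twist_approx (ρ : Poly n →ₐ[ℂ] Module.End ℂ V) (c : ℝ) :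
    ∃ p, Approx p (rootSpec ρ) (Module.finrank ℂ V) (jetPhi c) :=
  exists_approx _ finite_rootSpec _ _

/-- The operator `∏_β E(β + c) E(β)⁻¹`, the product being over the positive roots `β` of `R_i`. -/
def twist (h : ∀ k, d k + i k ≤ n k) (ρ : Poly n →ₐ[ℂ] Module.End ℂ V) (c : ℝ) : Module.End ℂ V :=
  ρ (rootProd h (exists_twist_approx ρ c).choose (posRoots i))

/-- The twist was defined with a polynomial chosen for ρ alone. Independence of that choice permits
comparison across modules. -/
theorem twist_eq (h : ∀ k, d k + i k ≤ n k) {ρ : Poly n →ₐ[ℂ] Module.End ℂ V} {c : ℝ}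
    {p : Polynomial ℂ} {r : ℕ} (hr : Module.finrank ℂ V ≤ r)
    (hp : Approx p (rootSpec ρ) r (jetPhi c)) : twist h ρ c = ρ (rootProd h p (posRoots i)) := by
  rw [twist]
  generalize posRoots i = s
  classical
  induction s using Finset.induction_on with
  | empty => rfl
  | insert x s hx ih =>
    simp only [rootProd, Finset.prod_insert hx, map_mul] at ih ⊢
    rw [ih, ← Polynomial.aeval_algHom_apply, ← Polynomial.aeval_algHom_apply]
    congr 1
    exact aeval_eq_of_approx _ le_rfl
      ((exists_twist_approx ρ c).choose_spec.mono (fun z hz => ⟨_, _, _, hz⟩) le_rfl)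
      (hp.mono (fun z hz => ⟨_, _, _, hz⟩) hr)

theorem isUnit_twist (h : ∀ k, d k + i k ≤ n k) {ρ : Poly n →ₐ[ℂ] Module.End ℂ V}
    (hρ : HasRealRoots ρ) (c : ℝ) : IsUnit (twist h ρ c) :=
  isUnit_rootProd h hρ le_rfl (exists_twist_approx ρ c).choose_spec _

theorem twist_intertwine (h : ∀ k, d k + i k ≤ n k) {W : Type u} [AddCommGroup W] [Module ℂ W]
    [FiniteDimensional ℂ W] {ρ : Poly n →ₐ[ℂ] Module.End ℂ V} {ρ' : Poly n →ₐ[ℂ] Module.End ℂ W}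
    {F : V →ₗ[ℂ] W} (hF : ∀ f y, F (ρ f y) = ρ' f (F y)) (c : ℝ) (y : V) :
    F (twist h ρ c y) = twist h ρ' c (F y) := by
  obtain ⟨p, hp⟩ := exists_approx (rootSpec ρ ∪ rootSpec ρ')
    (finite_rootSpec.union finite_rootSpec) (Module.finrank ℂ V + Module.finrank ℂ W) (jetPhi c)
  rw [twist_eq h (Nat.le_add_right _ _) (hp.mono Set.subset_union_left le_rfl),
    twist_eq h (Nat.le_add_left _ _) (hp.mono Set.subset_union_right le_rfl), hF]

variable {R : GradedHecke q n →ₐ[ℂ] Module.End ℂ V} {Ψ : AffineHecke q n →ₐ[ℂ] Module.End ℂ V}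

/-- The Weyl group of the preceding coordinates fixes every root in the product, and polynomials
commute with each other. -/
theorem twist_commute_emb {i' d' : Fin m → ℕ} (h : ∀ k, d k + i k ≤ n k)
    (h' : ∀ k, d' k + i' k ≤ n k) (hd : ∀ k, d' k + i' k ≤ d k) (c : ℝ) (z : GradedHecke q i') :
    Commute (twist h (polyRep q R) c) (R (GradedHecke.emb q h' z)) := by
  set B := twist h (polyRep q R) c with hB
  have key := GradedHecke.mem_of_generators q
    ((Subalgebra.centralizer ℂ {B}).comap (R.comp (GradedHecke.emb q h'))) ?_ ?_ z
  · exact (Subalgebra.mem_centralizer_iff ℂ).1 key _ rfl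
  · intro w
    refine (Subalgebra.mem_centralizer_iff ℂ).2 ?_
    rintro _ rfl
    change Commute B (R (GradedHecke.emb q h' _))
    induction w using weyl_induction with
    | one => rw [GradedHecke.t_one, map_one, map_one]; exact Commute.one_right _
    | step w k a b hab _ _ ih =>
      rw [← GradedHecke.t_mul, map_mul, map_mul]
      refine ih.mul_right ?_
      rw [GradedHecke.emb_t, embWeyl_simple]
      refine polyRep_commute_t q R (by rw [blk_val, blk_val]; omega) ?_
      rw [← embWeyl_simple, act_rootProd_of_disjoint h h' hd]
  · intro v
    refine (Subalgebra.mem_centralizer_iff ℂ).2 ?_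
    rintro _ rfl
    change B * R (GradedHecke.emb q h' _) = R (GradedHecke.emb q h' _) * B
    rw [GradedHecke.emb_lin]
    exact polyRep_commute q R _ _

/-- The heart of the comparison: (t_s + 1) B = B' (T_s + 1), where B' omits the root of s and is
therefore s-invariant and invertible. -/
theorem IsLusztigAction.T_add_one_apply_eq_zero_iff (hΨ : IsLusztigAction R Ψ)
    (hR : HasRealRoots (polyRep q R)) (h : ∀ k, d k + i k ≤ n k) {k : Fin m} {a b : Fin (i k)}
    (hab : (a : ℕ) + 1 = b) (y : V) :
    Ψ (AffineHecke.emb q h (AffineHecke.T q (simple k a b) + 1)) y = 0 ↔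
      R (GradedHecke.emb q h (GradedHecke.t q (simple k a b) + 1))
        (twist h (polyRep q R) (Real.log q) y) = 0 := by
  obtain ⟨p, hp⟩ := exists_twist_approx (polyRep q R) (Real.log q)
  have hab' : (blk h k a : ℕ) + 1 = blk h k b := by rw [blk_val, blk_val]; omega
  have hmem : (⟨k, a, b⟩ : Σ k : Fin m, Fin (i k) × Fin (i k)) ∈ posRoots i :=
    Finset.mem_filter.2 ⟨Finset.mem_univ _, show a < b by rw [Fin.lt_def]; omega⟩
  have hu := isUnit_rootProd h hR le_rfl hp ((posRoots i).erase ⟨k, a, b⟩)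
  have hc := polyRep_commute_t q R hab' (f := rootProd h p ((posRoots i).erase ⟨k, a, b⟩))
    (by rw [← embWeyl_simple, act_embWeyl_rootProd, map_posRoots_erase hab])
  have e : R (GradedHecke.emb q h (GradedHecke.t q (simple k a b) + 1)) *
      twist h (polyRep q R) (Real.log q) =
      polyRep q R (rootProd h p ((posRoots i).erase ⟨k, a, b⟩)) *
        Ψ (AffineHecke.emb q h (AffineHecke.T q (simple k a b) + 1)) := by
    rw [twist_eq h le_rfl hp, rootProd, ← Finset.prod_erase_mul _ _ hmem, map_mul]
    change _ * (polyRep q R (rootProd h p _) * _) = _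
    simp only [map_add, map_one, GradedHecke.emb_t, AffineHecke.emb_T, embWeyl_simple]
    rw [hΨ.T_add_one_eq hR le_rfl hp hab', ← mul_assoc, ← mul_assoc, add_mul, mul_add, hc.eq,
      one_mul, mul_one]
  have e' := LinearMap.congr_fun e y
  rw [Module.End.mul_apply, Module.End.mul_apply] at e'
  rw [e']
  -- B' is injective, hence does not affect the kernel.
  exact (map_eq_zero_iff _ ((Module.End.isUnit_iff _).1 hu).1).symm

/-- The twist maps the sign space of the affine Hecke algebra onto that of the graded one. -/
theorem IsLusztigAction.mem_range_signProj_iff (hq : 0 < q) (hΨ : IsLusztigAction R Ψ)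
    (hR : HasRealRoots (polyRep q R)) (h : ∀ k, d k + i k ≤ n k) (y : V) :
    (∃ x, Ψ (AffineHecke.emb q h (AffineHecke.signProj q i)) x = y) ↔
      ∃ x, R (GradedHecke.emb q h (GradedHecke.signProj q i)) x =
        twist h (polyRep q R) (Real.log q) y := by
  refine (AffineHecke.mem_range_signProj_iff hq (Ψ.comp (AffineHecke.emb q h)) y).trans
    (Iff.trans ?_ (GradedHecke.mem_range_signProj_iff (R.comp (GradedHecke.emb q h)) _).symm)
  exact forall_congr' fun k => forall_congr' fun a => forall_congr' fun b =>
    forall_congr' fun hab => hΨ.T_add_one_apply_eq_zero_iff hR h hab y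

end Twist

/-! ### The isomorphism of derivatives and its naturality. -/

section Derivative

open scoped ModuleCat

variable {q : ℝ} {m : ℕ} {n i : Fin m → ℕ}

/-- The inclusion of `gBZ(π)` in `π`. -/
def gBZIncl (hi : ∀ k, i k ≤ n k) (M : ModuleCat.{u} (GradedHecke q n)) :
    (gBZ q hi).obj M →ₗ[ℂ] M where
  toFun x := x.1
  map_add' _ _ := rfl
  map_smul' c x := by
    change (GradedHecke.emb q (offset_fst hi) (algebraMap ℂ _ c)) • (show M from x.1) = _
    rw [AlgHom.commutes]
    rfl

/-- gBZ(π) embeds in the restriction of π, so its root eigenvalues occur among those of π. -/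
theorem realCat_gBZ (hi : ∀ k, i k ≤ n k) {M : ModuleCat.{u} (GradedHecke q n)}
    (hM : RealCat.{u} q n M) : RealCat.{u} q (n - i) ((gBZ q hi).obj M) := by
  have := hM.1
  have hj : Function.Injective (gBZIncl hi M) := Subtype.val_injective
  have := FiniteDimensional.of_injective _ hj
  refine realCat_of_hasRealRoots
    (((RealCat.hasRealRoots hM).emb (offset_fst hi)).of_injective hj fun f y => rfl)

/-- The action of `ℋ_n` on the vector space `π` through a Lusztig functor. -/
def LusztigFunctor.action (L : LusztigFunctor.{u} q n) (π : (RealCat.{u} q n).FullSubcategory) :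
    AffineHecke q n →ₐ[ℂ] Module.End ℂ π.obj :=
  ((L.equiv π).symm.conjAlgEquiv ℂ).toAlgHom.comp (Algebra.lsmul ℂ ℂ (L.functor.obj π))

theorem LusztigFunctor.equiv_action (L : LusztigFunctor.{u} q n)
    (π : (RealCat.{u} q n).FullSubcategory) (h : AffineHecke q n) (y : π.obj) :
    L.equiv π (L.action π h y) = h • L.equiv π y :=
  (L.equiv π).apply_symm_apply _

/-- Everything is derived from the two formulas, so the comparison holds for any choice of Lusztig
functors. -/
theorem LusztigFunctor.isLusztigAction (L : LusztigFunctor.{u} q n)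
    (π : (RealCat.{u} q n).FullSubcategory) :
    have : FiniteDimensional ℂ π.obj := π.property.1
    IsLusztigAction (Algebra.lsmul ℂ ℂ π.obj) (L.action π) := by
  have : FiniteDimensional ℂ π.obj := π.property.1
  constructor
  · intro x
    ext y
    exact (L.equiv π).injective ((L.equiv_action π _ y).trans (L.theta_smul π x y))
  · intro k a b hab
    ext y
    refine (L.equiv π).injective ?_
    have e := L.T_smul π k a b hab y
    have h1 : (lin (root k a b) : Poly n) = rt k a b := lin_root k a b
    simp only [h1, map_add, AlgHom.commutes, add_smul, one_smul, ← L.equiv_action, map_one,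
      LinearMap.add_apply, Module.End.one_apply] at e
    simp only [Module.End.mul_apply, LinearMap.add_apply, Module.End.one_apply, map_add] at e ⊢
    exact e

/-- The operator by which the sign spaces of the affine and of the graded algebra differ. -/
def gBZTwist (hi : ∀ k, i k ≤ n k) (π : (RealCat.{u} q n).FullSubcategory) :
    Module.End ℂ π.obj :=
  have : FiniteDimensional ℂ π.obj := π.property.1
  twist (offset_snd hi) (polyRep (n := n) q (Algebra.lsmul ℂ ℂ π.obj)) (Real.log q)

variable (hq : 0 < q) (hi : ∀ k, i k ≤ n k) (L : LusztigFunctor.{u} q n)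
  (L' : LusztigFunctor.{u} q (n - i)) (π : (RealCat.{u} q n).FullSubcategory)
  (hN : RealCat.{u} q (n - i) ((gBZ q hi).obj π.obj))

include hq in
theorem mem_BZ_iff (y : π.obj) :
    (∃ x : L.functor.obj π, AffineHecke.emb q (offset_snd hi) (AffineHecke.signProj q i) • x =
      L.equiv π y) ↔
    ∃ x : π.obj, GradedHecke.emb q (offset_snd hi) (GradedHecke.signProj q i) • x =
      gBZTwist hi π y := by
  have : FiniteDimensional ℂ π.obj := π.property.1
  refine Iff.trans ?_ ((L.isLusztigAction π).mem_range_signProj_iff hq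
    (RealCat.hasRealRoots π.property) (offset_snd hi) y)
  constructor
  · rintro ⟨x, hx⟩
    obtain ⟨x, rfl⟩ := (L.equiv π).surjective x
    exact ⟨x, (L.equiv π).injective ((L.equiv_action π _ x).trans hx)⟩
  · rintro ⟨x, rfl⟩
    exact ⟨L.equiv π x, (L.equiv_action π _ x).symm⟩

theorem bijective_gBZTwist : Function.Bijective (gBZTwist hi π) :=
  have : FiniteDimensional ℂ π.obj := π.property.1
  (Module.End.isUnit_iff _).1
    (isUnit_twist (offset_snd hi) (RealCat.hasRealRoots π.property) (Real.log q))

/-- The inclusion of gBZ(π) in π and the twist of π both commute with ℍ_{n-i}. By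
`IsLusztigAction.intertwine` both commute with the corresponding affine actions. -/
theorem gBZTwist_action (h : AffineHecke q (n - i)) (y : π.obj) (x : (gBZ q hi).obj π.obj)
    (hx : gBZIncl hi π.obj x = gBZTwist hi π y) :
    gBZIncl hi π.obj (L'.action ⟨_, hN⟩ h x) =
      gBZTwist hi π (L.action π (AffineHecke.emb q (offset_fst hi) h) y) := by
  have : FiniteDimensional ℂ π.obj := π.property.1
  have : FiniteDimensional ℂ ((gBZ q hi).obj π.obj) := hN.1
  have hL := (L.isLusztigAction π).emb (offset_fst hi)
  have h1 := (L'.isLusztigAction ⟨_, hN⟩).intertwine hL (RealCat.hasRealRoots hN)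
    (F := gBZIncl hi π.obj) (fun z y => rfl) h x
  have h2 := hL.intertwine hL ((RealCat.hasRealRoots π.property).emb (offset_fst hi))
    (F := gBZTwist hi π) (fun z y => LinearMap.congr_fun
      (twist_commute_emb (R := Algebra.lsmul ℂ ℂ π.obj) (offset_snd hi) (offset_fst hi) offset_disj (Real.log q) z).eq y) h y
  exact h1.trans ((congrArg _ hx).trans h2.symm)

/-- The isomorphism `BZ(Λ(π)) ≅ Λ(gBZ(π))`. -/
def derivativeEquiv : (BZ q hi).obj (L.functor.obj π) ≃ₗ[AffineHecke q (n - i)]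
    L'.functor.obj ⟨(gBZ q hi).obj π.obj, hN⟩ :=
  LinearEquiv.ofBijective
    -- The underlying map is B, and its image lies in the graded sign space by `mem_BZ_iff`.
    { toFun := fun x => L'.equiv ⟨_, hN⟩ ⟨gBZTwist hi π ((L.equiv π).symm x.1),
        (mem_BZ_iff hq hi L π _).1 
          (x.2.imp fun _ h => h.trans ((L.equiv π).apply_symm_apply x.1).symm)⟩
      map_add' := fun x y => by
        refine Eq.trans (congrArg _ (Subtype.ext ?_)) ((L'.equiv ⟨_, hN⟩).map_add _ _)
        exact (congrArg _ ((L.equiv π).symm.map_add x.1 y.1)).trans (map_add (gBZTwist hi π) _ _)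
      map_smul' := fun h x => by
        refine Eq.trans (congrArg _ (Subtype.ext ?_)) (L'.equiv_action ⟨_, hN⟩ h _)
        refine Eq.trans ?_ (gBZTwist_action hi L L' π hN h _ _ rfl).symm
        refine congrArg (gBZTwist hi π) ((L.equiv π).injective ?_)
        refine ((L.equiv π).apply_symm_apply _).trans (Eq.trans ?_ (L.equiv_action π _ _).symm)
        exact congrArg (AffineHecke.emb q (offset_fst hi) h • ·)
          ((L.equiv π).apply_symm_apply x.1).symm }
    ⟨fun x y hxy => Subtype.ext ((L.equiv π).symm.injective ((bijective_gBZTwist hi π).1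
        (congrArg Subtype.val ((L'.equiv ⟨_, hN⟩).injective hxy)))),
      fun z => by
        obtain ⟨x, rfl⟩ := (L'.equiv ⟨_, hN⟩).surjective z
        -- The B-preimage of a graded sign vector is an affine sign vector, by the reverse direction
        -- of `mem_BZ_iff`.
        obtain ⟨y, hy⟩ := (bijective_gBZTwist hi π).2 (gBZIncl hi π.obj x)
        refine ⟨⟨L.equiv π y, (mem_BZ_iff hq hi L π y).2 (by rw [hy]; exact x.2)⟩, ?_⟩
        refine congrArg (L'.equiv ⟨_, hN⟩) (Subtype.ext ?_)
        exact (congrArg (gBZTwist hi π) ((L.equiv π).symm_apply_apply y)).trans hy⟩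

theorem gBZTwist_naturality {π π' : (RealCat.{u} q n).FullSubcategory} (f : π ⟶ π') (y : π.obj) :
    f.hom.hom (gBZTwist hi π y) = gBZTwist hi π' (f.hom.hom y) :=
  have : FiniteDimensional ℂ π.obj := π.property.1
  have : FiniteDimensional ℂ π'.obj := π'.property.1
  twist_intertwine (offset_snd hi) (F := f.hom.hom.restrictScalars ℂ)
    (fun _ y => f.hom.hom.map_smul _ y) (Real.log q) y

/-- The natural isomorphism `BZ(Λ(π)) ≅ Λ(gBZ(π))`. -/
def derivativeIso (P : ObjectProperty (ModuleCat.{u} (GradedHecke q n)))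
    (hP : P ≤ RealCat.{u} q n)
    (hg : ∀ π : P.FullSubcategory, RealCat.{u} q (n - i) ((P.ι ⋙ gBZ q hi).obj π)) :
    ObjectProperty.ιOfLE hP ⋙ L.functor ⋙ BZ q hi ≅
      (RealCat.{u} q (n - i)).lift (P.ι ⋙ gBZ q hi) hg ⋙ L'.functor :=
  NatIso.ofComponents
    (fun π => (derivativeEquiv hq hi L L' ((ObjectProperty.ιOfLE hP).obj π)
      (hg π)).toModuleIso) (by
    intro π π' f
    ext x
    change L'.equiv _ _ = (L'.functor.map _).hom (L'.equiv _ _)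
    refine Eq.trans (congrArg (L'.equiv _) (Subtype.ext ?_)) (L'.naturality
      (((RealCat q (n - i)).lift (P.ι ⋙ gBZ q hi) hg).map f) _).symm
    have e := (congrArg (L.functor.map ((ObjectProperty.ιOfLE hP).map f)).hom
      ((L.equiv _).apply_symm_apply x.1).symm).trans
      (L.naturality ((ObjectProperty.ιOfLE hP).map f) ((L.equiv _).symm x.1))
    refine Eq.trans ?_ (gBZTwist_naturality hi ((ObjectProperty.ιOfLE hP).map f) _).symm
    exact congrArg (gBZTwist hi _) ((LinearEquiv.symm_apply_eq _).2 e))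

end Derivative

end HeckeBZ

end

/-! ### The comparison theorem. -/

theorem theorem6p6 (q : ℝ) (hq : 1 < q) {m : ℕ} (n i : Fin m → ℕ) (hi : ∀ k, i k ≤ n k)
    (ζ : Coord n → ℂ) (hζ : IsRealPoint n ζ) :
    Nonempty (LusztigFunctor.{u} q n) ∧ Nonempty (LusztigFunctor.{u} q (n - i)) ∧
    ∃ hg : ∀ π : (CentralCat.{u} q n ζ).FullSubcategory,
        RealCat.{u} q (n - i) (((CentralCat.{u} q n ζ).ι ⋙ gBZ.{u} q hi).obj π),
      ∀ (L : LusztigFunctor.{u} q n) (L' : LusztigFunctor.{u} q (n - i)),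
        Nonempty (ObjectProperty.ιOfLE (centralCat_le_realCat q n hζ) ⋙ L.functor ⋙ BZ q hi ≅
          (RealCat.{u} q (n - i)).lift ((CentralCat.{u} q n ζ).ι ⋙ gBZ q hi) hg ⋙
            L'.functor) := by
  have hg : ∀ π : (CentralCat.{u} q n ζ).FullSubcategory,
      RealCat.{u} q (n - i) (((CentralCat.{u} q n ζ).ι ⋙ gBZ.{u} q hi).obj π) :=
    fun π => realCat_gBZ hi (centralCat_le_realCat q n hζ _ π.property)
  exact ⟨⟨lusztigFunctor hq⟩, ⟨lusztigFunctor hq⟩, hg, fun L L' =>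
    ⟨derivativeIso (zero_lt_one.trans hq) hi L L' _ (centralCat_le_realCat q n hζ) hg⟩⟩
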